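/- Let $k$ be an algebraically closed field (of any characteristic) and $R=k[x_0,x_1,x_2]$. For a finite set $X$ of points of $\mathbb P^2=\mathbb P^2_k$ and $m\ge 1$, let $mX$ be the subscheme with homogeneous ideal $I_{mX}=\bigcap_{p\in X} I(p)^m$, let $h_{mX}(d)=\dim_k (R/I_{mX})_d$ be its Hilbert function, and let $\Delta h_{mX}(d)=h_{mX}(d)-h_{mX}(d-1)$, with $h_{mX}(-1)=0$. Let $t,\delta$ be integers with $0\le\delta\le 2$ and $t>5-\delta$. Let $C\subset\mathbb P^2$ be an irreducible cubic curve and let $X$ be a set of $3t+\delta$ distinct points of $C$, none of which is a singular point of $C$. Assume that $\Delta h_X(0)=1$, $\Delta h_X(1)=2$, $\Delta h_X(d)=3$ for $2\le d\le t$, $\Delta h_X(t+1)=\delta$, and $\Delta h_X(d)=0$ for $d>t+1$. Then $\Delta h_{2X}(d)=d+1$ for $0\le d\le 5$, $\Delta h_{2X}(d)=6$ for $5\le d\le t+3$, $\Delta h_{2X}(t+4)=3+\delta$, and $\Delta h_{2X}(d)=3$ for $t+5\le d\le 2t+\delta-1$. Moreover: (a) If $\delta=1$ or $\delta=2$, then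 $\Delta h_{2X}(2t+\delta)=3-\delta$ and $\Delta h_{2X}(d)=0$ for all $d>2t+\delta$. (b) If $\delta=0$, then one of the following holds: (i) $\Delta h_{2X}(2t)=3$ and $\Delta h_{2X}(d)=0$ for all $d>2t$; (ii) $\Delta h_{2X}(2t)=2$, $\Delta h_{2X}(2t+1)=1$ and $\Delta h_{2X}(d)=0$ for all $d>2t+1$. Both possibilities occur: for every $t>5$ there are a smooth cubic $C$ and a set $X\subset C$ of $3t$ points with $\Delta h_X=(1,2,3,\dots,3,0)$ as above for which (i) holds, and there are such $C$ and $X$ for which (ii) holds. Finally, if $C$ is any smooth cubic and $t>5$, then there is a nonempty (hence dense) Zariski open subset $U$ of the $3t$-fold product $C^{3t}$ such that for every $(p_1,\dots,p_{3t})\in U$ the points $p_i$ are distinct, the set $X=\{p_1,\dots,p_{3t}\}$ has $\Delta h_X=(1,2,3,\dots,3,0)$ as above, and (i) holds for $X$. -/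

import Mathlib

open MvPolynomial
open scoped LinearAlgebra.Projectivization

noncomputable section

namespace FatPoints

variable {k : Type*} [Field k]

/-- The projective plane over `k` (its `k`-rational points). -/
abbrev Plane (k : Type*) [Field k] : Type _ := ℙ k (Fin 3 → k)

/-- The homogeneous ideal `I(p)` of a point `p` in `k[x₀, x₁, x₂]`: it is generated by the
homogeneous polynomials that vanish at `p`. -/
def pointIdeal (p : Plane k) : Ideal (MvPolynomial (Fin 3) k) :=
  Ideal.span {f | (∃ d : ℕ, f.IsHomogeneous d) ∧ eval p.rep f = 0}

/-- The homogeneous ideal `⋂_{p ∈ X} I(p) ^ m` of the fat point subscheme `mX`. -/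
def fatIdeal (m : ℕ) (X : Finset (Plane k)) : Ideal (MvPolynomial (Fin 3) k) :=
  ⨅ p ∈ X, pointIdeal p ^ m

/-- The Hilbert function of `R / I`, for a homogeneous ideal `I` of `R = k[x₀, x₁, x₂]`:
its value at `d` is the dimension of `R_d / (I ∩ R_d)`. -/
def hilb (I : Ideal (MvPolynomial (Fin 3) k)) (d : ℕ) : ℕ :=
  Module.finrank k (homogeneousSubmodule (Fin 3) k d ⧸
    (I.restrictScalars k).comap (homogeneousSubmodule (Fin 3) k d).subtype)

/-- The first difference of the Hilbert function of `mX`, with the convention `h(-1) = 0`. -/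
def diffHilb (m : ℕ) (X : Finset (Plane k)) : ℕ → ℤ
  | 0 => hilb (fatIdeal m X) 0
  | d + 1 => (hilb (fatIdeal m X) (d + 1) : ℤ) - hilb (fatIdeal m X) d

/-- `F` defines an irreducible plane cubic curve (when `k` is algebraically closed). -/
def IsIrreducibleCubic (F : MvPolynomial (Fin 3) k) : Prop :=
  F.IsHomogeneous 3 ∧ Irreducible F

/-- The point `p` lies on the curve `F = 0`. -/
def OnCurve (F : MvPolynomial (Fin 3) k) (p : Plane k) : Prop :=
  eval p.rep F = 0

/-- The point `p` lies on the curve `F = 0` and is not a singular point of it. -/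
def IsSmoothPoint (F : MvPolynomial (Fin 3) k) (p : Plane k) : Prop :=
  OnCurve F p ∧ ∃ i : Fin 3, eval p.rep (pderiv i F) ≠ 0

/-- The curve `F = 0` has no singular point. -/
def IsSmoothCurve (F : MvPolynomial (Fin 3) k) : Prop :=
  ∀ p : Plane k, OnCurve F p → IsSmoothPoint F p

/-- The sequence `1, 2, 3, 3, …, 3, δ, 0, 0, …`, with `3` in degrees `2, …, t`. -/
def IsReducedProfile (t δ : ℕ) (D : ℕ → ℤ) : Prop :=
  D 0 = 1 ∧ D 1 = 2 ∧ (∀ d, 2 ≤ d → d ≤ t → D d = 3) ∧ D (t + 1) = δ ∧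
    ∀ d, t + 1 < d → D d = 0

/-- In degrees below `2t + δ`, the sequence `1, 2, 3, 4, 5, 6, …, 6, 3 + δ, 3, …, 3`, with
`6` in degrees `5, …, t + 3` and `3` in degrees `t + 5, …, 2t + δ - 1`. -/
def IsDoubleProfile (t δ : ℕ) (D : ℕ → ℤ) : Prop :=
  (∀ d, d ≤ 5 → D d = d + 1) ∧ (∀ d, 5 ≤ d → d ≤ t + 3 → D d = 6) ∧
    D (t + 4) = 3 + δ ∧ ∀ d, t + 5 ≤ d → d < 2 * t + δ → D d = 3

/-- The ending `…, 3, 0, 0, …`, with the last nonzero value in degree `2t`. -/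
def EndsThree (t : ℕ) (D : ℕ → ℤ) : Prop :=
  D (2 * t) = 3 ∧ ∀ d, 2 * t < d → D d = 0

/-- The ending `…, 2, 1, 0, 0, …`, with the value `2` in degree `2t`. -/
def EndsTwoOne (t : ℕ) (D : ℕ → ℤ) : Prop :=
  D (2 * t) = 2 ∧ D (2 * t + 1) = 1 ∧ ∀ d, 2 * t + 1 < d → D d = 0

/-- `Φ`, a polynomial in `n` groups of three variables, is homogeneous in each group. -/
def IsMultihomogeneous {n : ℕ} (Φ : MvPolynomial (Fin n × Fin 3) k) : Prop :=
  ∃ e : Fin n → ℕ, ∀ i : Fin n,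
    Φ.IsWeightedHomogeneous (fun v : Fin n × Fin 3 => if v.1 = i then 1 else 0) (e i)

/-- Zariski closed subsets of `(ℙ²)ⁿ`: common zero loci of multihomogeneous polynomials. -/
def IsZariskiClosed {n : ℕ} (S : Set (Fin n → Plane k)) : Prop :=
  ∃ E : Set (MvPolynomial (Fin n × Fin 3) k), (∀ Φ ∈ E, IsMultihomogeneous Φ) ∧
    S = {p | ∀ Φ ∈ E, eval (fun v : Fin n × Fin 3 => (p v.1).rep v.2) Φ = 0}

/-- `P` holds for `n` sufficiently general points of the curve `F = 0`: it holds for all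
`n`-tuples in a nonempty Zariski open subset of the `n`-fold product of the curve (for an
irreducible curve over an algebraically closed field, such a subset is dense). -/
def ForGeneralPoints (F : MvPolynomial (Fin 3) k) (n : ℕ)
    (P : (Fin n → Plane k) → Prop) : Prop :=
  ∃ S : Set (Fin n → Plane k), IsZariskiClosed S ∧
    (∃ p, (∀ i, OnCurve F (p i)) ∧ p ∉ S) ∧
    ∀ p, (∀ i, OnCurve F (p i)) → p ∉ S → P p

end FatPoints

end

open MvPolynomial
open scoped LinearAlgebra.Projectivization

noncomputable section

namespace FatPoints

variable {k : Type*} [Field k]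

/-! The double points are compared with the divisor they cut on the curve C : F = 0. The points of X
are smooth on C, so I_{2X} : F = I_X, and I_{2X} + (F) lies in `tan F X`, the ideal of the divisor
2X on C. Multiplication by F gives h_{2X}(d+3) = h_X(d) + h_tan(d+3) whenever X imposes independent
conditions in degree d or `tan F X` has only multiples of F in degree d+3 (`hilb_dbl_add`). Under
the assumed profile of X one of the two holds for every d (`hilb_dbl_of_profile`).

It remains to know the Hilbert function of a subscheme of degree N on an irreducible cubic. As
Riemann-Roch in arithmetic genus one predicts, it is 3d for 0 < 3d < N and N for 3d > N; when 3d = N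
it is N, or N - 1 if some form of degree d in the ideal is not divisible by F. The range 3d < N is
Bézout. The rest is a slicing argument: if the function grows by at most one, the restriction to a
general line has codimension at most one and no base point, so it fills everything in the next
degree (`sliceSpace_succ_eq_top_of_codim_le_one`). For N = 2|X| = 6t + 2δ with δ ≤ 2, the case 3d =
N arises only for δ = 0 and d = 2t; hence the two endings.

Ending (i) means that no curve of degree 2t cuts out exactly 2X on C. To get it, 3t - 1 points are
fixed so that the curves of degree 2t through the doubled points form a pencil modulo F; the last
point is one where no member of the pencil is tangent to C. Such a point exists because a Wronskian
does not vanish identically (`exists_wronskian_ne_zero`); in characteristic two this rests on smooth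
cubics having no strange point (`polar_ne_zero`).

Ending (ii) comes from 2-torsion: X sums to a point E of order two in the group law, so X is not cut
out in degree t while 2X is cut out in degree 2t (`exists_points_cubic`).

Finally, h_X(t) = 3t and h_{2X}(2t) = 9t are the maximal possible values, and each is implied by the
nonvanishing of a suitable minor. An example of (i) therefore spreads to an open set of 3t-tuples
(`forGeneralPoints_endsThree`). -/

/-! ### Forms, Hilbert functions and a weak Bézout theorem -/

/-- The space of forms of degree `d` in three variables. -/
abbrev Hm (k : Type*) [Field k] (d : ℕ) : Submodule k (MvPolynomial (Fin 3) k) :=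
  homogeneousSubmodule (Fin 3) k d

/-- The forms of degree `d` in the ideal `I`, as a subspace of all forms of degree `d`. -/
abbrev gr (I : Ideal (MvPolynomial (Fin 3) k)) (d : ℕ) : Submodule k (Hm k d) :=
  (I.restrictScalars k).comap (Hm k d).subtype

instance finite_Hm (d : ℕ) : Module.Finite k (Hm k d) :=
  Module.Finite.iff_fg.mpr (homogeneousSubmodule_fg (Fin 3) k d)

theorem hilb_eq (I : Ideal (MvPolynomial (Fin 3) k)) (d : ℕ) :
    hilb I d = Module.finrank k (Hm k d ⧸ gr I d) := rfl

theorem finrank_Hm (d : ℕ) : 2 * Module.finrank k (Hm k d) = (d + 1) * (d + 2) := by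
  have h1 : Module.finrank k (Hm k d) = (d + 2).choose d := by
    rw [show Hm k d = AddMonoidAlgebra.supported _ k {e : Fin 3 →₀ ℕ | e.degree = d} from
      homogeneousSubmodule_eq_finsupp_supported (Fin 3) k d]
    have e := AddMonoidAlgebra.supportedEquivFinsupp (R := k) (M := Fin 3 →₀ ℕ) (S := k) {e : Fin 3 →₀ ℕ | e.degree = d}
    rw [LinearEquiv.finrank_eq e]
    have hs : {e : Fin 3 →₀ ℕ | e.degree = d} =
        ↑((Finset.univ : Finset (Fin 3)).finsuppAntidiag d) := by
      ext e
      simp [Finset.mem_finsuppAntidiag, Finsupp.degree_eq_sum]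
    rw [hs, Module.finrank_finsupp_self]
    simp [Finset.card_finsuppAntidiag_nat_eq_choose]
    rw [add_comm]
  rw [h1, Nat.choose_symm_add, Nat.choose_two_right]
  have := Nat.even_mul_pred_self (d + 2)
  rw [Nat.mul_div_cancel' this.two_dvd]
  simp [mul_comm]

/-- Multiplication by a form of degree `a`. -/
def mulForm {g : MvPolynomial (Fin 3) k} {a : ℕ} (hg : g.IsHomogeneous a) (d : ℕ) :
    Hm k d →ₗ[k] Hm k (d + a) where
  toFun f := ⟨g * f, by
    rw [mem_homogeneousSubmodule, add_comm]; exact hg.mul f.2⟩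
  map_add' f h := by ext1; simp [mul_add]
  map_smul' c f := by ext1; simp

@[simp] theorem coe_mulForm {g : MvPolynomial (Fin 3) k} {a : ℕ} (hg : g.IsHomogeneous a) (d : ℕ)
    (f : Hm k d) : (mulForm hg d f : MvPolynomial (Fin 3) k) = g * f := rfl

/-- Dimension count in the exact sequence 0 → R/I(-a) → R/I' → R/(I' + g) → 0, where I = I' : g in
degree d. It is used for F as a residuation and for a linear form as a slice. -/
theorem hilb_add_of_mul_mem_iff {I I' : Ideal (MvPolynomial (Fin 3) k)}
    {g : MvPolynomial (Fin 3) k} {a : ℕ} (hg : g.IsHomogeneous a) (d : ℕ)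
    (h : ∀ f : MvPolynomial (Fin 3) k, f.IsHomogeneous d → (g * f ∈ I' ↔ f ∈ I)) :
    hilb I' (d + a) = hilb I d +
      Module.finrank k (Hm k (d + a) ⧸ (gr I' (d + a) ⊔ LinearMap.range (mulForm hg d))) := by
  set φ := (gr I' (d + a)).mkQ ∘ₗ mulForm hg d with hφ
  have hker : LinearMap.ker φ = gr I d := by
    ext f
    rw [LinearMap.mem_ker, hφ, LinearMap.comp_apply, Submodule.mkQ_apply,
      Submodule.Quotient.mk_eq_zero]
    simpa using h f f.2
  have hr : LinearMap.range φ =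
      (LinearMap.range (mulForm hg d)).map (gr I' (d + a)).mkQ := LinearMap.range_comp _ _
  rw [hilb_eq, hilb_eq, ← Submodule.finrank_quotient_add_finrank (LinearMap.range φ),
    ← hker, LinearEquiv.finrank_eq φ.quotKerEquivRange, add_comm]
  congr 1
  rw [hr]
  exact LinearEquiv.finrank_eq (Submodule.quotientQuotientEquivQuotientSup _ _)

theorem homogeneousComponent_mul {g f : MvPolynomial (Fin 3) k} {a : ℕ} (hg : g.IsHomogeneous a)
    (d : ℕ) : homogeneousComponent (d + a) (g * f) = g * homogeneousComponent d f := by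
  conv_lhs => rw [← sum_homogeneousComponent f]
  rw [Finset.mul_sum, map_sum]
  have key : ∀ i, homogeneousComponent (d + a) (g * homogeneousComponent i f) =
      if i = d then g * homogeneousComponent d f else 0 := by
    intro i
    have hi : g * homogeneousComponent i f ∈ homogeneousSubmodule (Fin 3) k (a + i) :=
      hg.mul (homogeneousComponent_isHomogeneous i f)
    rw [homogeneousComponent_of_mem hi]
    by_cases hid : i = d
    · subst hid; rw [if_pos (by omega), if_pos rfl]
    · rw [if_neg (by omega), if_neg hid]
  rw [Finset.sum_congr rfl fun i _ => key i, Finset.sum_ite_eq']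
  split_ifs with hd
  · rfl
  · rw [homogeneousComponent_eq_zero, mul_zero]
    simpa using hd

theorem exists_isHomogeneous_of_dvd {g f : MvPolynomial (Fin 3) k} {a d : ℕ}
    (hg : g.IsHomogeneous a) (hf : f.IsHomogeneous (d + a)) (h : g ∣ f) :
    ∃ q : MvPolynomial (Fin 3) k, q.IsHomogeneous d ∧ f = g * q := by
  obtain ⟨q, rfl⟩ := h
  exact ⟨_, homogeneousComponent_isHomogeneous d q, by
    rw [← homogeneousComponent_mul hg, homogeneousComponent_eq_self hf]⟩

/-- Every form of positive degree is a combination of `x₀, x₁, x₂` with form coefficients. -/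
theorem exists_sum_X_mul {d : ℕ} {f : MvPolynomial (Fin 3) k} (hf : f.IsHomogeneous (d + 1)) :
    ∃ g : Fin 3 → MvPolynomial (Fin 3) k, (∀ i, (g i).IsHomogeneous d) ∧ f = ∑ i, X i * g i := by
  have hm : f ∈ Ideal.span (Set.range (X : Fin 3 → MvPolynomial (Fin 3) k)) := by
    rw [← Set.image_univ, mem_ideal_span_X_image]
    intro m hm
    by_contra hcon
    push Not at hcon
    have hm0 : m = 0 := Finsupp.ext fun i => by simpa using hcon i (Set.mem_univ i)
    have := hf (mem_support_iff.1 hm)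
    simp [hm0] at this
  obtain ⟨c, hc⟩ := (Submodule.mem_span_range_iff_exists_fun _).1 hm
  refine ⟨fun i => homogeneousComponent d (c i),
    fun i => homogeneousComponent_isHomogeneous d _, ?_⟩
  rw [← homogeneousComponent_eq_self hf, ← hc, map_sum]
  refine Finset.sum_congr rfl fun i _ => ?_
  rw [smul_eq_mul, mul_comm, homogeneousComponent_mul (isHomogeneous_X k i)]

theorem hilb_congr {I J : Ideal (MvPolynomial (Fin 3) k)} {d : ℕ}
    (h : ∀ f : MvPolynomial (Fin 3) k, f.IsHomogeneous d → (f ∈ I ↔ f ∈ J)) :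
    hilb I d = hilb J d := by
  have : gr I d = gr J d := by ext f; simpa using h f f.2
  rw [hilb_eq, hilb_eq, this]

theorem hilb_eq_finrank_Hm {I : Ideal (MvPolynomial (Fin 3) k)} {d : ℕ}
    (h : ∀ f : MvPolynomial (Fin 3) k, f.IsHomogeneous d → f ∈ I → f = 0) :
    hilb I d = Module.finrank k (Hm k d) := by
  have hb : gr I d = ⊥ := by
    rw [eq_bot_iff]
    intro f hf
    have := h f f.2 (by simpa using hf)
    simpa using this
  rw [hilb_eq]
  have h1 := Submodule.finrank_quotient_add_finrank (gr I d)
  rw [hb, finrank_bot] at h1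
  rw [hb]; omega

theorem eq_zero_of_isHomogeneous_of_dvd {g f : MvPolynomial (Fin 3) k} {a d : ℕ}
    (hg : g.IsHomogeneous a) (hf : f.IsHomogeneous d) (hd : d < a) (h : g ∣ f) : f = 0 := by
  by_contra h0
  obtain ⟨q, rfl⟩ := h
  have hg0 : g ≠ 0 := left_ne_zero_of_mul h0
  have hq0 : q ≠ 0 := right_ne_zero_of_mul h0
  have h1 := hf.totalDegree h0
  rw [totalDegree_mul_of_isDomain hg0 hq0, hg.totalDegree hg0] at h1
  omega

/-- The Hilbert function in degree `d` of an ideal whose forms of degree `d` are the multiples of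
a cubic form. -/
theorem hilb_of_mem_iff_cubic_dvd {F : MvPolynomial (Fin 3) k} (hF : F.IsHomogeneous 3)
    (hF0 : F ≠ 0) {I : Ideal (MvPolynomial (Fin 3) k)} {d : ℕ}
    (h : ∀ f : MvPolynomial (Fin 3) k, f.IsHomogeneous d → (f ∈ I ↔ F ∣ f)) :
    hilb I d = if d = 0 then 1 else 3 * d := by
  have hsmall : d < 3 → hilb I d = Module.finrank k (Hm k d) := fun hd =>
    hilb_eq_finrank_Hm fun f hf hfI =>
      eq_zero_of_isHomogeneous_of_dvd hF hf hd ((h f hf).1 hfI)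
  have hr := finrank_Hm (k := k) d
  match d, h, hsmall, hr with
  | 0, _, hs, hr => rw [hs (by norm_num)]; simp; omega
  | 1, _, hs, hr => rw [hs (by norm_num)]; simp; omega
  | 2, _, hs, hr => rw [hs (by norm_num)]; simp; omega
  | e + 3, h, _, hr =>
    have h1 := hilb_add_of_mul_mem_iff (I := ⊥) (I' := ⊥) hF e
      (fun f _ => by simp [hF0])
    have h2 : ∀ n, hilb (⊥ : Ideal (MvPolynomial (Fin 3) k)) n = Module.finrank k (Hm k n) :=
      fun n => hilb_eq_finrank_Hm fun f _ hf => by simpa using hf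
    have h3 : gr I (e + 3) = gr ⊥ (e + 3) ⊔ LinearMap.range (mulForm hF e) := by
      ext f
      have hb : gr (⊥ : Ideal (MvPolynomial (Fin 3) k)) (e + 3) = ⊥ := by
        ext f; simp
      rw [hb, bot_sup_eq, LinearMap.mem_range]
      constructor
      · intro hf
        obtain ⟨q, hq, hfq⟩ := exists_isHomogeneous_of_dvd hF f.2 ((h f f.2).1 (by simpa using hf))
        exact ⟨⟨q, hq⟩, Subtype.ext hfq.symm⟩
      · rintro ⟨q, rfl⟩
        have : (mulForm hF e q : MvPolynomial (Fin 3) k) ∈ I :=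
          (h _ (mulForm hF e q).2).2 (Dvd.intro _ rfl)
        simpa using this
    have he := finrank_Hm (k := k) e
    rw [hilb_eq, h3]
    rw [h2, h2] at h1
    rw [if_neg (by omega)]
    nlinarith

/-- A weak form of Bézout's theorem, in terms of Hilbert functions. -/
theorem hilb_le_of_not_dvd {F : MvPolynomial (Fin 3) k} (hF : F.IsHomogeneous 3)
    (hp : Prime F) {I : Ideal (MvPolynomial (Fin 3) k)} (hFI : F ∈ I) {e : ℕ}
    {g : MvPolynomial (Fin 3) k} (hg : g.IsHomogeneous e) (hgI : g ∈ I) (hFg : ¬ F ∣ g)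
    {d : ℕ} (hd : 0 < d) : hilb I (d + e) ≤ 3 * e := by
  have hS : ∀ n, hilb (Ideal.span {F}) n = if n = 0 then 1 else 3 * n := fun n =>
    hilb_of_mem_iff_cubic_dvd hF hp.ne_zero fun f _ => Ideal.mem_span_singleton
  -- Multiplication by g is injective modulo the prime F, so the cokernel has dimension 3(d+e) - 3d
  -- = 3e. Positivity of d matters: in degree 0 the Hilbert function of (F) is 1, not 0.
  have h1 := hilb_add_of_mul_mem_iff (I := Ideal.span {F}) (I' := Ideal.span {F}) hg d
    (fun f _ => by
      rw [Ideal.mem_span_singleton, Ideal.mem_span_singleton]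
      exact ⟨fun h => (hp.dvd_or_dvd h).resolve_left hFg, fun h => h.mul_left g⟩)
  rw [hS, hS, if_neg (by omega), if_neg (by omega)] at h1
  set W := gr (Ideal.span {F}) (d + e) ⊔ LinearMap.range (mulForm hg d)
  have hle : W ≤ gr I (d + e) := by
    refine sup_le (fun f hf => ?_) ?_
    · have : (f : MvPolynomial (Fin 3) k) ∈ Ideal.span {F} := by simpa using hf
      have : (f : MvPolynomial (Fin 3) k) ∈ I :=
        (Ideal.span_le.2 (by simpa using hFI)) this
      simpa using this
    · rintro _ ⟨f, rfl⟩
      have : (mulForm hg d f : MvPolynomial (Fin 3) k) ∈ I := I.mul_mem_right _ hgI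
      simpa using this
  have h2 := Submodule.finrank_quotient_add_finrank W
  have h3 := Submodule.finrank_quotient_add_finrank (gr I (d + e))
  have h4 := Submodule.finrank_mono hle
  rw [hilb_eq]
  omega

/-! ### Linear forms and the ideals of simple, double and tangential vanishing -/

/-- The linear form with coefficient vector `a`. -/
def lin (a : Fin 3 → k) : MvPolynomial (Fin 3) k := ∑ i, C (a i) * X i

theorem isHomogeneous_lin (a : Fin 3 → k) : (lin a).IsHomogeneous 1 :=
  IsHomogeneous.sum _ _ _ fun i _ => isHomogeneous_C_mul_X (a i) i

@[simp] theorem eval_lin (a v : Fin 3 → k) : eval v (lin a) = ∑ i, a i * v i := by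
  simp [lin]

@[simp] theorem pderiv_lin (a : Fin 3 → k) (j : Fin 3) : pderiv j (lin a) = C (a j) := by
  simp [lin, pderiv_X, Pi.single_apply]

theorem exists_eq_lin {f : MvPolynomial (Fin 3) k} (hf : f.IsHomogeneous 1) :
    ∃ a : Fin 3 → k, f = lin a := by
  obtain ⟨g, hg, rfl⟩ := exists_sum_X_mul (d := 0) hf
  refine ⟨fun i => coeff 0 (g i), Finset.sum_congr rfl fun i _ => ?_⟩
  have : totalDegree (g i) = 0 := (totalDegree_zero_iff_isHomogeneous _).2 (hg i)
  conv_lhs => rw [totalDegree_eq_zero_iff_eq_C.1 this]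
  rw [mul_comm]

/-- The ideal of polynomials that vanish at the points of `X`. -/
def van (X : Finset (Plane k)) : Ideal (MvPolynomial (Fin 3) k) where
  carrier := {f | ∀ p ∈ X, eval p.rep f = 0}
  add_mem' hf hg p hp := by simp [hf p hp, hg p hp]
  zero_mem' p _ := by simp
  smul_mem' c f hf p hp := by simp [hf p hp]

theorem mem_van {X : Finset (Plane k)} {f : MvPolynomial (Fin 3) k} :
    f ∈ van X ↔ ∀ p ∈ X, eval p.rep f = 0 := Iff.rfl

/-- The ideal of polynomials that vanish to second order at the points of `X`. -/
def dbl (X : Finset (Plane k)) : Ideal (MvPolynomial (Fin 3) k) where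
  carrier := {f | ∀ p ∈ X, eval p.rep f = 0 ∧ ∀ i, eval p.rep (pderiv i f) = 0}
  add_mem' hf hg p hp := by simp [hf p hp, hg p hp]
  zero_mem' p _ := by simp
  smul_mem' c f hf p hp := by simp [hf p hp]

theorem mem_dbl {X : Finset (Plane k)} {f : MvPolynomial (Fin 3) k} :
    f ∈ dbl X ↔ ∀ p ∈ X, eval p.rep f = 0 ∧ ∀ i, eval p.rep (pderiv i f) = 0 := Iff.rfl

/-- The ideal of polynomials whose restriction to the curve `F = 0` vanishes to second order at
the points of `X`. -/
def tan (F : MvPolynomial (Fin 3) k) (X : Finset (Plane k)) : Ideal (MvPolynomial (Fin 3) k) where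
  carrier := {f | ∀ p ∈ X, eval p.rep f = 0 ∧
    ∃ c, ∀ i, eval p.rep (pderiv i f) = c * eval p.rep (pderiv i F)}
  add_mem' := by
    intro f g hf hg p hp
    obtain ⟨hf0, c, hc⟩ := hf p hp
    obtain ⟨hg0, c', hc'⟩ := hg p hp
    exact ⟨by simp [hf0, hg0], c + c', fun i => by simp [hc, hc', add_mul]⟩
  zero_mem' p _ := ⟨by simp, 0, by simp⟩
  smul_mem' := by
    intro g f hf p hp
    obtain ⟨hf0, c, hc⟩ := hf p hp
    exact ⟨by simp [hf0], eval p.rep g * c, fun i => by simp [hf0, hc, mul_assoc]⟩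

/-! ### Interpolation at points in large degree -/

theorem exists_rep_ne_zero (p : Plane k) : ∃ s, p.rep s ≠ 0 := by
  by_contra h
  push Not at h
  exact p.rep_nonzero (funext h)

/-- A coordinate that does not vanish at `p`. -/
def chart (p : Plane k) : Fin 3 := (exists_rep_ne_zero p).choose

theorem rep_chart (p : Plane k) : p.rep (chart p) ≠ 0 := (exists_rep_ne_zero p).choose_spec

theorem eq_of_rep_eq_smul {p q : Plane k} {c : k} (h : p.rep = c • q.rep) : p = q := by
  rw [← p.mk_rep, ← q.mk_rep, Projectivization.mk_eq_mk_iff']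
  exact ⟨c, h.symm⟩

theorem exists_lin_separating {p q : Plane k} (h : p ≠ q) :
    ∃ a : Fin 3 → k, eval q.rep (lin a) = 0 ∧ eval p.rep (lin a) ≠ 0 := by
  by_contra hcon
  push Not at hcon
  obtain ⟨j, hj⟩ := exists_rep_ne_zero q
  refine h (eq_of_rep_eq_smul (c := p.rep j / q.rep j) (funext fun i => ?_))
  have := hcon (Pi.single i (q.rep j) - Pi.single j (q.rep i))
    (by simp [sub_mul, Finset.sum_sub_distrib, Pi.single_apply]; ring)
  simp [sub_mul, Finset.sum_sub_distrib, Pi.single_apply] at this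
  simp only [Pi.smul_apply, smul_eq_mul]
  field_simp
  linear_combination this

/-- A product of squared lines, one for each point of X and none through p. A coordinate that is
nonzero at p fills up the degree and also stands in for the line when the point is p itself. -/
theorem exists_separating_form (X : Finset (Plane k)) (p : Plane k) {e : ℕ} (he : 2 * X.card ≤ e) :
    ∃ A : MvPolynomial (Fin 3) k, A.IsHomogeneous e ∧ eval p.rep A ≠ 0 ∧
      ∀ q ∈ X, q ≠ p → eval q.rep A = 0 ∧ ∀ i, eval q.rep (pderiv i A) = 0 := by
  classical
  induction X using Finset.induction_on generalizing e with
  | empty =>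
    exact ⟨X (chart p) ^ e, isHomogeneous_X_pow _ _, by simp [rep_chart p], by simp⟩
  | insert q Y hq ih =>
    rw [Finset.card_insert_of_notMem hq] at he
    obtain ⟨A, hA, hA0, hAY⟩ := ih (e := e - 2) (by omega)
    obtain ⟨a, ha⟩ : ∃ a : Fin 3 → k, eval p.rep (lin a) ≠ 0 ∧
        (q ≠ p → eval q.rep (lin a) = 0) := by
      by_cases h : p = q
      · exact ⟨Pi.single (chart p) 1, by simp [Pi.single_apply, rep_chart p],
          fun h' => absurd h.symm h'⟩
      · obtain ⟨a, ha⟩ := exists_lin_separating h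
        exact ⟨a, ha.2, fun _ => ha.1⟩
    refine ⟨A * lin a ^ 2, ?_, ?_, ?_⟩
    · have := hA.mul ((isHomogeneous_lin a).pow 2)
      rwa [show e - 2 + 1 * 2 = e by omega] at this
    · rw [map_mul, map_pow]; exact mul_ne_zero hA0 (pow_ne_zero _ ha.1)
    · intro r hr hrp
      rcases Finset.mem_insert.1 hr with rfl | hr
      · have h0 := ha.2 hrp
        constructor
        · rw [map_mul, map_pow, h0]; ring
        · intro i
          rw [pderiv_mul, pderiv_pow, map_add, map_mul, map_mul, map_pow, map_mul, map_mul, map_pow,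
            h0]
          simp
      · obtain ⟨h0, h1⟩ := hAY r hr hrp
        constructor
        · rw [map_mul, h0, zero_mul]
        · intro i
          rw [pderiv_mul, map_add, map_mul, map_mul, h0, h1]
          ring

/-- The three conditions for a form to vanish to second order at a point `v` with `v s ≠ 0`:
the value at `v` and the two partial derivatives in the directions different from `s`. -/
def row (v : Fin 3 → k) (s j : Fin 3) : MvPolynomial (Fin 3) k →ₗ[k] k :=
  if j = s then (aeval v).toLinearMap else (aeval v).toLinearMap ∘ₗ (pderiv j).toLinearMap

theorem row_self (v : Fin 3 → k) (s : Fin 3) (f : MvPolynomial (Fin 3) k) :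
    row v s s f = eval v f := by
  simp [row, aeval_eq_eval]

theorem row_of_ne (v : Fin 3 → k) {s j : Fin 3} (h : j ≠ s) (f : MvPolynomial (Fin 3) k) :
    row v s j f = eval v (pderiv j f) := by
  simp [row, h, aeval_eq_eval]

theorem euler {f : MvPolynomial (Fin 3) k} {d : ℕ} (hf : f.IsHomogeneous d) (v : Fin 3 → k) :
    ∑ i, v i * eval v (pderiv i f) = d * eval v f := by
  have := congrArg (eval v) hf.sum_X_mul_pderiv
  simpa using this

/-- Euler's formula recovers the missing partial derivative after division by v s. The value has to
be kept among the conditions, since the degree may be zero in k and then the partials do not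
determine it. -/
theorem rows_eq_zero_iff {f : MvPolynomial (Fin 3) k} {d : ℕ} (hf : f.IsHomogeneous d)
    {v : Fin 3 → k} {s : Fin 3} (hs : v s ≠ 0) :
    (∀ j, row v s j f = 0) ↔ eval v f = 0 ∧ ∀ i, eval v (pderiv i f) = 0 := by
  constructor
  · intro h
    have h0 : eval v f = 0 := by rw [← row_self v s, h]
    refine ⟨h0, fun i => ?_⟩
    by_cases hi : i = s
    · subst hi
      have he := euler hf v
      rw [h0, mul_zero, Finset.sum_eq_single i] at he
      · exact (mul_eq_zero.1 he).resolve_left hs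
      · intro j _ hj
        rw [← row_of_ne v hj, h, mul_zero]
      · simp
    · rw [← row_of_ne v hi, h]
  · rintro ⟨h0, h1⟩ j
    by_cases hj : j = s
    · subst hj; rw [row_self, h0]
    · rw [row_of_ne v hj, h1]

theorem row_eq_zero {f : MvPolynomial (Fin 3) k} {v : Fin 3 → k} (h0 : eval v f = 0)
    (h1 : ∀ i, eval v (pderiv i f) = 0) (s j : Fin 3) : row v s j f = 0 := by
  by_cases hj : j = s
  · subst hj; rw [row_self, h0]
  · rw [row_of_ne v hj, h1]

/-- Forms of large degree have prescribed values and derivatives at the points of `X`. -/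
theorem exists_form_row_eq (X : Finset (Plane k)) {d : ℕ} (hd : 2 * X.card ≤ d)
    (y : X → Fin 3 → k) : ∃ f : MvPolynomial (Fin 3) k, f.IsHomogeneous (d + 1) ∧
      ∀ (p : X) (j : Fin 3), row (p : Plane k).rep (chart (p : Plane k)) j f = y p j := by
  classical
  have key : ∀ p : X, ∃ f : MvPolynomial (Fin 3) k, f.IsHomogeneous (d + 1) ∧
      ∀ (q : X) (j : Fin 3), row (q : Plane k).rep (chart (q : Plane k)) j f = if q = p then y p j else 0 := by
    intro p
    obtain ⟨A, hA, hA0, hAX⟩ := exists_separating_form X p hd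
    set v := (p : Plane k).rep with hv
    set s := chart (p : Plane k) with hs
    have hvs : v s ≠ 0 := rep_chart _
    set α := eval v A with hα
    -- The form sought is A times a linear form n. The prescribed value at v fixes n(v) = val, the
    -- prescribed derivatives fix the coefficients of n away from s, and the coefficient at s is
    -- then adjusted so that n(v) = val.
    set val := y p s / α with hval
    set n0 : Fin 3 → k := fun j => (y p j - eval v (pderiv j A) * val) / α with hn0
    set n : Fin 3 → k := Function.update n0 s ((val - ∑ j ∈ Finset.univ.erase s, n0 j * v j) / v s)
      with hn
    have hnv : eval v (lin n) = val := by
      rw [eval_lin, ← Finset.add_sum_erase _ _ (Finset.mem_univ s)]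
      have : ∑ j ∈ Finset.univ.erase s, n j * v j = ∑ j ∈ Finset.univ.erase s, n0 j * v j :=
        Finset.sum_congr rfl fun j hj => by
          rw [hn, Function.update_of_ne (Finset.ne_of_mem_erase hj)]
      rw [this, hn, Function.update_self]
      field_simp
      ring
    refine ⟨A * lin n, hA.mul (isHomogeneous_lin n), fun q j => ?_⟩
    split_ifs with hqp
    · subst hqp
      by_cases hj : j = s
      · subst hj
        rw [row_self, map_mul, hnv]
        exact mul_div_cancel₀ _ hA0
      · rw [row_of_ne _ hj, pderiv_mul, map_add, map_mul, map_mul, hnv, pderiv_lin, eval_C, hn,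
          Function.update_of_ne hj, hn0]
        simp only
        rw [← hα]
        field_simp
        ring
    · obtain ⟨h0, h1⟩ := hAX q q.2 (fun h => hqp (Subtype.ext h))
      refine row_eq_zero ?_ ?_ _ _
      · rw [map_mul, h0, zero_mul]
      · intro i
        rw [pderiv_mul, map_add, map_mul, map_mul, h0, h1]
        ring
  choose f hf hrow using key
  refine ⟨∑ p, f p, IsHomogeneous.sum _ _ _ fun p _ => hf p, fun p j => ?_⟩
  rw [map_sum, Finset.sum_congr rfl fun q _ => hrow q p j]
  simp

theorem hilb_eq_card {ι : Type*} [Fintype ι] {I : Ideal (MvPolynomial (Fin 3) k)} {d : ℕ}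
    (r : ι → MvPolynomial (Fin 3) k →ₗ[k] k)
    (hI : ∀ f : MvPolynomial (Fin 3) k, f.IsHomogeneous d → (f ∈ I ↔ ∀ i, r i f = 0))
    (hs : ∀ y : ι → k, ∃ f : MvPolynomial (Fin 3) k, f.IsHomogeneous d ∧ ∀ i, r i f = y i) :
    hilb I d = Fintype.card ι := by
  set φ : Hm k d →ₗ[k] (ι → k) := LinearMap.pi fun i => r i ∘ₗ (Hm k d).subtype
  have hker : LinearMap.ker φ = gr I d := by
    ext f
    rw [LinearMap.mem_ker, funext_iff]
    simpa [φ] using (hI f f.2).symm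
  have hsurj : Function.Surjective φ := fun y => by
    obtain ⟨f, hf, hfy⟩ := hs y
    exact ⟨⟨f, hf⟩, funext fun i => by simpa [φ] using hfy i⟩
  rw [hilb_eq, ← hker, LinearEquiv.finrank_eq (φ.quotKerEquivOfSurjective hsurj),
    Module.finrank_fintype_fun_eq_card]

theorem hilb_dbl_large (X : Finset (Plane k)) {d : ℕ} (hd : 2 * X.card < d) :
    hilb (dbl X) d = 3 * X.card := by
  obtain ⟨d, rfl⟩ : ∃ e, d = e + 1 := ⟨d - 1, by omega⟩
  rw [hilb_eq_card (ι := X × Fin 3) (fun q => row (q.1 : Plane k).rep (chart (q.1 : Plane k)) q.2)]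
  · simp [mul_comm]
  · intro f hf
    rw [mem_dbl]
    constructor
    · intro h q
      exact row_eq_zero (h _ q.1.2).1 (h _ q.1.2).2 _ _
    · intro h p hp
      exact (rows_eq_zero_iff hf (rep_chart p)).1 fun j => h (⟨p, hp⟩, j)
  · intro y
    obtain ⟨f, hf, h⟩ := exists_form_row_eq X (d := d) (by omega) fun p j => y (p, j)
    exact ⟨f, hf, fun i => h i.1 i.2⟩

theorem hilb_van_large (X : Finset (Plane k)) {d : ℕ} (hd : 2 * X.card < d) :
    hilb (van X) d = X.card := by
  obtain ⟨d, rfl⟩ : ∃ e, d = e + 1 := ⟨d - 1, by omega⟩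
  rw [hilb_eq_card (ι := X) (fun q => row (q : Plane k).rep 0 0)]
  · simp
  · intro f hf
    simp [mem_van, row_self]
  · intro y
    obtain ⟨f, hf, h⟩ := exists_form_row_eq X (d := d) (by omega) fun p _ => y p
    refine ⟨f, hf, fun i => ?_⟩
    rw [row_self, ← h i (chart (i : Plane k)), row_self]

/-! ### Slicing an ideal by a line -/

/-- An ideal `I` containing `F` that behaves like the ideal of a zero-dimensional subscheme of
degree `N` of the curve `F = 0`, supported on `X`. -/
structure IsCurveScheme (F : MvPolynomial (Fin 3) k) (X : Finset (Plane k)) (N : ℕ)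
    (I : Ideal (MvPolynomial (Fin 3) k)) : Prop where
  mem : F ∈ I
  sat : ∀ l : MvPolynomial (Fin 3) k, l.IsHomogeneous 1 → (∀ p ∈ X, eval p.rep l ≠ 0) →
    ∀ f, l * f ∈ I → f ∈ I
  large : ∃ e₀, ∀ e, e₀ ≤ e → hilb I e = N

theorem lin_ne_zero {a : Fin 3 → k} (ha : a ≠ 0) : lin a ≠ 0 := by
  obtain ⟨i, hi⟩ := Function.ne_iff.1 ha
  intro h
  have := congrArg (eval (Pi.single i 1)) h
  simp [Pi.single_apply] at this
  exact hi this

/-- Some line avoids a given finite set of points. -/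
theorem exists_lin_avoiding [Infinite k] (Y : Finset (Plane k)) :
    ∃ a : Fin 3 → k, ∀ p ∈ Y, eval p.rep (lin a) ≠ 0 := by
  have h : ∏ p ∈ Y, lin p.rep ≠ 0 := Finset.prod_ne_zero_iff.2 fun p _ => lin_ne_zero p.rep_nonzero
  obtain ⟨a, ha⟩ : ∃ a, eval a (∏ p ∈ Y, lin p.rep) ≠ 0 := by
    by_contra hcon
    push Not at hcon
    exact h (MvPolynomial.funext fun x => by rw [hcon, map_zero])
  rw [map_prod, Finset.prod_ne_zero_iff] at ha
  refine ⟨a, fun p hp => ?_⟩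
  have := ha p hp
  rw [eval_lin] at this ⊢
  simpa [mul_comm] using this

/-- The forms of degree `d + 1` that restrict on the line `l = 0` to elements of the ideal `I`. -/
abbrev sliceSpace (I : Ideal (MvPolynomial (Fin 3) k)) {l : MvPolynomial (Fin 3) k}
    (hl : l.IsHomogeneous 1) (d : ℕ) : Submodule k (Hm k (d + 1)) :=
  gr I (d + 1) ⊔ LinearMap.range (mulForm hl d)

theorem hilb_succ {I : Ideal (MvPolynomial (Fin 3) k)} {l : MvPolynomial (Fin 3) k}
    (hl : l.IsHomogeneous 1) (hsat : ∀ f, l * f ∈ I → f ∈ I) (d : ℕ) :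
    hilb I (d + 1) = hilb I d + Module.finrank k (Hm k (d + 1) ⧸ sliceSpace I hl d) :=
  hilb_add_of_mul_mem_iff hl d fun f _ => ⟨hsat f, I.mul_mem_left l⟩

theorem mem_sliceSpace {I : Ideal (MvPolynomial (Fin 3) k)} {l : MvPolynomial (Fin 3) k}
    {hl : l.IsHomogeneous 1} {d : ℕ} {f : Hm k (d + 1)} :
    f ∈ sliceSpace I hl d ↔ ∃ u ∈ I, ∃ h : MvPolynomial (Fin 3) k, u.IsHomogeneous (d + 1) ∧
      h.IsHomogeneous d ∧ (f : MvPolynomial (Fin 3) k) = u + l * h := by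
  rw [Submodule.mem_sup]
  constructor
  · rintro ⟨u, hu, _, ⟨h, rfl⟩, rfl⟩
    exact ⟨u, by simpa using hu, h, u.2, h.2, by simp⟩
  · rintro ⟨u, hu, h, hud, hhd, hf⟩
    exact ⟨⟨u, hud⟩, by simpa using hu, _, ⟨⟨h, hhd⟩, rfl⟩, Subtype.ext (by simpa using hf.symm)⟩

theorem sliceSpace_succ_eq_top {I : Ideal (MvPolynomial (Fin 3) k)} {l : MvPolynomial (Fin 3) k}
    {hl : l.IsHomogeneous 1} {d : ℕ} (h : sliceSpace I hl d = ⊤) : sliceSpace I hl (d + 1) = ⊤ := by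
  rw [eq_top_iff]
  intro f _
  obtain ⟨g, hg, hfg⟩ := exists_sum_X_mul f.2
  have : ∀ i, ∃ u ∈ I, ∃ h : MvPolynomial (Fin 3) k, u.IsHomogeneous (d + 1) ∧
      h.IsHomogeneous d ∧ g i = u + l * h := fun i => by
    have hi : (⟨g i, hg i⟩ : Hm k (d + 1)) ∈ sliceSpace I hl d := h ▸ Submodule.mem_top
    simpa using mem_sliceSpace.1 hi
  choose u hu q hud hqd hgi using this
  refine mem_sliceSpace.2 ⟨∑ i, X i * u i, I.sum_mem fun i _ => I.mul_mem_left _ (hu i),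
    ∑ i, X i * q i, ?_, ?_, ?_⟩
  · exact IsHomogeneous.sum _ _ _ fun i _ => by
      rw [add_comm (d + 1)]; exact (isHomogeneous_X k i).mul (hud i)
  · exact IsHomogeneous.sum _ _ _ fun i _ => by
      rw [add_comm d]; exact (isHomogeneous_X k i).mul (hqd i)
  · rw [hfg, Finset.mul_sum, ← Finset.sum_add_distrib]
    exact Finset.sum_congr rfl fun i _ => by rw [hgi]; ring

/-- A form of a proper subspace of codimension one comes with a functional which determines, up to
a factor, all functionals that vanish on the subspace. -/
theorem exists_functional {V : Type*} [AddCommGroup V] [Module k V] [Module.Finite k V]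
    {W : Submodule k V} (hW : Module.finrank k (V ⧸ W) = 1) :
    ∃ (φ : V →ₗ[k] k) (f₀ : V), φ f₀ = 1 ∧ (∀ f ∈ W, φ f = 0) ∧
      ∀ θ : V →ₗ[k] k, (∀ f ∈ W, θ f = 0) → ∀ f, θ f = φ f * θ f₀ := by
  obtain ⟨v, hv, hspan⟩ := finrank_eq_one_iff'.1 hW
  obtain ⟨f₀, rfl⟩ := W.mkQ_surjective v
  obtain ⟨e⟩ := Module.nonempty_linearEquiv_of_finrank_eq_one hW
  have he : e.symm (W.mkQ f₀) ≠ 0 := by simpa using hv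
  refine ⟨(e.symm (W.mkQ f₀))⁻¹ • (e.symm.toLinearMap ∘ₗ W.mkQ), f₀, ?_, ?_, ?_⟩
  · simp only [LinearMap.smul_apply, LinearMap.comp_apply, LinearEquiv.coe_coe, smul_eq_mul]
    exact inv_mul_cancel₀ he
  · intro f hf
    have : W.mkQ f = 0 := by simpa using hf
    simp only [LinearMap.smul_apply, LinearMap.comp_apply, this, map_zero,
      smul_zero]
  · intro θ hθ f
    obtain ⟨c, hc⟩ := hspan (W.mkQ f)
    have h1 : f - c • f₀ ∈ W := by
      rw [← Submodule.Quotient.mk_eq_zero, ← Submodule.mkQ_apply, map_sub, map_smul, hc, sub_self]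
    have h2 := hθ _ h1
    rw [map_sub, map_smul, sub_eq_zero] at h2
    rw [h2]
    simp only [LinearMap.smul_apply, LinearMap.comp_apply, LinearEquiv.coe_coe, smul_eq_mul, ← hc,
      map_smul]
    field_simp

/-- If the forms of degree `d + 1` of `I`, restricted to the line `l = 0`, have codimension at
most one and no common zero, then `I` contains all forms of degree `d + 2` on that line. -/
theorem sliceSpace_succ_eq_top_of_codim_le_one {I : Ideal (MvPolynomial (Fin 3) k)}
    {l : MvPolynomial (Fin 3) k} {hl : l.IsHomogeneous 1} {d : ℕ}
    (h : Module.finrank k (Hm k (d + 1) ⧸ sliceSpace I hl d) ≤ 1)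
    (hzero : ∀ v : Fin 3 → k, v ≠ 0 → eval v l = 0 →
      ∃ f ∈ I, f.IsHomogeneous (d + 1) ∧ eval v f ≠ 0) :
    sliceSpace I hl (d + 1) = ⊤ := by
  rcases Nat.lt_or_ge (Module.finrank k (Hm k (d + 1) ⧸ sliceSpace I hl d)) 1 with h0 | h1
  · apply sliceSpace_succ_eq_top
    rw [Nat.lt_one_iff, Module.finrank_zero_iff] at h0
    exact Submodule.Quotient.subsingleton_iff.1 h0
  by_contra hne
  obtain ⟨φ, f₀, hφ0, hφW, hφ⟩ := exists_functional (le_antisymm h h1)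
  obtain ⟨ψ, hψ0, hψW⟩ := Submodule.exists_le_ker_of_lt_top _ (lt_top_iff_ne_top.2 hne)
  obtain ⟨Φ, hΦ⟩ := LinearMap.exists_extend φ
  obtain ⟨Ψ, hΨ⟩ := LinearMap.exists_extend ψ
  have hΦ' : ∀ f : Hm k (d + 1), Φ f = φ f := fun f => by rw [← hΦ]; rfl
  have hΨ' : ∀ f : Hm k (d + 1 + 1), Ψ f = ψ f := fun f => by rw [← hΨ]; rfl
  -- Contracting Ψ with X i gives a functional in degree d + 1 that kills the slice, hence a
  -- multiple v i of Φ. The aim is to show that v is a point of the line and that Φ is, up to a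
  -- nonzero factor, evaluation at v; then v is a base point.
  set v : Fin 3 → k := fun i => Ψ (X i * (f₀ : MvPolynomial (Fin 3) k)) with hv
  have hX : ∀ i, ∀ f : MvPolynomial (Fin 3) k, f.IsHomogeneous (d + 1) →
      (X i * f).IsHomogeneous (d + 1 + 1) := fun i f hf => by
    rw [add_comm (d + 1)]; exact (isHomogeneous_X k i).mul hf
  have hΨv : ∀ i, ∀ f : MvPolynomial (Fin 3) k, f.IsHomogeneous (d + 1) →
      Ψ (X i * f) = v i * Φ f := by
    intro i f hf
    have := hφ (Ψ ∘ₗ LinearMap.mulLeft k (X i) ∘ₗ (Hm k (d + 1)).subtype) ?_ ⟨f, hf⟩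
    · simp only [LinearMap.comp_apply, Submodule.subtype_apply, LinearMap.mulLeft_apply] at this
      rw [this, ← hΦ', mul_comm]
    · intro g hg
      obtain ⟨u, hu, q, hud, hqd, hgu⟩ := mem_sliceSpace.1 hg
      simp only [LinearMap.comp_apply, Submodule.subtype_apply, LinearMap.mulLeft_apply]
      rw [hΨ' ⟨X i * (g : MvPolynomial (Fin 3) k), hX i g g.2⟩]
      refine hψW (mem_sliceSpace.2 ⟨X i * u, I.mul_mem_left _ hu, X i * q, hX i u hud, ?_, ?_⟩)
      · rw [add_comm d]; exact (isHomogeneous_X k i).mul hqd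
      · change X i * (g : MvPolynomial (Fin 3) k) = _
        rw [hgu]; ring
  have hv0 : v ≠ 0 := by
    intro h0
    refine hψ0 (LinearMap.ext fun f => ?_)
    obtain ⟨g, hg, hfg⟩ := exists_sum_X_mul f.2
    rw [← hΨ', hfg, map_sum, LinearMap.zero_apply]
    refine Finset.sum_eq_zero fun i _ => ?_
    rw [hΨv i _ (hg i), h0, Pi.zero_apply, zero_mul]
  have hlv : eval v l = 0 := by
    obtain ⟨a, ha⟩ := exists_eq_lin hl
    have h2 : Ψ (l * (f₀ : MvPolynomial (Fin 3) k)) = 0 := by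
      rw [hΨ' ⟨l * (f₀ : MvPolynomial (Fin 3) k), (mulForm hl (d + 1) f₀).2⟩]
      exact hψW (mem_sliceSpace.2 ⟨0, I.zero_mem, f₀, isHomogeneous_zero _ _ _, f₀.2, by simp⟩)
    rw [ha, lin, Finset.sum_mul, map_sum] at h2
    rw [ha, eval_lin, ← h2]
    refine Finset.sum_congr rfl fun i _ => ?_
    rw [mul_assoc, ← smul_eq_C_mul, map_smul, smul_eq_mul]
  obtain ⟨s, hs⟩ := Function.ne_iff.1 hv0
  have hswap : ∀ i, ∀ f : MvPolynomial (Fin 3) k, f.IsHomogeneous d →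
      v s * Φ (X i * f) = v i * Φ (X s * f) := by
    intro i f hf
    have hXf : ∀ j, (X j * f).IsHomogeneous (d + 1) := fun j => by
      rw [add_comm d]; exact (isHomogeneous_X k j).mul hf
    rw [← hΨv s _ (hXf i), ← hΨv i _ (hXf s)]
    congr 1; ring
  -- Each use of `hswap` trades a variable X i for v i at the cost of a factor X s, so by induction
  -- f is replaced by its value at v.
  have key : ∀ j, j ≤ d + 1 → ∀ f : MvPolynomial (Fin 3) k, f.IsHomogeneous j →
      v s ^ j * Φ (X s ^ (d + 1 - j) * f) = eval v f * Φ (X s ^ (d + 1)) := by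
    intro j
    induction j with
    | zero =>
      intro _ f hf
      rw [totalDegree_eq_zero_iff_eq_C.1 ((totalDegree_zero_iff_isHomogeneous _).2 hf), mul_comm (X s ^ _),
        ← smul_eq_C_mul, map_smul]
      simp
    | succ j ih =>
      intro hj f hf
      obtain ⟨g, hg, rfl⟩ := exists_sum_X_mul hf
      rw [Finset.mul_sum, map_sum, map_sum, Finset.mul_sum, Finset.sum_mul]
      refine Finset.sum_congr rfl fun i _ => ?_
      have h3 := hswap i (X s ^ (d + 1 - (j + 1)) * g i) (by
        have := (isHomogeneous_X_pow (R := k) s (d + 1 - (j + 1))).mul (hg i)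
        rwa [show d + 1 - (j + 1) + j = d by omega] at this)
      have h4 := ih (by omega) (g i) (hg i)
      rw [show d + 1 - j = d + 1 - (j + 1) + 1 by omega, pow_succ' (X s), mul_assoc] at h4
      rw [map_mul (eval v), eval_X, mul_left_comm, pow_succ, mul_assoc, h3, mul_left_comm, h4, mul_assoc]
  have key' : ∀ f : MvPolynomial (Fin 3) k, f.IsHomogeneous (d + 1) →
      v s ^ (d + 1) * Φ f = eval v f * Φ (X s ^ (d + 1)) := fun f hf => by
    simpa using key (d + 1) le_rfl f hf
  have hΦs : Φ (X s ^ (d + 1)) ≠ 0 := by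
    intro h0
    have := key' f₀ f₀.2
    rw [hΦ', hφ0, h0, mul_zero, mul_one] at this
    exact pow_ne_zero _ hs this
  obtain ⟨f, hfI, hfd, hf⟩ := hzero v hv0 hlv
  have h5 := key' f hfd
  rw [hΦ' ⟨f, hfd⟩, hφW _ (mem_sliceSpace.2 ⟨f, hfI, 0, hfd, isHomogeneous_zero _ _ _, by simp⟩),
    mul_zero] at h5
  exact mul_ne_zero hf hΦs h5.symm

/-! ### Evaluation at projective points and common zeros with the cubic -/

theorem eval_smul_of_isHomogeneous {f : MvPolynomial (Fin 3) k} {d : ℕ} (hf : f.IsHomogeneous d)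
    (c : k) (v : Fin 3 → k) : eval (c • v) f = c ^ d * eval v f := by
  induction d generalizing f with
  | zero =>
    rw [totalDegree_eq_zero_iff_eq_C.1 ((totalDegree_zero_iff_isHomogeneous _).2 hf)]
    simp
  | succ d ih =>
    obtain ⟨g, hg, rfl⟩ := exists_sum_X_mul hf
    rw [map_sum, map_sum, Finset.mul_sum]
    refine Finset.sum_congr rfl fun i _ => ?_
    rw [map_mul, map_mul, ih (hg i), eval_X, eval_X, Pi.smul_apply, smul_eq_mul]
    ring

theorem exists_rep_mk_eq_smul (v : Fin 3 → k) (hv : v ≠ 0) :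
    ∃ c : k, c ≠ 0 ∧ (Projectivization.mk k v hv).rep = c • v := by
  obtain ⟨a, ha⟩ := Projectivization.exists_smul_eq_mk_rep k v hv
  exact ⟨a, a.ne_zero, ha.symm⟩

theorem eval_rep_mk_eq_zero_iff {f : MvPolynomial (Fin 3) k} {d : ℕ} (hf : f.IsHomogeneous d)
    (v : Fin 3 → k) (hv : v ≠ 0) :
    eval (Projectivization.mk k v hv).rep f = 0 ↔ eval v f = 0 := by
  obtain ⟨c, hc, h⟩ := exists_rep_mk_eq_smul v hv
  rw [h, eval_smul_of_isHomogeneous hf, mul_eq_zero, or_iff_right (pow_ne_zero _ hc)]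

/-- In large degree the ideal of Y has Hilbert function |Y|, which the weak Bézout bound limits to
3e. -/
theorem card_le_of_common_zeros {F g : MvPolynomial (Fin 3) k} (hF : F.IsHomogeneous 3)
    (hp : Prime F) {e : ℕ} (hg : g.IsHomogeneous e) (hFg : ¬ F ∣ g) (Y : Finset (Plane k))
    (hY : ∀ p ∈ Y, OnCurve F p ∧ eval p.rep g = 0) : Y.card ≤ 3 * e := by
  have h := hilb_le_of_not_dvd hF hp (I := van Y) (fun p hp => (hY p hp).1) hg
    (fun p hp => (hY p hp).2) hFg (d := 2 * Y.card + 1) (by omega)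
  rwa [hilb_van_large Y (by omega)] at h

theorem finite_common_zeros {F g : MvPolynomial (Fin 3) k} (hF : F.IsHomogeneous 3)
    (hp : Prime F) {e : ℕ} (hg : g.IsHomogeneous e) (hFg : ¬ F ∣ g) :
    {p : Plane k | OnCurve F p ∧ eval p.rep g = 0}.Finite := by
  by_contra h
  obtain ⟨Y, hY, hcard⟩ := (show Set.Infinite _ from h).exists_subset_card_eq (3 * e + 1)
  have := card_le_of_common_zeros hF hp hg hFg Y fun p hp => hY hp
  omega

/-! ### Hilbert function of a zero-dimensional subscheme of the cubic -/

namespace IsCurveScheme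

variable {F : MvPolynomial (Fin 3) k} {X : Finset (Plane k)} {N : ℕ}
  {I : Ideal (MvPolynomial (Fin 3) k)}

theorem dvd_of_lt (h : IsCurveScheme F X N I) (hF : F.IsHomogeneous 3) (hp : Prime F) {d : ℕ}
    (hd : 3 * d < N) {f : MvPolynomial (Fin 3) k} (hf : f.IsHomogeneous d) (hfI : f ∈ I) :
    F ∣ f := by
  by_contra hcon
  obtain ⟨e₀, he⟩ := h.large
  have := hilb_le_of_not_dvd hF hp h.mem hf hfI hcon (d := e₀ + 1) (by omega)
  rw [he _ (by omega)] at this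
  omega

theorem hilb_of_forall_dvd (h : IsCurveScheme F X N I) (hF : F.IsHomogeneous 3) (hp : Prime F)
    {d : ℕ} (hd : ∀ f : MvPolynomial (Fin 3) k, f.IsHomogeneous d → f ∈ I → F ∣ f) :
    hilb I d = if d = 0 then 1 else 3 * d :=
  hilb_of_mem_iff_cubic_dvd hF hp.ne_zero fun f hf =>
    ⟨hd f hf, fun hdvd => I.mem_of_dvd hdvd h.mem⟩

theorem hilb_of_lt (h : IsCurveScheme F X N I) (hF : F.IsHomogeneous 3) (hp : Prime F) {d : ℕ}
    (hd : 3 * d < N) : hilb I d = if d = 0 then 1 else 3 * d :=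
  h.hilb_of_forall_dvd hF hp fun _ => h.dvd_of_lt hF hp hd

theorem dvd_of_hilb_eq (h : IsCurveScheme F X N I) (hF : F.IsHomogeneous 3) (hp : Prime F)
    {d : ℕ} (hd0 : 0 < d) (hd : 3 * d ≤ hilb I d) {f : MvPolynomial (Fin 3) k}
    (hf : f.IsHomogeneous d) (hfI : f ∈ I) : F ∣ f := by
  have hS : hilb (Ideal.span {F}) d = if d = 0 then 1 else 3 * d :=
    hilb_of_mem_iff_cubic_dvd hF hp.ne_zero fun f _ => Ideal.mem_span_singleton
  rw [if_neg hd0.ne'] at hS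
  have hle : gr (Ideal.span {F}) d ≤ gr I d := by
    intro f hf
    have h1 : (f : MvPolynomial (Fin 3) k) ∈ Ideal.span {F} := by simpa using hf
    have h2 : (f : MvPolynomial (Fin 3) k) ∈ I :=
      (Ideal.span_le.2 (by simpa using h.mem)) h1
    simpa using h2
  have h1 := Submodule.finrank_quotient_add_finrank (gr (Ideal.span {F}) d)
  have h2 := Submodule.finrank_quotient_add_finrank (gr I d)
  have h3 := Submodule.finrank_mono hle
  rw [hilb_eq] at hS hd
  have h4 := Submodule.eq_of_le_of_finrank_eq hle (by omega)
  have h5 : (⟨f, hf⟩ : Hm k d) ∈ gr I d := by simpa using hfI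
  rw [← h4] at h5
  exact Ideal.mem_span_singleton.1 (by simpa using h5)

theorem hilb_le_succ [Infinite k] (h : IsCurveScheme F X N I) (d : ℕ) : hilb I d ≤ hilb I (d + 1) := by
  obtain ⟨a, ha⟩ := exists_lin_avoiding X
  rw [hilb_succ (isHomogeneous_lin a) (h.sat _ (isHomogeneous_lin a) ha) d]
  omega

theorem monotone [Infinite k] (h : IsCurveScheme F X N I) : Monotone (hilb I) :=
  monotone_nat_of_le_succ h.hilb_le_succ

theorem hilb_le [Infinite k] (h : IsCurveScheme F X N I) (d : ℕ) : hilb I d ≤ N := by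
  obtain ⟨e₀, he⟩ := h.large
  rw [← he (max e₀ d) (le_max_left _ _)]
  exact h.monotone (le_max_right _ _)

/-- A full slice stays full in all higher degrees, so the Hilbert function is constant from there on
and equals its eventual value. -/
theorem hilb_eq_of_sliceSpace_eq_top (h : IsCurveScheme F X N I) {l : MvPolynomial (Fin 3) k}
    (hl : l.IsHomogeneous 1) (hlX : ∀ p ∈ X, eval p.rep l ≠ 0) {d : ℕ}
    (ht : sliceSpace I hl d = ⊤) : hilb I d = N := by
  have hall : ∀ j, sliceSpace I hl (d + j) = ⊤ := fun j => by
    induction j with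
    | zero => exact ht
    | succ j ih => exact sliceSpace_succ_eq_top ih
  have hc : ∀ j, hilb I (d + j) = hilb I d := fun j => by
    induction j with
    | zero => rfl
    | succ j ih =>
      rw [← add_assoc, hilb_succ hl (h.sat l hl hlX), ih, hall j,
        Module.finrank_zero_iff.2 (Submodule.Quotient.subsingleton_iff.2 rfl), add_zero]
  obtain ⟨e₀, he⟩ := h.large
  rw [← hc e₀, he _ (by omega)]

/-- If `I` contains a form of degree `d + 1` that is not a multiple of `F`, then the Hilbert
function of `I` is stationary as soon as it grows by at most one. -/
theorem hilb_eq_of_le_succ [Infinite k] (h : IsCurveScheme F X N I) (hF : F.IsHomogeneous 3) (hp : Prime F)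
    {d : ℕ} (hd : 2 ≤ d) {f : MvPolynomial (Fin 3) k} (hf : f.IsHomogeneous (d + 1)) (hfI : f ∈ I)
    (hFf : ¬ F ∣ f) (hle : hilb I (d + 1) ≤ hilb I d + 1) : hilb I (d + 1) = N := by
  classical
  have hfin := finite_common_zeros hF hp hf hFf
  -- The line avoids X, so that it is a nonzerodivisor modulo I, and also the finitely many common
  -- zeros of f and F, so that the forms of I of degree d + 1 have no common zero on it.
  obtain ⟨a, ha⟩ := exists_lin_avoiding (X ∪ hfin.toFinset)
  have hl := isHomogeneous_lin a
  have haX : ∀ p ∈ X, eval p.rep (lin a) ≠ 0 := fun p hp => ha p (Finset.mem_union_left _ hp)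
  refine h.hilb_eq_of_sliceSpace_eq_top hl haX (sliceSpace_succ_eq_top_of_codim_le_one ?_ ?_)
  · rw [hilb_succ hl (h.sat _ hl haX)] at hle
    omega
  · intro v hv hlv
    by_contra hcon
    push Not at hcon
    have h1 := hcon f hfI hf
    obtain ⟨s, hs⟩ := Function.ne_iff.1 hv
    have h2 := hcon (MvPolynomial.X s ^ (d - 2) * F) (I.mul_mem_left _ h.mem) (by
      have := (isHomogeneous_X_pow (R := k) s (d - 2)).mul hF
      rwa [show d - 2 + 3 = d + 1 by omega] at this)
    rw [map_mul, map_pow, eval_X, mul_eq_zero, or_iff_right (pow_ne_zero _ hs)] at h2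
    refine ha (Projectivization.mk k v hv) (Finset.mem_union_right _ ?_)
      ((eval_rep_mk_eq_zero_iff hl v hv).2 hlv)
    rw [Set.Finite.mem_toFinset]
    exact ⟨(eval_rep_mk_eq_zero_iff hF v hv).2 h2, (eval_rep_mk_eq_zero_iff hf v hv).2 h1⟩

theorem exists_not_dvd (h : IsCurveScheme F X N I) (hF : F.IsHomogeneous 3) (hp : Prime F) {d : ℕ}
    (hd0 : 0 < d) (hd : hilb I d < 3 * d) :
    ∃ f ∈ I, f.IsHomogeneous d ∧ ¬ F ∣ f := by
  by_contra hcon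
  push Not at hcon
  have := h.hilb_of_forall_dvd hF hp fun f hf hfI => hcon f hfI hf
  rw [if_neg hd0.ne'] at this
  omega

/-- In degree d - 1 the value is N - 3. In degree d the form f forces a value below N. A value of at
most N - 2 would be growth by at most one, and then `hilb_eq_of_le_succ` would give N, a
contradiction. -/
theorem hilb_of_exists_not_dvd [Infinite k] (h : IsCurveScheme F X N I) (hF : F.IsHomogeneous 3) (hp : Prime F)
    {d : ℕ} (hd : 3 ≤ d) (hN : 3 * d = N)
    {f : MvPolynomial (Fin 3) k} (hf : f.IsHomogeneous d) (hfI : f ∈ I) (hFf : ¬ F ∣ f) :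
    hilb I d + 1 = N := by
  obtain ⟨m, rfl⟩ : ∃ m, d = m + 1 := ⟨d - 1, by omega⟩
  have h1 := h.hilb_of_lt hF hp (d := m) (by omega)
  rw [if_neg (by omega)] at h1
  have h2 := h.hilb_le (m + 1)
  have h3 : hilb I (m + 1) < 3 * (m + 1) := by
    by_contra hcon
    exact hFf (h.dvd_of_hilb_eq hF hp (by omega) (by omega) hf hfI)
  by_contra hcon
  have h4 := h.hilb_eq_of_le_succ hF hp (by omega) hf hfI hFf (by omega)
  omega

theorem hilb_of_gt [Infinite k] (h : IsCurveScheme F X N I) (hF : F.IsHomogeneous 3) (hp : Prime F)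
    (hN : 9 ≤ N) {d : ℕ} (hd : N < 3 * d) : hilb I d = N := by
  -- By monotonicity the first degree beyond N/3 suffices. If the value there is below N, the growth
  -- into that degree is at most one: one degree earlier the value is N, N - 1 or 3m ≥ N - 2.
  suffices hs : hilb I (N / 3 + 1) = N from
    le_antisymm (h.hilb_le d) (by rw [← hs]; exact h.monotone (by omega))
  set m := N / 3
  have hle := h.hilb_le (m + 1)
  by_contra hne
  obtain ⟨f, hfI, hf, hFf⟩ := h.exists_not_dvd hF hp (d := m + 1) (by omega) (by omega)
  refine hne (h.hilb_eq_of_le_succ hF hp (by omega) hf hfI hFf ?_)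
  by_cases hm : 3 * m = N
  · by_cases hdvd : ∃ g ∈ I, g.IsHomogeneous m ∧ ¬ F ∣ g
    · obtain ⟨g, hgI, hg, hFg⟩ := hdvd
      have := h.hilb_of_exists_not_dvd hF hp (by omega) hm hg hgI hFg
      omega
    · push Not at hdvd
      have := h.hilb_of_forall_dvd hF hp (d := m) fun g hg hgI => hdvd g hgI hg
      rw [if_neg (by omega)] at this
      omega
  · have := h.hilb_of_lt hF hp (d := m) (by omega)
    rw [if_neg (by omega)] at this
    omega

end IsCurveScheme

/-! ### Powers of point ideals as vanishing conditions -/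

theorem mem_pointIdeal_iff {p : Plane k} {f : MvPolynomial (Fin 3) k} {d : ℕ}
    (hf : f.IsHomogeneous d) : f ∈ pointIdeal p ↔ eval p.rep f = 0 := by
  constructor
  · intro h
    have hle : pointIdeal p ≤ RingHom.ker (eval p.rep) := Ideal.span_le.2 fun g hg => hg.2
    exact hle h
  · exact fun h => Ideal.subset_span ⟨⟨d, hf⟩, h⟩

/-- A linear form vanishing at `v`. -/
def ptLin (v : Fin 3 → k) (s j : Fin 3) : MvPolynomial (Fin 3) k :=
  C (v s) * X j - C (v j) * X s

theorem isHomogeneous_ptLin (v : Fin 3 → k) (s j : Fin 3) : (ptLin v s j).IsHomogeneous 1 :=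
  (isHomogeneous_C_mul_X _ _).sub (isHomogeneous_C_mul_X _ _)

@[simp] theorem eval_ptLin (v : Fin 3 → k) (s j : Fin 3) : eval v (ptLin v s j) = 0 := by
  simp [ptLin, mul_comm]

/-- Modulo the linear forms `ptLin`, each variable X j is the multiple v j / v s of X s, so every
form reduces to a power of X s. -/
theorem exists_expansion {v : Fin 3 → k} {s : Fin 3} (hs : v s ≠ 0) (d : ℕ)
    {f : MvPolynomial (Fin 3) k} (hf : f.IsHomogeneous (d + 1)) :
    ∃ (c : k) (h : Fin 3 → MvPolynomial (Fin 3) k), (∀ j, (h j).IsHomogeneous d) ∧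
      f = C c * X s ^ (d + 1) + ∑ j, h j * ptLin v s j := by
  have hX : ∀ (c : k) (e : ℕ) (i : Fin 3), (X i : MvPolynomial (Fin 3) k) * (C c * X s ^ e) =
      C (c * (v i / v s)) * X s ^ (e + 1) + C (c / v s) * X s ^ e * ptLin v s i := by
    intro c e i
    have h1 : (C (v s) : MvPolynomial (Fin 3) k) * C (v s)⁻¹ = 1 := by
      rw [← C_mul, mul_inv_cancel₀ hs, C_1]
    simp only [ptLin, div_eq_mul_inv, C_mul]
    linear_combination (-(C c) * X s ^ e * X i) * h1
  induction d generalizing f with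
  | zero =>
    obtain ⟨g, hg, rfl⟩ := exists_sum_X_mul hf
    have hgC : ∀ i, g i = C (coeff 0 (g i)) := fun i =>
      totalDegree_eq_zero_iff_eq_C.1 ((totalDegree_zero_iff_isHomogeneous _).2 (hg i))
    refine ⟨∑ i, coeff 0 (g i) * (v i / v s), fun i => C (coeff 0 (g i) / v s),
      fun j => isHomogeneous_C _ _, ?_⟩
    rw [map_sum, Finset.sum_mul, ← Finset.sum_add_distrib]
    refine Finset.sum_congr rfl fun i _ => ?_
    have := hX (coeff 0 (g i)) 0 i
    rw [pow_zero, mul_one, ← hgC, mul_one] at this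
    exact this
  | succ d ih =>
    obtain ⟨g, hg, rfl⟩ := exists_sum_X_mul hf
    choose c h hh hg' using fun i => ih (hg i)
    refine ⟨∑ i, c i * (v i / v s),
      fun j => C (c j / v s) * X s ^ (d + 1) + ∑ i, X i * h i j, fun j => ?_, ?_⟩
    · refine (isHomogeneous_C_mul_X_pow _ _ _).add (IsHomogeneous.sum _ _ _ fun i _ => ?_)
      rw [add_comm]; exact (isHomogeneous_X k i).mul (hh i j)
    · have h1 : ∑ j, (C (c j / v s) * X s ^ (d + 1) + ∑ i, X i * h i j) * ptLin v s j =
          ∑ j, (C (c j / v s) * X s ^ (d + 1) * ptLin v s j + X j * ∑ i, h j i * ptLin v s i) := by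
        simp_rw [add_mul, Finset.sum_add_distrib, Finset.sum_mul, Finset.mul_sum, mul_assoc]
        rw [Finset.sum_comm (f := fun i j => X j * (h j i * ptLin v s i))]
      rw [h1, map_sum, Finset.sum_mul, ← Finset.sum_add_distrib]
      refine Finset.sum_congr rfl fun i _ => ?_
      conv_lhs => rw [hg' i, mul_add, hX, add_assoc]

/-- For the reverse direction f is expanded at p. Vanishing kills the power of X s, and the
derivative in a direction i other than s equals v s times the value of the i-th coefficient. So the
relevant coefficients lie in I(p), and f lies in its square in every characteristic. -/
theorem mem_pointIdeal_sq_iff {p : Plane k} {f : MvPolynomial (Fin 3) k} {d : ℕ}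
    (hf : f.IsHomogeneous d) :
    f ∈ pointIdeal p ^ 2 ↔ eval p.rep f = 0 ∧ ∀ i, eval p.rep (pderiv i f) = 0 := by
  constructor
  · intro h
    have hker : pointIdeal p ≤ RingHom.ker (eval p.rep) := Ideal.span_le.2 fun g hg => hg.2
    have hle : pointIdeal p ^ 2 ≤ dbl {p} := by
      rw [pow_two, Ideal.mul_le]
      intro a ha b hb q hq
      rw [Finset.mem_singleton.1 hq]
      have ha' : eval p.rep a = 0 := hker ha
      have hb' : eval p.rep b = 0 := hker hb
      simp [ha', hb']
    exact mem_dbl.1 (hle h) p (Finset.mem_singleton_self p)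
  · rintro ⟨h0, h1⟩
    set v := p.rep with hv
    set s := chart p with hs
    have hvs : v s ≠ 0 := rep_chart p
    cases d with
    | zero =>
      have hC := totalDegree_eq_zero_iff_eq_C.1 ((totalDegree_zero_iff_isHomogeneous _).2 hf)
      rw [hC, eval_C] at h0
      rw [hC, h0, C_0]
      exact Ideal.zero_mem _
    | succ d =>
      obtain ⟨c, h, hh, rfl⟩ := exists_expansion hvs d hf
      have hc : c = 0 := by
        simpa [hvs] using h0
      subst hc
      have hL : ∀ j, ptLin v s j ∈ pointIdeal p := fun j =>
        (mem_pointIdeal_iff (isHomogeneous_ptLin v s j)).2 (eval_ptLin v s j)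
      have hLs : ptLin v s s = 0 := by simp [ptLin]
      have hv0 : ∀ i, i ≠ s → eval v (h i) = 0 := by
        intro i hi
        have h2 := h1 i
        simp only [C_0, zero_mul, zero_add, map_sum, pderiv_mul, map_add, map_mul, eval_ptLin,
          mul_zero] at h2
        rw [Finset.sum_eq_single i] at h2
        · simpa [ptLin, pderiv_X, hi, Ne.symm hi, hvs] using h2
        · intro j _ hj
          simp [ptLin, pderiv_X, Ne.symm hi, hj]
        · simp
      rw [C_0, zero_mul, zero_add]
      refine Ideal.sum_mem _ fun j _ => ?_
      by_cases hj : j = s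
      · rw [hj, hLs, mul_zero]; exact Ideal.zero_mem _
      · rw [pow_two]
        exact Ideal.mul_mem_mul ((mem_pointIdeal_iff (hh j)).2 (hv0 j hj)) (hL j)

theorem hilb_fatIdeal_one (X : Finset (Plane k)) (d : ℕ) :
    hilb (fatIdeal 1 X) d = hilb (van X) d :=
  hilb_congr fun f hf => by
    simp only [fatIdeal, Ideal.mem_iInf, pow_one, mem_van]
    exact forall₂_congr fun p _ => mem_pointIdeal_iff hf

theorem hilb_fatIdeal_two (X : Finset (Plane k)) (d : ℕ) :
    hilb (fatIdeal 2 X) d = hilb (dbl X) d :=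
  hilb_congr fun f hf => by
    simp only [fatIdeal, Ideal.mem_iInf, mem_dbl]
    exact forall₂_congr fun p _ => mem_pointIdeal_sq_iff hf

/-! ### Residuation with respect to the cubic -/

/-- Dimension count converse to `hilb_eq_card`: conditions that are independent in number can be
prescribed arbitrarily. -/
theorem surjective_of_hilb_eq_card {ι : Type*} [Fintype ι] {I : Ideal (MvPolynomial (Fin 3) k)}
    {d : ℕ} (r : ι → MvPolynomial (Fin 3) k →ₗ[k] k)
    (hI : ∀ f : MvPolynomial (Fin 3) k, f.IsHomogeneous d → (f ∈ I ↔ ∀ i, r i f = 0))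
    (h : hilb I d = Fintype.card ι) (y : ι → k) :
    ∃ f : MvPolynomial (Fin 3) k, f.IsHomogeneous d ∧ ∀ i, r i f = y i := by
  set φ : Hm k d →ₗ[k] (ι → k) := LinearMap.pi fun i => r i ∘ₗ (Hm k d).subtype
  have hker : LinearMap.ker φ = gr I d := by
    ext f
    rw [LinearMap.mem_ker, funext_iff]
    simpa [φ] using (hI f f.2).symm
  have hrange : LinearMap.range φ = ⊤ := by
    apply Submodule.eq_top_of_finrank_eq
    rw [← LinearEquiv.finrank_eq φ.quotKerEquivRange, hker, Module.finrank_fintype_fun_eq_card, ← h]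
    rfl
  obtain ⟨f, hf⟩ := LinearMap.range_eq_top.1 hrange y
  exact ⟨f, f.2, fun i => by simpa [φ] using congrFun hf i⟩

/-- The Hilbert functions of `2X`, of `X` and of `2X ∩ C`, for points of a cubic curve `C`. -/
theorem hilb_dbl_add {F : MvPolynomial (Fin 3) k} (hF : F.IsHomogeneous 3) {X : Finset (Plane k)}
    (hX : ∀ p ∈ X, IsSmoothPoint F p) {d : ℕ}
    (h : hilb (van X) d = X.card ∨
      ∀ f : MvPolynomial (Fin 3) k, f.IsHomogeneous (d + 3) → f ∈ tan F X → F ∣ f) :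
    hilb (dbl X) (d + 3) = hilb (van X) d + hilb (tan F X) (d + 3) := by
  rw [hilb_add_of_mul_mem_iff (I := van X) hF d]
  · congr 1
    suffices hs : gr (dbl X) (d + 3) ⊔ LinearMap.range (mulForm hF d) = gr (tan F X) (d + 3) by
      rw [hs]; rfl
    apply le_antisymm
    · refine sup_le (fun f hf => ?_) ?_
      · have h1 : (f : MvPolynomial (Fin 3) k) ∈ dbl X := by simpa using hf
        have h2 : (f : MvPolynomial (Fin 3) k) ∈ tan F X := fun p hp =>
          ⟨(h1 p hp).1, 0, fun i => by rw [(h1 p hp).2, zero_mul]⟩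
        simpa using h2
      · rintro _ ⟨f, rfl⟩
        have h2 : (mulForm hF d f : MvPolynomial (Fin 3) k) ∈ tan F X := fun p hp => by
          have h0 : eval p.rep F = 0 := (hX p hp).1
          exact ⟨by simp [h0], eval p.rep (f : MvPolynomial (Fin 3) k), fun i => by
            simp [h0]⟩
        simpa using h2
    · intro f hf
      have hft : (f : MvPolynomial (Fin 3) k) ∈ tan F X := by simpa using hf
      -- If X imposes independent conditions in degree d, some q of degree d takes the multipliers c
      -- as its values on X, and f - F q is then singular at every point of X. In the other case f
      -- is itself a multiple of F.
      rcases h with h | h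
      · choose hf0 c hc using hft
        obtain ⟨q, hq, hqc⟩ := surjective_of_hilb_eq_card (ι := X) (I := van X) (d := d)
          (fun p => row (p : Plane k).rep 0 0)
          (fun f _ => by simp [mem_van, row_self]) (by rw [h]; simp) fun p => c p p.2
        have h1 : (f : MvPolynomial (Fin 3) k) - F * q ∈ dbl X := by
          intro p hp
          have h0 : eval p.rep F = 0 := (hX p hp).1
          have h2 := hqc ⟨p, hp⟩
          rw [row_self] at h2
          simp only at h2
          refine ⟨by simp [h0, hf0 p hp], fun i => ?_⟩
          simp only [map_sub, pderiv_mul, map_add, map_mul, h0, zero_mul, add_zero, hc p hp i, h2]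
          ring
        have h2 : f - mulForm hF d ⟨q, hq⟩ ∈ gr (dbl X) (d + 3) := by simpa using h1
        have h3 := Submodule.add_mem_sup h2 (LinearMap.mem_range_self (mulForm hF d) ⟨q, hq⟩)
        rwa [sub_add_cancel] at h3
      · obtain ⟨q, hq, hfq⟩ := exists_isHomogeneous_of_dvd hF f.2 (h f f.2 hft)
        exact Submodule.mem_sup_right ⟨⟨q, hq⟩, Subtype.ext hfq.symm⟩
  · intro f _
    constructor
    · intro hFf p hp
      obtain ⟨h0, i, hi⟩ := hX p hp
      have h0' : eval p.rep F = 0 := h0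
      have := (hFf p hp).2 i
      rw [pderiv_mul, map_add, map_mul, map_mul, h0', zero_mul, add_zero, mul_eq_zero] at this
      exact this.resolve_left hi
    · intro hf p hp
      have h0' : eval p.rep F = 0 := (hX p hp).1
      have h1 : eval p.rep f = 0 := hf p hp
      simp [h0', h1]

theorem isCurveScheme_van {F : MvPolynomial (Fin 3) k} {X : Finset (Plane k)}
    (hX : ∀ p ∈ X, OnCurve F p) : IsCurveScheme F X X.card (van X) where
  mem := hX
  sat l _ hlX f hf p hp := by
    have h := hf p hp
    rw [map_mul, mul_eq_zero] at h
    exact h.resolve_left (hlX p hp)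
  large := ⟨2 * X.card + 1, fun e he => hilb_van_large X (by omega)⟩

/-- The degree is found by subtraction: in large degree 2X imposes 3|X| conditions and X imposes
|X|, so `hilb_dbl_add` leaves 2|X|. For saturation, the multiplier of l f at p is divided by l(p).
-/
theorem isCurveScheme_tan {F : MvPolynomial (Fin 3) k} (hF : F.IsHomogeneous 3)
    {X : Finset (Plane k)} (hX : ∀ p ∈ X, IsSmoothPoint F p) :
    IsCurveScheme F X (2 * X.card) (tan F X) where
  mem p hp := ⟨(hX p hp).1, 1, fun i => by rw [one_mul]⟩
  sat l _ hlX f hf p hp := by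
    obtain ⟨h0, c, hc⟩ := hf p hp
    rw [map_mul, mul_eq_zero, or_iff_right (hlX p hp)] at h0
    refine ⟨h0, c / eval p.rep l, fun i => ?_⟩
    have := hc i
    rw [pderiv_mul, map_add, map_mul, map_mul, h0, mul_zero, zero_add] at this
    have hl := hlX p hp
    field_simp
    linear_combination this
  large := ⟨2 * X.card + 4, fun e he => by
    obtain ⟨d, rfl⟩ : ∃ d, e = d + 3 := ⟨e - 3, by omega⟩
    have h1 := hilb_van_large X (d := d) (by omega)
    have h2 := hilb_dbl_add hF hX (Or.inl h1)
    rw [hilb_dbl_large X (by omega), h1] at h2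
    omega⟩

/-! ### First differences and profiles -/

theorem isReducedProfile_iff {X : Finset (Plane k)} {t δ : ℕ} (ht : 2 ≤ t) :
    IsReducedProfile t δ (diffHilb 1 X) ↔
      hilb (van X) 0 = 1 ∧ (∀ d, 1 ≤ d → d ≤ t → hilb (van X) d = 3 * d) ∧
        ∀ d, t < d → hilb (van X) d = 3 * t + δ := by
  have hs : ∀ d, diffHilb 1 X (d + 1) = (hilb (van X) (d + 1) : ℤ) - hilb (van X) d := fun d => by
    simp only [diffHilb, hilb_fatIdeal_one]
  have h0 : diffHilb 1 X 0 = hilb (van X) 0 := by simp only [diffHilb, hilb_fatIdeal_one]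
  constructor
  · rintro ⟨hD0, hD1, hDm, hDt, hDe⟩
    have e0 : hilb (van X) 0 = 1 := by rw [h0] at hD0; exact_mod_cast hD0
    have e1 : hilb (van X) 1 = 3 := by have := hs 0; rw [zero_add] at this; omega
    have em : ∀ d, d + 1 ≤ t → hilb (van X) (d + 1) = 3 * (d + 1) := by
      intro d
      induction d with
      | zero => intro _; exact e1
      | succ d ih =>
        intro hd
        have h1 := ih (by omega)
        have h2 := hDm (d + 1 + 1) (by omega) hd
        rw [hs] at h2
        omega
    refine ⟨e0, fun d h1 h2 => ?_, fun d hd => ?_⟩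
    · obtain ⟨e, rfl⟩ : ∃ e, d = e + 1 := ⟨d - 1, by omega⟩
      exact em e h2
    · obtain ⟨e, rfl⟩ : ∃ e, d = t + 1 + e := ⟨d - (t + 1), by omega⟩
      induction e with
      | zero =>
        have h1 := em (t - 1) (by omega)
        rw [Nat.sub_add_cancel (by omega)] at h1
        rw [hs] at hDt
        rw [add_zero]
        omega
      | succ e ih =>
        have h1 := ih (by omega)
        have h2 := hDe (t + 1 + e + 1) (by omega)
        rw [hs] at h2
        rw [← add_assoc]
        omega
  · rintro ⟨e0, em, ee⟩
    refine ⟨by rw [h0, e0]; rfl, ?_, fun d h2 hd => ?_, ?_, fun d hd => ?_⟩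
    · have h1 := hs 0
      rw [zero_add, em 1 le_rfl (by omega), e0] at h1
      rw [h1]; norm_num
    · obtain ⟨e, rfl⟩ : ∃ e, d = e + 1 := ⟨d - 1, by omega⟩
      rw [hs, em _ (by omega) hd, em _ (by omega) (by omega)]
      push_cast; ring
    · rw [hs, em t (by omega) le_rfl, ee _ (by omega)]
      push_cast; ring
    · obtain ⟨e, rfl⟩ : ∃ e, d = e + 1 := ⟨d - 1, by omega⟩
      rw [hs, ee _ (by omega), ee e (by omega)]
      push_cast; ring

section Profile

variable {F : MvPolynomial (Fin 3) k} {X : Finset (Plane k)} {t δ : ℕ}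

/-- The Hilbert function of `2X` when `X` has the generic reduced profile. -/
theorem hilb_dbl_of_profile (hF : F.IsHomogeneous 3) (hp : Prime F) (hδ : δ ≤ 2) (ht : 5 < t + δ)
    (hcard : X.card = 3 * t + δ) (hX : ∀ p ∈ X, IsSmoothPoint F p)
    (hprof : IsReducedProfile t δ (diffHilb 1 X)) :
    hilb (dbl X) 0 = 1 ∧ hilb (dbl X) 1 = 3 ∧ hilb (dbl X) 2 = 6 ∧
      ∀ d, hilb (dbl X) (d + 3) = hilb (van X) d + hilb (tan F X) (d + 3) := by
  obtain ⟨-, hm, he⟩ := (isReducedProfile_iff (by omega)).1 hprof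
  have hS := isCurveScheme_tan hF hX
  have hsmall : ∀ d, d < 3 → hilb (dbl X) d = if d = 0 then 1 else 3 * d := fun d hd =>
    hilb_of_mem_iff_cubic_dvd hF hp.ne_zero fun f hf => by
      constructor
      · intro h
        exact hS.dvd_of_lt hF hp (by omega) hf fun p hp => ⟨(h p hp).1, 0, fun i => by
          rw [(h p hp).2, zero_mul]⟩
      · intro h
        rw [eq_zero_of_isHomogeneous_of_dvd hF hf hd h]
        exact Ideal.zero_mem _
  refine ⟨hsmall 0 (by norm_num), hsmall 1 (by norm_num), hsmall 2 (by norm_num), fun d => ?_⟩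
  apply hilb_dbl_add hF hX
  -- Above degree t the points impose independent conditions. Up to degree t one has 3(d+3) ≤ 3t + 9
  -- < 2|X|, so Bézout leaves only multiples of F in `tan F X`.
  by_cases hd : t < d
  · exact Or.inl ((he d hd).trans hcard.symm)
  · exact Or.inr fun f hf hfI => hS.dvd_of_lt hF hp (by omega) hf hfI

/-- Degree 2t is the critical one, 3 · 2t = 2|X|. The cases are told apart by whether a curve of
degree 2t not containing C passes through the divisor 2X, which it then cuts out exactly. -/
theorem hilb_tan_dichotomy [Infinite k] (hF : F.IsHomogeneous 3) (hp : Prime F) (ht : 5 < t)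
    (hcard : X.card = 3 * t) (hX : ∀ p ∈ X, IsSmoothPoint F p) :
    hilb (tan F X) (2 * t) = 6 * t ∨ hilb (tan F X) (2 * t) + 1 = 6 * t := by
  have hS := isCurveScheme_tan hF hX
  by_cases h : ∃ f ∈ tan F X, f.IsHomogeneous (2 * t) ∧ ¬ F ∣ f
  · obtain ⟨f, hfI, hf, hFf⟩ := h
    have := hS.hilb_of_exists_not_dvd hF hp (by omega) (by omega) hf hfI hFf
    exact Or.inr (by omega)
  · push Not at h
    have := hS.hilb_of_forall_dvd hF hp (d := 2 * t) fun f hf hfI => h f hfI hf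
    rw [if_neg (by omega)] at this
    exact Or.inl (by omega)

/-- The first difference of the Hilbert function of `2X`, up to the last degrees for `δ = 0`. -/
theorem double_profile [Infinite k] (hF : F.IsHomogeneous 3) (hp : Prime F) (hδ : δ ≤ 2) (ht : 5 < t + δ)
    (hcard : X.card = 3 * t + δ) (hX : ∀ p ∈ X, IsSmoothPoint F p)
    (hprof : IsReducedProfile t δ (diffHilb 1 X)) :
    IsDoubleProfile t δ (diffHilb 2 X) ∧
      (δ = 1 ∨ δ = 2 → diffHilb 2 X (2 * t + δ) = 3 - δ ∧
        ∀ d, 2 * t + δ < d → diffHilb 2 X d = 0) ∧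
      (δ = 0 → hilb (tan F X) (2 * t) = 6 * t → EndsThree t (diffHilb 2 X)) ∧
      (δ = 0 → hilb (tan F X) (2 * t) + 1 = 6 * t → EndsTwoOne t (diffHilb 2 X)) := by
  obtain ⟨b0, b1, b2, b3⟩ := hilb_dbl_of_profile hF hp hδ ht hcard hX hprof
  obtain ⟨v0, vm, ve⟩ := (isReducedProfile_iff (by omega)).1 hprof
  have hS := isCurveScheme_tan hF hX
  have T1 : ∀ d, 0 < d → 3 * d < 2 * X.card → hilb (tan F X) d = 3 * d := fun d h0 hd => by
    rw [hS.hilb_of_lt hF hp hd, if_neg (by omega)]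
  have T2 : ∀ d, 2 * X.card < 3 * d → hilb (tan F X) d = 2 * X.card := fun d hd =>
    hS.hilb_of_gt hF hp (by omega) hd
  have hs : ∀ d, diffHilb 2 X (d + 1) = (hilb (dbl X) (d + 1) : ℤ) - hilb (dbl X) d := fun d => by
    simp only [diffHilb, hilb_fatIdeal_two]
  have h0 : diffHilb 2 X 0 = hilb (dbl X) 0 := by simp only [diffHilb, hilb_fatIdeal_two]
  have b3' := b3 0
  have t3 := T1 3 (by omega) (by omega)
  rw [v0, zero_add, t3] at b3'
  have hs3 : ∀ d, diffHilb 2 X (d + 4) = (hilb (van X) (d + 1) : ℤ) - hilb (van X) d +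
      (hilb (tan F X) (d + 4) - hilb (tan F X) (d + 3)) := fun d => by
    rw [hs, show d + 3 + 1 = d + 1 + 3 by ring, b3, b3 d]
    push_cast; ring_nf
  have b4 := hs3 0
  rw [zero_add, zero_add, zero_add, t3, T1 4 (by omega) (by omega), v0,
    vm 1 le_rfl (by omega)] at b4
  have hmid : ∀ d, 5 ≤ d → d ≤ t + 3 → diffHilb 2 X d = 6 := fun d hd hd' => by
    obtain ⟨e, rfl⟩ : ∃ e, d = e + 4 := ⟨d - 4, by omega⟩
    rw [hs3, T1 (e + 4) (by omega) (by omega), T1 (e + 3) (by omega) (by omega),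
      vm (e + 1) (by omega) (by omega), vm e (by omega) (by omega)]
    push_cast; ring
  have hlate : ∀ d, t + 5 ≤ d → diffHilb 2 X d =
      hilb (tan F X) d - hilb (tan F X) (d - 1) := fun d hd => by
    obtain ⟨e, rfl⟩ : ∃ e, d = e + 4 := ⟨d - 4, by omega⟩
    rw [hs3, ve (e + 1) (by omega), ve e (by omega), show e + 4 - 1 = e + 3 by omega]
    ring
  refine ⟨⟨fun d hd => ?_, hmid, ?_, fun d hd hd' => ?_⟩, fun h12 => ⟨?_, fun d hd => ?_⟩,
    fun hδ0 hT => ⟨?_, fun d hd => ?_⟩, fun hδ0 hT => ⟨?_, ?_, fun d hd => ?_⟩⟩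
  · have c1 := hs 0
    have c2 := hs 1
    have c3 := hs 2
    have c5 := hmid 5 le_rfl (by omega)
    simp only [zero_add, Nat.reduceAdd] at c1 c2 c3 b3' b4
    interval_cases d
    · rw [h0, b0]; rfl
    · rw [c1, b1, b0]; norm_num
    · rw [c2, b2, b1]; norm_num
    · rw [c3, b3', b2]; norm_num
    · rw [b4]; norm_num
    · rw [c5]; norm_num
  · rw [hs3, T1 (t + 4) (by omega) (by omega), T1 (t + 3) (by omega) (by omega),
      ve (t + 1) (by omega), vm t (by omega) le_rfl]
    push_cast; ring
  · rw [hlate d hd, T1 d (by omega) (by omega), T1 (d - 1) (by omega) (by omega)]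
    omega
  · rw [hlate _ (by omega), T1 (2 * t + δ - 1) (by omega) (by omega),
      T2 (2 * t + δ) (by omega)]
    omega
  · rw [hlate d (by omega), T2 d (by omega), T2 (d - 1) (by omega)]
    ring
  · rw [hlate _ (by omega), hT, T1 _ (by omega) (by omega)]
    omega
  · have hT' : hilb (tan F X) (d - 1) = 6 * t := by
      by_cases h : d = 2 * t + 1
      · rw [h, Nat.add_sub_cancel, hT]
      · rw [T2 _ (by omega)]; omega
    rw [hlate d (by omega), T2 d (by omega), hT']
    omega
  · rw [hlate _ (by omega), T1 (2 * t - 1) (by omega) (by omega)]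
    omega
  · rw [hlate _ (by omega), T2 (2 * t + 1) (by omega), Nat.add_sub_cancel]
    omega
  · rw [hlate d (by omega), T2 d (by omega), T2 (d - 1) (by omega)]
    ring

/-- The generic reduced profile for `δ = 0`. -/
theorem isReducedProfile_zero [Infinite k] (hF : F.IsHomogeneous 3) (hp : Prime F) (ht : 5 < t)
    (hcard : X.card = 3 * t) (hX : ∀ p ∈ X, OnCurve F p) (h : 3 * t ≤ hilb (van X) t) :
    IsReducedProfile t 0 (diffHilb 1 X) := by
  have hS := isCurveScheme_van hX
  refine (isReducedProfile_iff (by omega)).2 ⟨?_, fun d h1 h2 => ?_, fun d hd => ?_⟩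
  · exact hS.hilb_of_lt hF hp (by omega)
  · rcases Nat.lt_or_ge d t with hlt | hge
    · rw [hS.hilb_of_lt hF hp (by omega), if_neg (by omega)]
    · obtain rfl : d = t := by omega
      have := hS.hilb_le d
      omega
  · rw [hS.hilb_of_gt hF hp (by omega) (by omega), hcard, add_zero]

end Profile

/-! ### Directional derivatives and polars of a cubic -/

/-- The derivative of `f` at `p` in the direction `v`. -/
def dirD (f : MvPolynomial (Fin 3) k) (p v : Fin 3 → k) : k := ∑ i, v i * eval p (pderiv i f)

@[simp] theorem dirD_zero (p v : Fin 3 → k) : dirD 0 p v = 0 := by simp [dirD]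

@[simp] theorem dirD_C (c : k) (p v : Fin 3 → k) : dirD (C c) p v = 0 := by simp [dirD]

@[simp] theorem dirD_X (i : Fin 3) (p v : Fin 3 → k) : dirD (X i) p v = v i := by
  simp [dirD, pderiv_X, Pi.single_apply]

@[simp] theorem dirD_add (f g : MvPolynomial (Fin 3) k) (p v : Fin 3 → k) :
    dirD (f + g) p v = dirD f p v + dirD g p v := by
  simp [dirD, mul_add, Finset.sum_add_distrib]

@[simp] theorem dirD_mul (f g : MvPolynomial (Fin 3) k) (p v : Fin 3 → k) :
    dirD (f * g) p v = dirD f p v * eval p g + eval p f * dirD g p v := by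
  simp only [dirD, pderiv_mul, map_add, map_mul, Finset.sum_mul, Finset.mul_sum,
    ← Finset.sum_add_distrib]
  exact Finset.sum_congr rfl fun i _ => by ring

@[simp] theorem dirD_lin (m p v : Fin 3 → k) : dirD (lin m) p v = ∑ i, m i * v i := by
  simp [dirD, mul_comm]

theorem dirD_add_right (f : MvPolynomial (Fin 3) k) (p v w : Fin 3 → k) :
    dirD f p (v + w) = dirD f p v + dirD f p w := by
  simp [dirD, add_mul, Finset.sum_add_distrib]

theorem dirD_smul_right (f : MvPolynomial (Fin 3) k) (p v : Fin 3 → k) (c : k) :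
    dirD f p (c • v) = c * dirD f p v := by
  simp [dirD, Finset.mul_sum, mul_assoc]

theorem dirD_self {f : MvPolynomial (Fin 3) k} {d : ℕ} (hf : f.IsHomogeneous d) (p : Fin 3 → k) :
    dirD f p p = d * eval p f := euler hf p

theorem isHomogeneous_pderiv {f : MvPolynomial (Fin 3) k} {d : ℕ} (hf : f.IsHomogeneous (d + 1))
    (i : Fin 3) : (pderiv i f).IsHomogeneous d := by
  simpa using hf.pderiv (i := i)

/-- The gradient of `f` at `p`. -/
def grad (f : MvPolynomial (Fin 3) k) (p : Fin 3 → k) : Fin 3 → k := fun i => eval p (pderiv i f)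

theorem sum_grad_mul (f : MvPolynomial (Fin 3) k) (p v : Fin 3 → k) :
    ∑ i, grad f p i * v i = dirD f p v :=
  Finset.sum_congr rfl fun _ _ => mul_comm _ _

/-- The equation of the polar of the curve `f = 0` with respect to `v`. -/
def polar (f : MvPolynomial (Fin 3) k) (v : Fin 3 → k) : MvPolynomial (Fin 3) k :=
  ∑ i, C (v i) * pderiv i f

@[simp] theorem eval_polar (f : MvPolynomial (Fin 3) k) (p v : Fin 3 → k) :
    eval p (polar f v) = dirD f p v := by
  simp [polar, dirD]

theorem isHomogeneous_polar {f : MvPolynomial (Fin 3) k} {d : ℕ} (hf : f.IsHomogeneous (d + 1))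
    (v : Fin 3 → k) : (polar f v).IsHomogeneous d :=
  IsHomogeneous.sum _ _ _ fun i _ => (isHomogeneous_pderiv hf i).C_mul _

/-- To prove an additive property of cubic forms, it suffices to check it on monomials. -/
theorem cubic_induction {P : MvPolynomial (Fin 3) k → Prop} (h0 : P 0)
    (hadd : ∀ f g, P f → P g → P (f + g))
    (hmon : ∀ (c : k) (i j l : Fin 3), P (X i * (X j * (X l * C c))))
    {F : MvPolynomial (Fin 3) k} (hF : F.IsHomogeneous 3) : P F := by
  have hsum : ∀ f : Fin 3 → MvPolynomial (Fin 3) k, (∀ i, P (f i)) → P (∑ i, f i) := fun _ hf =>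
    Finset.sum_induction _ P (fun a b => hadd a b) h0 fun _ _ => hf _
  obtain ⟨g, hg, rfl⟩ := exists_sum_X_mul (d := 2) hF
  refine hsum _ fun i => ?_
  obtain ⟨g', hg', hgg'⟩ := exists_sum_X_mul (d := 1) (hg i)
  rw [hgg', Finset.mul_sum]
  refine hsum _ fun j => ?_
  obtain ⟨g'', hg'', hgg''⟩ := exists_sum_X_mul (d := 0) (hg' j)
  rw [hgg'', Finset.mul_sum, Finset.mul_sum]
  refine hsum _ fun l => ?_
  rw [totalDegree_eq_zero_iff_eq_C.1 ((totalDegree_zero_iff_isHomogeneous _).2 (hg'' l))]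
  exact hmon _ i j l

/-- Taylor expansion along a line without denominators: both mixed coefficients are first
derivatives, taken at either end. For a and c on the curve it factors as αβ(α D_aF(c) + β D_cF(a)),
which gives the third intersection point. -/
theorem eval_cubic_add {F : MvPolynomial (Fin 3) k} (hF : F.IsHomogeneous 3) (a c : Fin 3 → k)
    (α β : k) : eval (α • a + β • c) F = α ^ 3 * eval a F + α ^ 2 * β * dirD F a c +
      α * β ^ 2 * dirD F c a + β ^ 3 * eval c F := by
  refine cubic_induction (P := fun F => eval (α • a + β • c) F = α ^ 3 * eval a F + α ^ 2 * β * dirD F a c +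
      α * β ^ 2 * dirD F c a + β ^ 3 * eval c F) ?_ (fun f g hf hg => ?_)
    (fun e i j l => ?_) hF
  · simp
  · rw [map_add, hf, hg]; simp; ring
  · simp; ring

theorem dirD_cubic_add_left {F : MvPolynomial (Fin 3) k} (hF : F.IsHomogeneous 3)
    (a c : Fin 3 → k) (α β : k) : dirD F (α • a + β • c) a = 3 * α ^ 2 * eval a F +
      2 * α * β * dirD F a c + β ^ 2 * dirD F c a := by
  refine cubic_induction (P := fun F => dirD F (α • a + β • c) a = 3 * α ^ 2 * eval a F +
      2 * α * β * dirD F a c + β ^ 2 * dirD F c a) ?_ (fun f g hf hg => ?_)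
    (fun e i j l => ?_) hF
  · simp
  · rw [dirD_add, hf, hg]; simp; ring
  · simp; ring

/-- The coefficient of s is the symmetric trilinear form of F, written through the polar of x so
that it visibly vanishes when that polar does. -/
theorem dirD_cubic_add_smul {F : MvPolynomial (Fin 3) k} (hF : F.IsHomogeneous 3)
    (v x y : Fin 3 → k) (s : k) : dirD F (v + s • x) y = dirD F v y +
      s * (dirD F (v + y) x - dirD F v x - dirD F y x) + s ^ 2 * dirD F x y := by
  refine cubic_induction (P := fun F => dirD F (v + s • x) y = dirD F v y +
      s * (dirD F (v + y) x - dirD F v x - dirD F y x) + s ^ 2 * dirD F x y) ?_ (fun f g hf hg => ?_)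
    (fun e i j l => ?_) hF
  · simp
  · rw [dirD_add, hf, hg]; simp; ring
  · simp; ring

theorem exists_pderiv_ne_zero {F : MvPolynomial (Fin 3) k} (hF : F.IsHomogeneous 3)
    (hs : IsSmoothCurve F) {v : Fin 3 → k} (hv : v ≠ 0) (h : eval v F = 0) :
    ∃ i, eval v (pderiv i F) ≠ 0 := by
  obtain ⟨i, hi⟩ := (hs _ ((eval_rep_mk_eq_zero_iff hF v hv).2 h)).2
  exact ⟨i, fun h0 => hi ((eval_rep_mk_eq_zero_iff (isHomogeneous_pderiv hF i) v hv).2 h0)⟩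

theorem eval_polynomial_aeval (g : Fin 3 → Polynomial k) (f : MvPolynomial (Fin 3) k) (s : k) :
    (aeval g f).eval s = eval (fun i => (g i).eval s) f := by
  induction f using MvPolynomial.induction_on with
  | C a => simp [Polynomial.algebraMap_eq]
  | add p q hp hq => simp [hp, hq]
  | mul_X p i hp => simp [hp]

theorem sum_fin_three_rotate {M : Type*} [AddCommMonoid M] (f : Fin 3 → M) (s : Fin 3) :
    ∑ i, f i = f s + f (s + 1) + f (s + 2) := by
  rw [Fin.sum_univ_three]
  fin_cases s
  · rfl
  · change f 0 + f 1 + f 2 = f 1 + f 2 + f 0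
    abel
  · change f 0 + f 1 + f 2 = f 2 + f 0 + f 1
    abel

theorem eq_or_eq_rotate : ∀ j i : Fin 3, i = j ∨ i = j + 1 ∨ i = j + 2 := by decide

theorem eq_or_eq_of_ne :
    ∀ j a i r : Fin 3, a ≠ j → a ≠ i → i ≠ j → r = j ∨ r = a ∨ r = i := by decide

/-! ### Zeros on lines and strange points -/

section AlgClosed

variable [IsAlgClosed k]

/-- A form of positive degree has a zero on every line. -/
theorem exists_zero_on_span {f : MvPolynomial (Fin 3) k} {d : ℕ} (hf : f.IsHomogeneous d)
    (hd : 0 < d) (u w : Fin 3 → k) :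
    ∃ α β : k, (α ≠ 0 ∨ β ≠ 0) ∧ eval (α • u + β • w) f = 0 := by
  set P : Polynomial k := aeval (fun i => Polynomial.C (u i) + Polynomial.X * Polynomial.C (w i)) f
    with hP
  have hPe : ∀ s : k, P.eval s = eval (u + s • w) f := fun s => by
    rw [hP, eval_polynomial_aeval]
    congr 2
    ext i
    simp only [Polynomial.eval_add, Polynomial.eval_mul, Polynomial.eval_C, Polynomial.eval_X,
      Pi.add_apply, Pi.smul_apply, smul_eq_mul]
  -- If f(u + s w) is a nonzero constant c, homogeneity makes f(s u + w) equal to c s^d, so w is a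
  -- zero. The zero polynomial has degree ⊥ and falls into the other case, where a root exists.
  by_cases hdeg : P.degree = 0
  · obtain ⟨c, hc⟩ : ∃ c, P = Polynomial.C c := ⟨_, Polynomial.eq_C_of_degree_eq_zero hdeg⟩
    set Q : Polynomial k := aeval (fun i => Polynomial.X * Polynomial.C (u i) + Polynomial.C (w i)) f
      with hQ
    have hQe : ∀ s : k, Q.eval s = eval (s • u + w) f := fun s => by
      rw [hQ, eval_polynomial_aeval]
      congr 2
      ext i
      simp only [Polynomial.eval_add, Polynomial.eval_mul, Polynomial.eval_C, Polynomial.eval_X,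
        Pi.add_apply, Pi.smul_apply, smul_eq_mul]
    have hQc : Q = Polynomial.C c * Polynomial.X ^ d := by
      apply Polynomial.eq_of_infinite_eval_eq
      refine Set.Infinite.mono (s := {0}ᶜ) (fun s hs => ?_) (Set.finite_singleton (0 : k)).infinite_compl
      have hs0 : s ≠ 0 := hs
      have h1 : s • u + w = s • (u + s⁻¹ • w) := by
        rw [smul_add, smul_smul, mul_inv_cancel₀ hs0, one_smul]
      simp only [Set.mem_ofPred_eq]
      rw [hQe, h1, eval_smul_of_isHomogeneous hf, ← hPe, hc]
      simp only [Polynomial.eval_mul, Polynomial.eval_C, Polynomial.eval_pow, Polynomial.eval_X]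
      ring
    refine ⟨0, 1, Or.inr one_ne_zero, ?_⟩
    have h2 := hQe 0
    rw [hQc, zero_smul, zero_add] at h2
    rw [zero_smul, zero_add, one_smul, ← h2]
    simp [hd.ne']
  · obtain ⟨s, hs⟩ := IsAlgClosed.exists_root P hdeg
    refine ⟨1, s, Or.inl one_ne_zero, ?_⟩
    rw [one_smul, ← hPe]
    exact hs

theorem exists_zero_on_lin {f : MvPolynomial (Fin 3) k} {d : ℕ} (hf : f.IsHomogeneous d)
    (hd : 0 < d) (a : Fin 3 → k) :
    ∃ v : Fin 3 → k, v ≠ 0 ∧ eval v (lin a) = 0 ∧ eval v f = 0 := by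
  obtain ⟨s, hs⟩ : ∃ s, a = 0 ∨ a s ≠ 0 := by
    by_cases h : a = 0
    · exact ⟨0, Or.inl h⟩
    · obtain ⟨s, hs⟩ := Function.ne_iff.1 h
      exact ⟨s, Or.inr hs⟩
  have h01 : s + 1 ≠ s := by simp
  have h02 : s + 2 ≠ s := by simp
  have h12 : s + 1 ≠ s + 2 := by simp
  -- Two independent vectors on the line. When a = 0 the quotients are 0 by convention, and the two
  -- vectors still serve.
  obtain ⟨α, β, h, h0⟩ := exists_zero_on_span hf hd
    (Pi.single (s + 1) 1 - Pi.single s (a (s + 1) / a s))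
    (Pi.single (s + 2) 1 - Pi.single s (a (s + 2) / a s))
  refine ⟨_, fun hv => ?_, ?_, h0⟩
  · have h1 := congrFun hv (s + 1)
    have h2 := congrFun hv (s + 2)
    simp at h1 h2
    rcases h with h | h
    · exact h h1
    · exact h h2
  · rw [eval_lin, sum_fin_three_rotate _ s]
    rcases hs with rfl | hs
    · simp
    · simp
      field_simp
      ring

theorem exists_point_notMem {f : MvPolynomial (Fin 3) k} {d : ℕ} (hf : f.IsHomogeneous d)
    (hd : 0 < d) (Y : Finset (Plane k)) : ∃ p : Plane k, eval p.rep f = 0 ∧ p ∉ Y := by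
  obtain ⟨a, ha⟩ := exists_lin_avoiding Y
  obtain ⟨v, hv, hva, hvf⟩ := exists_zero_on_lin hf hd a
  exact ⟨Projectivization.mk k v hv, (eval_rep_mk_eq_zero_iff hf v hv).2 hvf, fun hY =>
    ha _ hY ((eval_rep_mk_eq_zero_iff (isHomogeneous_lin a) v hv).2 hva)⟩

/-- A form that is not a multiple of `F` is nonzero at infinitely many points of the curve. -/
theorem exists_point_ne_zero {F g : MvPolynomial (Fin 3) k} (hF : F.IsHomogeneous 3)
    (hp : Prime F) {e : ℕ} (hg : g.IsHomogeneous e) (hFg : ¬ F ∣ g) (Y : Finset (Plane k)) :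
    ∃ p : Plane k, OnCurve F p ∧ p ∉ Y ∧ eval p.rep g ≠ 0 := by
  classical
  have hfin := finite_common_zeros hF hp hg hFg
  obtain ⟨p, hpF, hpY⟩ := exists_point_notMem hF (by norm_num) (Y ∪ hfin.toFinset)
  rw [Finset.mem_union, not_or] at hpY
  refine ⟨p, hpF, hpY.1, fun h => hpY.2 ?_⟩
  rw [Set.Finite.mem_toFinset]
  exact ⟨hpF, h⟩

/-- A smooth cubic has no strange point on it; in characteristic two it has no strange point at
all. -/
theorem polar_ne_zero {F : MvPolynomial (Fin 3) k} (hF : F.IsHomogeneous 3)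
    (hs : IsSmoothCurve F) {x : Fin 3 → k} (hx : x ≠ 0) (h : eval x F = 0 ∨ (2 : k) = 0) :
    polar F x ≠ 0 := by
  intro h0
  have hD : ∀ v, dirD F v x = 0 := fun v => by rw [← eval_polar, h0, map_zero]
  by_cases h2 : (2 : k) = 0
  -- In characteristic two Euler's formula reads D_vF(v) = F(v), so a common zero of the partial
  -- derivatives lies on the curve. Such a zero is constructed.
  · have h3 : (3 : k) = 1 := by linear_combination h2
    have hE : ∀ v, dirD F v v = eval v F := fun v => by
      rw [dirD_self hF]; push_cast; rw [h3, one_mul]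
    have hFx : eval x F = 0 := by rw [← hE, hD]
    obtain ⟨j, hj⟩ := exists_pderiv_ne_zero hF hs hx hFx
    set m := grad F x with hm
    have hmx : ∑ i, m i * x i = 0 := by rw [hm, sum_grad_mul, hD]
    obtain ⟨a, i, hxa, hsum, haj, hai, hij⟩ : ∃ a i : Fin 3, x a ≠ 0 ∧
        (∀ f : Fin 3 → k, ∑ i, f i = f j + f a + f i) ∧ a ≠ j ∧ a ≠ i ∧ i ≠ j := by
      by_cases h1 : x (j + 1) = 0
      · by_cases h2 : x (j + 2) = 0
        · rw [sum_fin_three_rotate _ j, h1, h2, mul_zero, mul_zero, add_zero, add_zero,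
            mul_eq_zero] at hmx
          exfalso
          have hxj := hmx.resolve_left hj
          refine hx (funext fun i => ?_)
          rcases eq_or_eq_rotate j i with rfl | rfl | rfl <;> assumption
        · exact ⟨j + 2, j + 1, h2, fun f => by rw [sum_fin_three_rotate f j]; ring,
            by simp, by simp, by simp⟩
      · exact ⟨j + 1, j + 2, h1, fun f => by rw [sum_fin_three_rotate f j],
          by simp, by simp, by simp⟩
    -- The vector w is tangent at x, and w, e_j, x span the space because x a ≠ 0. As the polar of x
    -- vanishes, the gradient at v + s x is grad(v) + s² grad(x). Choosing v in the span of w and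
    -- e_j with D_vF(w) = 0, and then s to cancel the j-th partial, kills the derivatives along w,
    -- e_j and x.
    set w : Fin 3 → k := Pi.single i 1 - Pi.single j (m i / m j) with hw
    have hmj : m j ≠ 0 := hj
    have hdw : ∀ y, dirD F y w = eval y (pderiv i F) - m i / m j * eval y (pderiv j F) := by
      intro y
      simp [dirD, hw, sub_mul, Finset.sum_sub_distrib, Pi.single_apply]
    obtain ⟨α, β, hαβ, hv⟩ := exists_zero_on_span (isHomogeneous_polar hF w) (by norm_num) w
      (Pi.single j 1)
    set v := α • w + β • (Pi.single j 1 : Fin 3 → k) with hvdef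
    rw [eval_polar] at hv
    obtain ⟨s, hs2⟩ := IsAlgClosed.exists_pow_nat_eq (-(eval v (pderiv j F)) / m j)
      (n := 2) (by norm_num)
    have hB : ∀ y, dirD F (v + s • x) y = dirD F v y + s ^ 2 * dirD F x y := fun y => by
      rw [dirD_cubic_add_smul hF, hD, hD, hD]; ring
    set y := v + s • x with hy
    have hgj : ∀ z, dirD F z (Pi.single j 1) = eval z (pderiv j F) := fun z => by
      simp [dirD, Pi.single_apply]
    have e1 : dirD F y w = 0 := by
      rw [hB, hv, hdw x]
      change 0 + s ^ 2 * (m i - m i / m j * m j) = 0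
      field_simp
      ring
    have e2 : eval y (pderiv j F) = 0 := by
      rw [← hgj, hB, hgj, hgj, hs2]
      change eval v (pderiv j F) + -(eval v (pderiv j F)) / m j * m j = 0
      field_simp
      ring
    have e3 : eval y (pderiv i F) = 0 := by
      rw [hdw, e2, mul_zero, sub_zero] at e1
      exact e1
    have e4 : eval y (pderiv a F) = 0 := by
      have := hD y
      rw [dirD, hsum, e2, e3, mul_zero, mul_zero, zero_add, add_zero, mul_eq_zero] at this
      exact this.resolve_left hxa
    have hgrad : ∀ r, eval y (pderiv r F) = 0 := by
      intro r
      rcases eq_or_eq_of_ne j a i r haj hai hij with rfl | rfl | rfl <;> assumption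
    have hy0 : y ≠ 0 := by
      intro hy0
      have c1 := congrFun hy0 a
      have c2 := congrFun hy0 i
      have c3 := congrFun hy0 j
      simp [hy, hvdef, hw, haj, hai, hij, hij.symm, hxa] at c1 c2 c3
      simp [c1] at c2 c3
      simp [c2] at c3
      rcases hαβ with h | h
      · exact h c2
      · exact h c3
    obtain ⟨r, hr⟩ := exists_pderiv_ne_zero hF hs hy0
      (by rw [← hE, dirD]; exact Finset.sum_eq_zero fun r _ => by rw [hgrad, mul_zero])
    exact hr (hgrad r)
  · have hFx := h.resolve_right h2
    obtain ⟨i, hi⟩ := exists_pderiv_ne_zero hF hs hx hFx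
    have h1 := dirD_cubic_add_left hF x (Pi.single i 1) 1 1
    rw [hD, hD, hFx] at h1
    have h3 : dirD F x (Pi.single i 1) = eval x (pderiv i F) := by simp [dirD, Pi.single_apply]
    rw [h3] at h1
    apply hi
    have h4 : 2 * eval x (pderiv i F) = 0 := by linear_combination -h1
    exact (mul_eq_zero.1 h4).resolve_left h2

end AlgClosed

/-! ### Cross products and lines transversal to the cubic -/

theorem eval_crossProduct_eq_neg (a b c : Fin 3 → k) :
    eval b (lin (crossProduct a c)) = -eval c (lin (crossProduct a b)) := by
  simp only [eval_lin, Fin.sum_univ_three, cross_apply]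
  simp
  ring

theorem eval_crossProduct_left (a c : Fin 3 → k) : eval a (lin (crossProduct a c)) = 0 := by
  simp only [eval_lin, Fin.sum_univ_three, cross_apply]
  simp
  ring

theorem eval_crossProduct_right (a c : Fin 3 → k) : eval c (lin (crossProduct a c)) = 0 := by
  simp only [eval_lin, Fin.sum_univ_three, cross_apply]
  simp
  ring

theorem mul_sub_mul_eq_zero_of_crossProduct {m n : Fin 3 → k} (h : crossProduct m n = 0)
    (i j : Fin 3) : m i * n j = m j * n i := by
  have h0 := congrFun h 0
  have h1 := congrFun h 1
  have h2 := congrFun h 2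
  simp [cross_apply] at h0 h1 h2
  fin_cases i <;> fin_cases j <;> simp
  all_goals first | linear_combination h0 | linear_combination -h0 | linear_combination h1 |
    linear_combination -h1 | linear_combination h2 | linear_combination -h2

/-- Two covectors are independent when one of them vanishes at a vector but not the other. -/
theorem crossProduct_ne_zero {m n a : Fin 3 → k} (hm : m ≠ 0) (hma : ∑ i, m i * a i = 0)
    (hna : ∑ i, n i * a i ≠ 0) : crossProduct m n ≠ 0 := by
  intro h
  refine hm (funext fun i => ?_)
  have : m i * ∑ j, n j * a j = (∑ j, m j * a j) * n i := by
    rw [Finset.mul_sum, Finset.sum_mul]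
    refine Finset.sum_congr rfl fun j _ => ?_
    rw [← mul_assoc, mul_sub_mul_eq_zero_of_crossProduct h]
    ring
  rw [hma, zero_mul, mul_eq_zero] at this
  exact this.resolve_right hna

theorem crossProduct_rep_ne_zero {a b : Plane k} (h : a ≠ b) :
    crossProduct a.rep b.rep ≠ 0 := by
  intro h0
  obtain ⟨j, hj⟩ := exists_rep_ne_zero b
  refine h (eq_of_rep_eq_smul (c := a.rep j / b.rep j) (funext fun i => ?_))
  have := mul_sub_mul_eq_zero_of_crossProduct h0 i j
  simp only [Pi.smul_apply, smul_eq_mul]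
  field_simp
  linear_combination this

theorem not_dvd_of_lt {F g : MvPolynomial (Fin 3) k} (hF : F.IsHomogeneous 3) {e : ℕ}
    (hg : g.IsHomogeneous e) (he : e < 3) (h0 : g ≠ 0) : ¬ F ∣ g := fun h =>
  h0 (eq_zero_of_isHomogeneous_of_dvd hF hg he h)

theorem not_dvd_lin {F : MvPolynomial (Fin 3) k} (hF : F.IsHomogeneous 3) {a : Fin 3 → k}
    (ha : a ≠ 0) : ¬ F ∣ lin a :=
  not_dvd_of_lt hF (isHomogeneous_lin a) (by norm_num) (lin_ne_zero ha)

theorem not_dvd_prod {F : MvPolynomial (Fin 3) k} (hp : Prime F) {ι : Type*} {s : Finset ι}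
    {f : ι → MvPolynomial (Fin 3) k} (h : ∀ i ∈ s, ¬ F ∣ f i) : ¬ F ∣ ∏ i ∈ s, f i := by
  rw [hp.dvd_finsetProd_iff]
  rintro ⟨i, hi, hd⟩
  exact h i hi hd

theorem grad_ne_zero {F : MvPolynomial (Fin 3) k} {a : Plane k} (ha : IsSmoothPoint F a) :
    grad F a.rep ≠ 0 := by
  obtain ⟨i, hi⟩ := ha.2
  exact fun h => hi (congrFun h i)

theorem eval_lin_grad (F : MvPolynomial (Fin 3) k) (p v : Fin 3 → k) :
    eval v (lin (grad F p)) = dirD F p v := by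
  rw [eval_lin, sum_grad_mul]

section AlgClosed

variable [IsAlgClosed k]

/-- Through a point `a` of a cubic curve there is a line that meets the curve in three points and
avoids a given finite set. -/
theorem exists_transversal_line {F : MvPolynomial (Fin 3) k} (hF : F.IsHomogeneous 3)
    (hp : Prime F) {a : Plane k} (ha : IsSmoothPoint F a) (hpol : polar F a.rep ≠ 0)
    (B : Finset (Plane k)) (haB : a ∉ B) :
    ∃ b c : Plane k, OnCurve F b ∧ OnCurve F c ∧ a ≠ b ∧ a ≠ c ∧ b ≠ c ∧
      eval b.rep (lin (crossProduct a.rep c.rep)) = 0 ∧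
      (∀ p ∈ B, eval p.rep (lin (crossProduct a.rep c.rep)) ≠ 0) ∧
      dirD F a.rep c.rep ≠ 0 ∧ dirD F c.rep a.rep ≠ 0 ∧
      ∃ γ : k, γ ≠ 0 ∧ b.rep = γ • (dirD F c.rep a.rep • a.rep +
        (-dirD F a.rep c.rep) • c.rep) := by
  have hFa : eval a.rep F = 0 := ha.1
  have hcross : ∀ p ∈ B, crossProduct a.rep p.rep ≠ 0 := fun p hpB =>
    crossProduct_rep_ne_zero (fun h => haB (h ▸ hpB))
  -- The point c is taken off the tangent at a, off the polar of a, and off the lines joining a to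
  -- B. The first two make the line ac transversal at a and at c, so the third point b differs from
  -- both.
  obtain ⟨c, hcF, hca, hc⟩ := exists_point_ne_zero hF hp
    (g := lin (grad F a.rep) * polar F a.rep * ∏ p ∈ B, lin (crossProduct a.rep p.rep))
    (((isHomogeneous_lin _).mul (isHomogeneous_polar hF _)).mul
      (IsHomogeneous.prod _ _ _ fun p _ => isHomogeneous_lin _))
    (by
      refine hp.not_dvd_mul (hp.not_dvd_mul (not_dvd_lin hF (grad_ne_zero ha))
        (not_dvd_of_lt hF (isHomogeneous_polar hF _) (by norm_num) hpol)) ?_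
      exact not_dvd_prod hp fun p hpB => not_dvd_lin hF (hcross p hpB)) {a}
  rw [Finset.mem_singleton] at hca
  rw [map_mul, map_mul, eval_lin_grad, eval_polar, map_prod] at hc
  have hac : dirD F a.rep c.rep ≠ 0 := left_ne_zero_of_mul (left_ne_zero_of_mul hc)
  have hca' : dirD F c.rep a.rep ≠ 0 := right_ne_zero_of_mul (left_ne_zero_of_mul hc)
  have hB := Finset.prod_ne_zero_iff.1 (right_ne_zero_of_mul hc)
  have hFc : eval c.rep F = 0 := hcF
  set α := dirD F c.rep a.rep
  set β := -dirD F a.rep c.rep with hβ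
  have hβ0 : β ≠ 0 := neg_ne_zero.2 hac
  have hnot : ∀ (α β s : k) (p q : Plane k), p ≠ q → β ≠ 0 → α • p.rep + β • q.rep ≠ s • p.rep := by
    intro α β s p q hpq hβ h
    refine hpq.symm (eq_of_rep_eq_smul (c := β⁻¹ * (s - α)) ?_)
    rw [mul_smul, sub_smul, ← h, add_sub_cancel_left, smul_smul, inv_mul_cancel₀ hβ, one_smul]
  have hv : α • a.rep + β • c.rep ≠ 0 := by
    have := hnot α β 0 a c (Ne.symm hca) hβ0
    rwa [zero_smul] at this
  obtain ⟨γ, hγ, hb⟩ := exists_rep_mk_eq_smul _ hv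
  refine ⟨Projectivization.mk k _ hv, c, ?_, hcF, ?_, Ne.symm hca, ?_, ?_, fun p hpB => ?_, hac, hca',
    γ, hγ, hb⟩
  · refine (eval_rep_mk_eq_zero_iff hF _ hv).2 ?_
    rw [eval_cubic_add hF, hFa, hFc, hβ]
    ring
  · intro h
    rw [← h] at hb
    exact hnot α β γ⁻¹ a c (Ne.symm hca) hβ0 ((inv_smul_eq_iff₀ hγ).2 hb).symm
  · intro h
    rw [h] at hb
    refine hnot β α γ⁻¹ c a hca hca' ?_
    rw [add_comm]
    exact ((inv_smul_eq_iff₀ hγ).2 hb).symm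
  · rw [hb, eval_smul_of_isHomogeneous (isHomogeneous_lin _), eval_lin]
    have h1 := eval_crossProduct_left a.rep c.rep
    have h2 := eval_crossProduct_right a.rep c.rep
    rw [eval_lin] at h1 h2
    simp only [Pi.add_apply, Pi.smul_apply, smul_eq_mul, mul_add, Finset.sum_add_distrib]
    rw [Finset.sum_congr rfl fun i _ => mul_left_comm (crossProduct a.rep c.rep i) α _,
      Finset.sum_congr rfl fun i _ => mul_left_comm (crossProduct a.rep c.rep i) β _,
      ← Finset.mul_sum, ← Finset.mul_sum, h1, h2]
    ring
  · rw [eval_crossProduct_eq_neg, neg_ne_zero]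
    exact hB p hpB

/-- A union of `m` lines that meets the smooth cubic `F = 0` in `3m` distinct points. -/
theorem exists_lines {F : MvPolynomial (Fin 3) k} (hF : F.IsHomogeneous 3) (hp : Prime F)
    (hs : IsSmoothCurve F) (B : Finset (Plane k)) (m : ℕ) :
    ∃ (S : Finset (Plane k)) (M : MvPolynomial (Fin 3) k), S.card = 3 * m ∧
      (∀ p ∈ S, OnCurve F p) ∧ (∀ p ∈ S, p ∉ B) ∧ M.IsHomogeneous m ∧ ¬ F ∣ M ∧
      (∀ p ∈ S, eval p.rep M = 0) ∧ ∀ p ∈ B, eval p.rep M ≠ 0 := by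
  classical
  induction m with
  | zero =>
    exact ⟨∅, 1, by simp, by simp, by simp, isHomogeneous_one _ _,
      fun h => hp.not_isUnit (isUnit_of_dvd_one h), by simp, by simp⟩
  | succ m ih =>
    obtain ⟨S, M, hcard, hSF, hSB, hM, hFM, hMS, hMB⟩ := ih
    obtain ⟨a, ha, haB⟩ := exists_point_notMem hF (by norm_num) (B ∪ S)
    obtain ⟨b, c, hb, hc, hab, hac, hbc, hl, hlB, -, -, -⟩ :=
      exists_transversal_line hF hp (hs a ha) (polar_ne_zero hF hs a.rep_nonzero (Or.inl ha))
        (B ∪ S) haB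
    set l := lin (crossProduct a.rep c.rep)
    have hla : eval a.rep l = 0 := eval_crossProduct_left _ _
    have hlc : eval c.rep l = 0 := eval_crossProduct_right _ _
    have hbB : b ∉ B ∪ S := fun h => hlB b h hl
    have hcB : c ∉ B ∪ S := fun h => hlB c h hlc
    rw [Finset.mem_union, not_or] at haB hbB hcB
    refine ⟨insert a (insert b (insert c S)), M * l, ?_, ?_, ?_, hM.mul (isHomogeneous_lin _),
      hp.not_dvd_mul hFM (not_dvd_lin hF (crossProduct_rep_ne_zero hac)), ?_, ?_⟩
    · rw [Finset.card_insert_of_notMem, Finset.card_insert_of_notMem,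
        Finset.card_insert_of_notMem, hcard]
      · ring
      · exact hcB.2
      · simp [hbc, hbB.2]
      · simp [hab, hac, haB.2]
    · simp only [Finset.forall_mem_insert]
      exact ⟨ha, hb, hc, hSF⟩
    · simp only [Finset.forall_mem_insert]
      exact ⟨haB.1, hbB.1, hcB.1, hSB⟩
    · simp only [Finset.forall_mem_insert, map_mul, hla, hl, hlc, mul_zero, true_and]
      exact fun p hpS => by rw [hMS p hpS, zero_mul]
    · intro p hpB
      rw [map_mul]
      exact mul_ne_zero (hMB p hpB) (hlB p (Finset.mem_union_left _ hpB))

end AlgClosed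

/-! ### A pencil that is generically not tangent to the cubic -/

/-- Forms in the ideal of a subscheme of the cubic curve are, modulo the cubic, combinations of any
independent family of the expected size. -/
theorem exists_dvd_sub_sum {F : MvPolynomial (Fin 3) k} (hF : F.IsHomogeneous 3) (hp : Prime F)
    {I : Ideal (MvPolynomial (Fin 3) k)} (hFI : F ∈ I) {d n : ℕ} (hd : 0 < d)
    (hn : hilb I d + n = 3 * d) (G : Fin n → MvPolynomial (Fin 3) k)
    (hG : ∀ i, (G i).IsHomogeneous d) (hGI : ∀ i, G i ∈ I)
    (hind : ∀ c : Fin n → k, F ∣ ∑ i, C (c i) * G i → ∀ i, c i = 0)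
    {f : MvPolynomial (Fin 3) k} (hf : f.IsHomogeneous d) (hfI : f ∈ I) :
    ∃ c : Fin n → k, F ∣ f - ∑ i, C (c i) * G i := by
  set J : Ideal (MvPolynomial (Fin 3) k) := Ideal.span {F} with hJ
  have hS : hilb J d = 3 * d := by
    rw [hilb_of_mem_iff_cubic_dvd hF hp.ne_zero fun f _ => Ideal.mem_span_singleton,
      if_neg hd.ne']
  have hle : gr J d ≤ gr I d := by
    intro f hf
    have h1 : (f : MvPolynomial (Fin 3) k) ∈ J := by simpa using hf
    have h2 : (f : MvPolynomial (Fin 3) k) ∈ I :=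
      (Ideal.span_le.2 (by simpa using hFI)) h1
    simpa using h2
  set W := (gr I d).map (gr J d).mkQ with hW
  have hWr : Module.finrank k W = n := by
    have h1 := Submodule.finrank_quotient_add_finrank W
    have h2 := LinearEquiv.finrank_eq (Submodule.quotientQuotientEquivQuotient (gr J d) (gr I d) hle)
    rw [hilb_eq] at hS hn
    rw [← hW] at h2
    omega
  set w : Fin n → W := fun i => ⟨(gr J d).mkQ ⟨G i, hG i⟩,
    Submodule.mem_map_of_mem (by simpa using hGI i)⟩ with hw
  have hcomb : ∀ c : Fin n → k, ((∑ i, c i • w i : W) : Hm k d ⧸ gr J d) =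
      (gr J d).mkQ (∑ i, c i • ⟨G i, hG i⟩) := fun c => by
    simp [hw]
  have hcoe : ∀ c : Fin n → k, ((∑ i, c i • (⟨G i, hG i⟩ : Hm k d) : Hm k d) :
      MvPolynomial (Fin 3) k) = ∑ i, C (c i) * G i := fun c => by
    simp [smul_eq_C_mul]
  have hli : LinearIndependent k w := by
    rw [Fintype.linearIndependent_iff]
    intro c hc
    apply hind c
    have h1 := hcomb c
    rw [hc, Submodule.coe_zero, eq_comm, Submodule.mkQ_apply, Submodule.Quotient.mk_eq_zero] at h1
    rw [← Ideal.mem_span_singleton, ← hcoe]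
    simpa using h1
  have hspan := hli.span_eq_top_of_card_eq_finrank' (by rw [hWr]; simp)
  have hfW : (⟨(gr J d).mkQ ⟨f, hf⟩, Submodule.mem_map_of_mem (by simpa using hfI)⟩ : W) ∈
      Submodule.span k (Set.range w) := by rw [hspan]; trivial
  obtain ⟨c, hc⟩ := (Submodule.mem_span_range_iff_exists_fun k).1 hfW
  refine ⟨c, ?_⟩
  have h1 := congrArg Subtype.val hc
  rw [hcomb, eq_comm, ← sub_eq_zero, ← map_sub, Submodule.mkQ_apply,
    Submodule.Quotient.mk_eq_zero] at h1
  rw [← Ideal.mem_span_singleton, ← hcoe]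
  simpa using h1

theorem sum_mul_crossProduct (m g u : Fin 3 → k) :
    ∑ i, g i * crossProduct u m i = ∑ i, m i * crossProduct g u i := by
  simp only [Fin.sum_univ_three, cross_apply]
  simp
  ring

theorem dirD_crossProduct (F : MvPolynomial (Fin 3) k) (q u m : Fin 3 → k) :
    dirD F q (crossProduct u m) = ∑ i, m i * crossProduct (grad F q) u i := by
  rw [← sum_grad_mul, sum_mul_crossProduct]

/-- The vector grad F(q) × u is tangent to the curve at q and depends polynomially on q, so it acts
as a derivation along the curve. -/
theorem dirD_grad_crossProduct (F : MvPolynomial (Fin 3) k) (q u : Fin 3 → k) :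
    dirD F q (crossProduct (grad F q) u) = 0 := by
  rw [← sum_grad_mul]
  simp only [Fin.sum_univ_three, cross_apply]
  simp
  ring

theorem dirD_smul_left {F : MvPolynomial (Fin 3) k} (hF : F.IsHomogeneous 3) (γ : k)
    (v w : Fin 3 → k) : dirD F (γ • v) w = γ ^ 2 * dirD F v w := by
  rw [← eval_polar, eval_smul_of_isHomogeneous (isHomogeneous_polar hF w), eval_polar]

section ThirdPoint

variable {F : MvPolynomial (Fin 3) k} {a b c : Fin 3 → k} {γ : k}

theorem dirD_thirdPoint_left (hF : F.IsHomogeneous 3) (ha : eval a F = 0)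
    (hac : dirD F a c ≠ 0) (hγ : γ ≠ 0)
    (hb : b = γ • (dirD F c a • a + (-dirD F a c) • c)) : dirD F a b ≠ 0 := by
  rw [hb, dirD_smul_right, dirD_add_right, dirD_smul_right, dirD_smul_right, dirD_self hF, ha]
  refine mul_ne_zero hγ ?_
  rw [mul_zero, mul_zero, zero_add, neg_mul, neg_ne_zero]
  exact mul_ne_zero hac hac

theorem dirD_thirdPoint_right (hF : F.IsHomogeneous 3) (hc : eval c F = 0)
    (hca : dirD F c a ≠ 0) (hγ : γ ≠ 0)
    (hb : b = γ • (dirD F c a • a + (-dirD F a c) • c)) : dirD F c b ≠ 0 := by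
  rw [hb, dirD_smul_right, dirD_add_right, dirD_smul_right, dirD_smul_right, dirD_self hF, hc]
  refine mul_ne_zero hγ ?_
  rw [mul_zero, mul_zero, add_zero]
  exact mul_ne_zero hca hca

/-- The line is transversal at the third point b too: its derivative there is, up to a nonzero
factor, D_aF(c)² D_cF(a). -/
theorem dirD_thirdPoint (hF : F.IsHomogeneous 3) (ha : eval a F = 0)
    (hac : dirD F a c ≠ 0) (hca : dirD F c a ≠ 0) (hγ : γ ≠ 0)
    (hb : b = γ • (dirD F c a • a + (-dirD F a c) • c)) : dirD F b a ≠ 0 := by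
  rw [hb, dirD_smul_left hF, dirD_cubic_add_left hF, ha]
  refine mul_ne_zero (pow_ne_zero _ hγ) ?_
  rw [show 3 * dirD F c a ^ 2 * 0 + 2 * dirD F c a * -dirD F a c * dirD F a c +
    (-dirD F a c) ^ 2 * dirD F c a = -(dirD F a c ^ 2 * dirD F c a) by ring, neg_ne_zero]
  exact mul_ne_zero (pow_ne_zero _ hac) hca

end ThirdPoint

section AlgClosed

variable [IsAlgClosed k]

/-- For three distinct collinear points `a, b, c` of a smooth cubic, a member of the pencil spanned
by the union of the tangent lines at `a` and `c` and the double line `ac` is in general not tangent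
to the cubic outside `a` and `c`. -/
theorem exists_wronskian_ne_zero {F : MvPolynomial (Fin 3) k} (hF : F.IsHomogeneous 3)
    (hp : Prime F) (hs : IsSmoothCurve F) {a b c : Plane k} (ha : OnCurve F a) (hb : OnCurve F b)
    (hc : OnCurve F c) (hac : dirD F a.rep c.rep ≠ 0) (hca : dirD F c.rep a.rep ≠ 0)
    (hlb : eval b.rep (lin (crossProduct a.rep c.rep)) = 0)
    (hl0 : crossProduct a.rep c.rep ≠ 0)
    {γ : k} (hγ : γ ≠ 0)
    (hbr : b.rep = γ • (dirD F c.rep a.rep • a.rep + (-dirD F a.rep c.rep) • c.rep)) :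
    ∃ (u : Fin 3 → k) (g : MvPolynomial (Fin 3) k) (e : ℕ), g.IsHomogeneous e ∧ ¬ F ∣ g ∧
      ∀ q : Plane k, OnCurve F q → eval q.rep g ≠ 0 →
      (dirD F a.rep (crossProduct (grad F q.rep) u) * dirD F c.rep q.rep +
        dirD F a.rep q.rep * dirD F c.rep (crossProduct (grad F q.rep) u)) *
        eval q.rep (lin (crossProduct a.rep c.rep)) - 2 * (dirD F a.rep q.rep * dirD F c.rep q.rep *
          ∑ i, crossProduct a.rep c.rep i * crossProduct (grad F q.rep) u i) ≠ 0 := by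
  set l := crossProduct a.rep c.rep with hl
  have hFa : eval a.rep F = 0 := ha
  have hFc : eval c.rep F = 0 := hc
  by_cases h2 : (2 : k) = 0
  -- In characteristic two l² has zero derivative, so only the tangent lines at a and c matter. Here
  -- x is their intersection point, whose polar is nonzero.
  · set x := crossProduct (grad F a.rep) (grad F c.rep) with hx
    have hx0 : x ≠ 0 := by
      refine crossProduct_ne_zero (a := a.rep) (grad_ne_zero (hs a ha)) ?_ ?_
      · rw [sum_grad_mul, dirD_self hF, hFa, mul_zero]
      · rwa [sum_grad_mul]
    set u : Fin 3 → k := Pi.single 0 1 with hu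
    have hu0 : u ≠ 0 := fun h => by simpa [hu] using congrFun h 0
    refine ⟨u, lin l * lin u * polar F x, 1 + 1 + 2, ((isHomogeneous_lin _).mul
      (isHomogeneous_lin _)).mul (isHomogeneous_polar hF x), ?_, ?_⟩
    · exact hp.not_dvd_mul (hp.not_dvd_mul (not_dvd_lin hF hl0) (not_dvd_lin hF hu0))
        (not_dvd_of_lt hF (isHomogeneous_polar hF x) (by norm_num)
          (polar_ne_zero hF hs hx0 (Or.inr h2)))
    · intro q hq hg
      have hFq : eval q.rep F = 0 := hq
      rw [map_mul, map_mul, eval_polar] at hg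
      -- With m and n the gradients at a and c, the left side is the Wronskian of the two tangent
      -- lines. On the curve Euler's formula kills the first product on the right, leaving u(q)
      -- times the polar of x at q, up to sign.
      have hid : ∀ g u m n q : Fin 3 → k,
          (∑ i, m i * crossProduct g u i) * (∑ i, n i * q i) -
            (∑ i, m i * q i) * (∑ i, n i * crossProduct g u i) =
          (∑ i, g i * q i) * (∑ i, crossProduct m n i * u i) -
            (∑ i, u i * q i) * (∑ i, g i * crossProduct m n i) := by
        intro g u m n q
        simp only [Fin.sum_univ_three, cross_apply]
        simp
        ring
      have h3 := hid (grad F q.rep) u (grad F a.rep) (grad F c.rep) q.rep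
      rw [sum_grad_mul, sum_grad_mul, sum_grad_mul, sum_grad_mul, sum_grad_mul, sum_grad_mul,
        dirD_self hF, hFq, ← eval_lin u, ← hx] at h3
      intro h4
      apply hg
      linear_combination eval q.rep (lin l) * h3 - h4 + (eval q.rep (lin l) * dirD F a.rep q.rep *
        dirD F c.rep (crossProduct (grad F q.rep) u) - dirD F a.rep q.rep * dirD F c.rep q.rep *
          ∑ i, l i * crossProduct (grad F q.rep) u i) * h2
  -- Away from characteristic two the Wronskian is evaluated at b, where l vanishes. What remains is
  -- -2 times the values at b of both tangents times the derivative of l, and transversality at b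
  -- makes that derivative nonzero for some coordinate vector u.
  · have hba := dirD_thirdPoint hF hFa hac hca hγ hbr
    have hab := dirD_thirdPoint_left hF hFa hac hγ hbr
    have hcb := dirD_thirdPoint_right hF hFc hca hγ hbr
    have hlg : crossProduct l (grad F b.rep) ≠ 0 := by
      refine crossProduct_ne_zero (a := a.rep) hl0 ?_ ?_
      · rw [← eval_lin]; exact eval_crossProduct_left _ _
      · rwa [sum_grad_mul]
    obtain ⟨i, hi⟩ := Function.ne_iff.1 hlg
    set u : Fin 3 → k := Pi.single i 1 with hu
    have hlu : ∑ j, l j * crossProduct (grad F b.rep) u j = crossProduct l (grad F b.rep) i := by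
      have h1 : ∑ j, l j * crossProduct (grad F b.rep) u j =
          ∑ j, u j * crossProduct l (grad F b.rep) j := by
        simp only [Fin.sum_univ_three, cross_apply]
        simp
        ring
      rw [h1]
      simp [hu, Pi.single_apply]
    set Φ := (polar F (crossProduct u (grad F a.rep)) * lin (grad F c.rep) +
      lin (grad F a.rep) * polar F (crossProduct u (grad F c.rep))) * lin l -
      C 2 * (lin (grad F a.rep) * lin (grad F c.rep) * polar F (crossProduct u l)) with hΦ
    have hΦe : ∀ q : Fin 3 → k, eval q Φ =
        (dirD F a.rep (crossProduct (grad F q) u) * dirD F c.rep q +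
        dirD F a.rep q * dirD F c.rep (crossProduct (grad F q) u)) *
        eval q (lin l) - 2 * (dirD F a.rep q * dirD F c.rep q *
          ∑ i, l i * crossProduct (grad F q) u i) := by
      intro q
      simp only [hΦ, map_sub, map_mul, map_add, eval_polar, eval_C, dirD_crossProduct,
        eval_lin_grad, sum_grad_mul]
    refine ⟨u, Φ, 4, ?_, ?_, fun q _ hq => by rwa [hΦe] at hq⟩
    · have hL := fun m : Fin 3 → k => isHomogeneous_lin m
      have hP := fun v : Fin 3 → k => isHomogeneous_polar hF v
      refine ((((hP _).mul (hL _)).add ?_).mul (hL _)).sub ((((hL _).mul (hL _)).mul (hP _)).C_mul _)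
      rw [add_comm]
      exact (hL _).mul (hP _)
    · rintro ⟨h, hh⟩
      have hFb : eval b.rep F = 0 := hb
      have h1 := hΦe b.rep
      rw [hh, map_mul, hFb, zero_mul, hlb, hlu, mul_zero, zero_sub, eq_comm, neg_eq_zero] at h1
      revert h1
      exact mul_ne_zero h2 (mul_ne_zero (mul_ne_zero hab hcb) hi)

/-- On every smooth cubic there are `3t` points such that no curve of degree `2t` cuts out exactly
twice these points. -/
theorem exists_points_forall_dvd {F : MvPolynomial (Fin 3) k} (hF : F.IsHomogeneous 3)
    (hp : Prime F) (hs : IsSmoothCurve F) {t : ℕ} (ht : 5 < t) :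
    ∃ X : Finset (Plane k), X.card = 3 * t ∧ (∀ p ∈ X, OnCurve F p) ∧
      ∀ f ∈ tan F X, f.IsHomogeneous (2 * t) → F ∣ f := by
  classical
  obtain ⟨a, ha, -⟩ := exists_point_notMem hF (by norm_num) ∅
  obtain ⟨b, c, hb, hc, hab, hac, hbc, hlb, -, Dac, Dca, γ, hγ, hbr⟩ :=
    exists_transversal_line hF hp (hs a ha) (polar_ne_zero hF hs a.rep_nonzero (Or.inl ha))
      ∅ (by simp)
  have hl0 := crossProduct_rep_ne_zero hac
  obtain ⟨u, g, e, hg, hFg, hW⟩ :=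
    exists_wronskian_ne_zero hF hp hs ha hb hc Dac Dca hlb hl0 hγ hbr
  have hFa : eval a.rep F = 0 := ha
  have hFc : eval c.rep F = 0 := hc
  have Dab := dirD_thirdPoint_left hF hFa Dac hγ hbr
  have Dcb := dirD_thirdPoint_right hF hFc Dca hγ hbr
  set l := lin (crossProduct a.rep c.rep) with hl
  have hla : eval a.rep l = 0 := eval_crossProduct_left _ _
  have hlc : eval c.rep l = 0 := eval_crossProduct_right _ _
  obtain ⟨S, M, hScard, hSF, hSB, hM, hFM, hMS, -⟩ := exists_lines hF hp hs {a, c} (t - 1)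
  set Y := insert a (insert c S) with hY
  have haS : a ∉ insert c S := by
    rw [Finset.mem_insert, not_or]
    exact ⟨hac, fun h => hSB a h (by simp)⟩
  have hcS : c ∉ S := fun h => hSB c h (by simp)
  have hYcard : Y.card = 3 * t - 1 := by
    rw [hY, Finset.card_insert_of_notMem haS, Finset.card_insert_of_notMem hcS, hScard]
    omega
  have hYF : ∀ p ∈ Y, OnCurve F p := by
    simp only [hY, Finset.forall_mem_insert]
    exact ⟨ha, hc, hSF⟩
  have hFl : ¬ F ∣ l := not_dvd_lin hF hl0
  obtain ⟨q, hq, hqY, hgq⟩ := exists_point_ne_zero hF hp (g := M * l * g)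
    ((hM.mul (isHomogeneous_lin _)).mul hg) (hp.not_dvd_mul (hp.not_dvd_mul hFM hFl) hFg) Y
  rw [map_mul, map_mul] at hgq
  have hMq := left_ne_zero_of_mul (left_ne_zero_of_mul hgq)
  have hlq := right_ne_zero_of_mul (left_ne_zero_of_mul hgq)
  have hWq := hW q hq (right_ne_zero_of_mul hgq)
  refine ⟨insert q Y, ?_, ?_, fun f hfI hf => ?_⟩
  · rw [Finset.card_insert_of_notMem hqY, hYcard]
    omega
  · simp only [Finset.forall_mem_insert]
    exact ⟨hq, hYF⟩
  set A := lin (grad F a.rep) * lin (grad F c.rep) with hA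
  have hAhom : A.IsHomogeneous 2 := (isHomogeneous_lin _).mul (isHomogeneous_lin _)
  have hlhom : (l ^ 2).IsHomogeneous 2 := (isHomogeneous_lin _).pow 2
  have hMhom : (M ^ 2).IsHomogeneous (2 * t - 2) := by
    have := hM.pow 2
    rwa [show (t - 1) * 2 = 2 * t - 2 by omega] at this
  have hS := isCurveScheme_tan hF (X := Y) fun p hp => hs p (hYF p hp)
  -- The divisor 2Y has degree 6t - 2, so its forms of degree 2t are two-dimensional modulo F. The
  -- basis is M² times the two tangents, and M² times the double line.
  have hhilb : hilb (tan F Y) (2 * t) + 2 = 3 * (2 * t) := by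
    rw [hS.hilb_of_gt hF hp (by omega) (by omega)]
    omega
  have hG : ∀ i : Fin 2, (M ^ 2 * ![A, l ^ 2] i).IsHomogeneous (2 * t) := by
    have key : ∀ P : MvPolynomial (Fin 3) k, P.IsHomogeneous 2 →
        (M ^ 2 * P).IsHomogeneous (2 * t) := fun P hP => by
      have := hMhom.mul hP
      rwa [show 2 * t - 2 + 2 = 2 * t by omega] at this
    intro i
    fin_cases i
    · exact key A hAhom
    · exact key _ hlhom
  have hGI : ∀ i : Fin 2, M ^ 2 * ![A, l ^ 2] i ∈ tan F Y := by
    have hsing : ∀ (P : MvPolynomial (Fin 3) k) (p : Plane k), eval p.rep P = 0 →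
        ∀ i, eval p.rep (pderiv i (P ^ 2)) = 0 := fun P p h i => by
      rw [pow_two, pderiv_mul, map_add, map_mul, map_mul, h, mul_zero, zero_mul, add_zero]
    intro i p hpY
    rw [hY, Finset.mem_insert, Finset.mem_insert] at hpY
    by_cases hpS : eval p.rep M = 0
    · refine ⟨by rw [map_mul, map_pow, hpS]; ring, 0, fun j => ?_⟩
      rw [pderiv_mul, map_add, map_mul, map_mul, hsing M p hpS, map_pow, hpS]
      ring
    have hpac : p = a ∨ p = c := by
      rcases hpY with h | h | h
      · exact Or.inl h
      · exact Or.inr h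
      · exact absurd (hMS p h) hpS
    have hlp : eval p.rep l = 0 := by rcases hpac with rfl | rfl <;> assumption
    fin_cases i
    · change eval p.rep (M ^ 2 * A) = 0 ∧ ∃ c, ∀ j, eval p.rep (pderiv j (M ^ 2 * A)) =
        c * eval p.rep (pderiv j F)
      rcases hpac with rfl | rfl
      · have h0 : eval p.rep (lin (grad F p.rep)) = 0 := by
          rw [eval_lin_grad, dirD_self hF, hFa, mul_zero]
        refine ⟨by simp only [hA, map_mul, h0]; ring,
          eval p.rep M ^ 2 * eval p.rep (lin (grad F c.rep)), fun j => ?_⟩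
        simp only [hA, pderiv_mul, map_mul, map_add, h0, pderiv_lin, eval_C, map_pow, grad]
        ring
      · have h0 : eval p.rep (lin (grad F p.rep)) = 0 := by
          rw [eval_lin_grad, dirD_self hF, hFc, mul_zero]
        refine ⟨by simp only [hA, map_mul, h0]; ring,
          eval p.rep M ^ 2 * eval p.rep (lin (grad F a.rep)), fun j => ?_⟩
        simp only [hA, pderiv_mul, map_mul, map_add, h0, pderiv_lin, eval_C, map_pow, grad]
        ring
    · change eval p.rep (M ^ 2 * l ^ 2) = 0 ∧ ∃ c, ∀ j, eval p.rep (pderiv j (M ^ 2 * l ^ 2)) =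
        c * eval p.rep (pderiv j F)
      refine ⟨by rw [map_mul, map_pow _ l, hlp]; ring, 0, fun j => ?_⟩
      rw [pderiv_mul, map_add, map_mul, map_mul, hsing l p hlp, map_pow _ l, hlp]
      ring
  have hsum : ∀ d : Fin 2 → k, ∑ i, C (d i) * (M ^ 2 * ![A, l ^ 2] i) =
      M ^ 2 * (C (d 0) * A + C (d 1) * l ^ 2) := fun d => by
    rw [Fin.sum_univ_two]
    simp only [Matrix.cons_val_zero, Matrix.cons_val_one]
    ring
  have hind : ∀ d : Fin 2 → k, F ∣ ∑ i, C (d i) * (M ^ 2 * ![A, l ^ 2] i) → ∀ i, d i = 0 := by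
    intro d hd
    rw [hsum] at hd
    have h1 := (hp.dvd_or_dvd hd).resolve_left fun h => hFM (hp.dvd_of_dvd_pow h)
    have h2 := eq_zero_of_isHomogeneous_of_dvd hF
      ((hAhom.C_mul (d 0)).add (hlhom.C_mul (d 1))) (by norm_num) h1
    -- The third point b separates the two generators: l vanishes there and the tangents at a and c
    -- do not.
    have h3 := congrArg (eval b.rep) h2
    simp only [hA, map_add, map_mul, map_pow, eval_C, hlb, eval_lin_grad, map_zero] at h3
    have h4 : d 0 = 0 := by
      have h5 : d 0 * (dirD F a.rep b.rep * dirD F c.rep b.rep) = 0 := by linear_combination h3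
      exact (mul_eq_zero.1 h5).resolve_right (mul_ne_zero Dab Dcb)
    rw [h4, C_0, zero_mul, zero_add, mul_eq_zero, C_eq_zero] at h2
    have h6 := h2.resolve_right (pow_ne_zero _ (lin_ne_zero hl0))
    intro i
    fin_cases i
    · exact h4
    · exact h6
  have hfY : f ∈ tan F Y := fun p hp => hfI p (Finset.mem_insert_of_mem hp)
  obtain ⟨d, hd⟩ := exists_dvd_sub_sum hF hp hS.mem (by omega) hhilb _ hG hGI hind hf hfY
  rw [hsum] at hd
  obtain ⟨h, hh⟩ := hd
  set Γ := C (d 0) * A + C (d 1) * l ^ 2 with hΓ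
  have hfe : f = M ^ 2 * Γ + F * h := by rw [← hh]; ring
  obtain ⟨hf0, κ, hκ⟩ := hfI q (Finset.mem_insert_self _ _)
  have hFq : eval q.rep F = 0 := hq
  set τ := crossProduct (grad F q.rep) u with hτ
  have hFτ : dirD F q.rep τ = 0 := dirD_grad_crossProduct F q.rep u
  have hfτ : dirD f q.rep τ = 0 := by
    have : dirD f q.rep τ = κ * dirD F q.rep τ := by
      simp only [dirD, hκ, Finset.mul_sum]
      exact Finset.sum_congr rfl fun i _ => by ring
    rw [this, hFτ, mul_zero]
  have hΓ0 : eval q.rep Γ = 0 := by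
    rw [hfe, map_add, map_mul, map_mul, hFq, zero_mul, add_zero, map_pow, mul_eq_zero] at hf0
    exact hf0.resolve_left (pow_ne_zero _ hMq)
  have hΓ1 : dirD Γ q.rep τ = 0 := by
    rw [hfe, dirD_add, dirD_mul, dirD_mul, hFτ, hFq, hΓ0, map_pow] at hfτ
    simp only [mul_zero, zero_mul, zero_add, add_zero, mul_eq_zero] at hfτ
    exact hfτ.resolve_left (pow_ne_zero _ hMq)
  -- Both Γ and its tangential derivative vanish at q. Eliminating d 1 leaves d 0 times l(q) times
  -- the Wronskian at q.
  have hd0 : d 0 = 0 := by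
    simp only [hΓ, hA, pow_two, map_add, map_mul, eval_C, eval_lin_grad, dirD_add, dirD_mul, dirD_C,
      dirD_lin, sum_grad_mul, zero_mul, zero_add, hl] at hΓ0 hΓ1
    rw [← hl] at hΓ0 hΓ1
    have h1 := mul_ne_zero hlq hWq
    refine (mul_eq_zero.1 (?_ : d 0 * _ = 0)).resolve_right h1
    linear_combination (eval q.rep l) ^ 2 * hΓ1 - 2 * eval q.rep l *
      (∑ i, crossProduct a.rep c.rep i * τ i) * hΓ0
  have hd1 : d 1 = 0 := by
    rw [hΓ, hd0, C_0, zero_mul, zero_add, map_mul, eval_C, map_pow, mul_eq_zero] at hΓ0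
    exact hΓ0.resolve_right (pow_ne_zero _ hlq)
  rw [hfe, hΓ, hd0, hd1]
  simp

end AlgClosed

/-! ### Smooth cubics are irreducible -/

theorem homogeneousComponent_totalDegree_mul (G H : MvPolynomial (Fin 3) k) :
    homogeneousComponent (G.totalDegree + H.totalDegree) (G * H) =
      homogeneousComponent G.totalDegree G * homogeneousComponent H.totalDegree H := by
  have hsum : G * H = ∑ i ∈ Finset.range (G.totalDegree + 1), homogeneousComponent i G * H := by
    rw [← Finset.sum_mul, sum_homogeneousComponent]
  rw [hsum, map_sum, Finset.sum_eq_single G.totalDegree]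
  · rw [add_comm, homogeneousComponent_mul (homogeneousComponent_isHomogeneous _ _)]
  · intro i hi hne
    have hi' : i < G.totalDegree := by
      have := Finset.mem_range.1 hi
      omega
    rw [show G.totalDegree + H.totalDegree = (G.totalDegree - i + H.totalDegree) + i by omega,
      homogeneousComponent_mul (homogeneousComponent_isHomogeneous _ _),
      homogeneousComponent_eq_zero _ H (by omega), mul_zero]
  · intro h
    simp at h

section AlgClosed

variable [IsAlgClosed k]

/-- A product of two forms, one of them linear, is singular somewhere. -/
theorem exists_singular_of_lin_mul {a : Fin 3 → k} {h : MvPolynomial (Fin 3) k} {d : ℕ}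
    (hh : h.IsHomogeneous d) (hd : 0 < d) :
    ∃ v : Fin 3 → k, v ≠ 0 ∧ eval v (lin a * h) = 0 ∧ ∀ i, eval v (pderiv i (lin a * h)) = 0 := by
  obtain ⟨v, hv, hva, hvh⟩ := exists_zero_on_lin hh hd a
  refine ⟨v, hv, by rw [map_mul, hva, zero_mul], fun i => ?_⟩
  rw [pderiv_mul, map_add, map_mul, map_mul, hva, hvh, mul_zero, zero_mul, add_zero]

/-- A proper factorization of F may be replaced by one into top-degree forms, hence into a line and
a conic. These meet, and any common point is singular on the curve. -/
theorem irreducible_of_smooth {F : MvPolynomial (Fin 3) k} (hF : F.IsHomogeneous 3) (hF0 : F ≠ 0)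
    (hs : IsSmoothCurve F) : Irreducible F := by
  constructor
  · intro hu
    exact one_ne_zero (eq_zero_of_isHomogeneous_of_dvd hF (isHomogeneous_one (Fin 3) k)
      (by norm_num) hu.dvd)
  · intro G H hGH
    have hG0 : G ≠ 0 := fun h => hF0 (by rw [hGH, h, zero_mul])
    have hH0 : H ≠ 0 := fun h => hF0 (by rw [hGH, h, mul_zero])
    have hunit : ∀ P : MvPolynomial (Fin 3) k, P ≠ 0 → P.totalDegree = 0 → IsUnit P := by
      intro P hP h
      rw [totalDegree_eq_zero_iff_eq_C.1 h] at hP ⊢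
      exact (isUnit_iff_ne_zero.2 fun h0 => hP (by rw [h0, C_0])).map C
    have hdeg : G.totalDegree + H.totalDegree = 3 := by
      rw [← totalDegree_mul_of_isDomain hG0 hH0, ← hGH, hF.totalDegree hF0]
    have hprod := homogeneousComponent_totalDegree_mul G H
    rw [← hGH, hdeg, homogeneousComponent_eq_self hF] at hprod
    have hg := homogeneousComponent_isHomogeneous G.totalDegree G
    have hh := homogeneousComponent_isHomogeneous H.totalDegree H
    have key : ∀ P Q : MvPolynomial (Fin 3) k, P.IsHomogeneous 1 → Q.IsHomogeneous 2 →
        F ≠ P * Q := by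
      intro P Q hP hQ hPQ
      obtain ⟨a, rfl⟩ := exists_eq_lin hP
      obtain ⟨v, hv, h0, h1⟩ := exists_singular_of_lin_mul (a := a) hQ (by norm_num)
      rw [← hPQ] at h0 h1
      obtain ⟨i, hi⟩ := exists_pderiv_ne_zero hF hs hv h0
      exact hi (h1 i)
    by_contra hcon
    rw [not_or] at hcon
    have hG1 : G.totalDegree ≠ 0 := fun h => hcon.1 (hunit G hG0 h)
    have hH1 : H.totalDegree ≠ 0 := fun h => hcon.2 (hunit H hH0 h)
    rcases (by omega : G.totalDegree = 1 ∨ H.totalDegree = 1) with h | h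
    · have h' : H.totalDegree = 2 := by omega
      rw [h] at hg
      rw [h'] at hh
      rw [h, h'] at hprod
      exact key _ _ hg hh hprod
    · have h' : G.totalDegree = 2 := by omega
      rw [h'] at hg
      rw [h] at hh
      rw [h, h', mul_comm] at hprod
      exact key _ _ hh hg hprod

end AlgClosed

/-! ### A cubic with a point of order two -/

/-- The cubic `y² z + x y z = x³ + b x z²`; it has a flex at `(0 : 1 : 0)`, and the tangent line
`x = 0` at `(0 : 0 : 1)` passes through the flex. -/
def cubic (b : k) : MvPolynomial (Fin 3) k :=
  X 1 ^ 2 * X 2 + X 0 * X 1 * X 2 - X 0 ^ 3 - C b * (X 0 * X 2 ^ 2)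

theorem isHomogeneous_cubic (b : k) : (cubic b).IsHomogeneous 3 := by
  have hX := fun i : Fin 3 => isHomogeneous_X k i
  exact ((((hX 1).pow 2).mul (hX 2)).add (((hX 0).mul (hX 1)).mul (hX 2))).sub
    ((hX 0).pow 3) |>.sub (((hX 0).mul ((hX 2).pow 2)).C_mul b)

theorem eval_cubic (b : k) (v : Fin 3 → k) :
    eval v (cubic b) = v 1 ^ 2 * v 2 + v 0 * v 1 * v 2 - v 0 ^ 3 - b * (v 0 * v 2 ^ 2) := by
  simp [cubic]

theorem eval_pderiv_zero_cubic (b : k) (v : Fin 3 → k) :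
    eval v (pderiv 0 (cubic b)) = v 1 * v 2 - 3 * v 0 ^ 2 - b * v 2 ^ 2 := by
  simp [cubic, pderiv_X]
  ring

theorem eval_pderiv_one_cubic (b : k) (v : Fin 3 → k) :
    eval v (pderiv 1 (cubic b)) = 2 * v 1 * v 2 + v 0 * v 2 := by
  simp [cubic, pderiv_X]
  ring

theorem eval_pderiv_two_cubic (b : k) (v : Fin 3 → k) :
    eval v (pderiv 2 (cubic b)) = v 1 ^ 2 + v 0 * v 1 - 2 * b * v 0 * v 2 := by
  simp [cubic, pderiv_X]
  ring

/-- The square of a line through the flex, times the line `x = 0`, cuts the cubic in the flex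
tangent and a residual conic. -/
theorem exists_residual_conic (b m c : k) : ∃ R : MvPolynomial (Fin 3) k, R.IsHomogeneous 2 ∧
    X 2 * R = (C m * X 0 + C c * X 2) ^ 2 * X 0 + cubic b * C (m ^ 2) := by
  have h1 : (X 1 ^ 2 : MvPolynomial (Fin 3) k).IsHomogeneous 2 := isHomogeneous_X_pow 1 2
  have h0 : (X 0 ^ 2 : MvPolynomial (Fin 3) k).IsHomogeneous 2 := isHomogeneous_X_pow 0 2
  have h01 : (X 0 * X 1 : MvPolynomial (Fin 3) k).IsHomogeneous 2 :=
    (isHomogeneous_X k 0).mul (isHomogeneous_X k 1)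
  have h02 : (X 0 * X 2 : MvPolynomial (Fin 3) k).IsHomogeneous 2 :=
    (isHomogeneous_X k 0).mul (isHomogeneous_X k 2)
  refine ⟨C (m ^ 2) * (X 1 ^ 2 + X 0 * X 1 - C b * (X 0 * X 2)) + C (2 * m * c) * X 0 ^ 2 +
    C (c ^ 2) * (X 0 * X 2), ?_, ?_⟩
  · exact ((((h1.add h01).sub (h02.C_mul b)).C_mul _).add (h0.C_mul _)).add (h02.C_mul _)
  · rw [cubic]
    simp only [C_mul, C_pow, map_ofNat]
    ring

theorem cubic_ne_zero (b : k) : cubic b ≠ 0 := by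
  intro h
  have h1 := eval_cubic b ![0, 1, 1]
  rw [h] at h1
  simp at h1

/-- The conditions on b say that the discriminant b²(1 - 64b) is nonzero, which works in every
characteristic. -/
theorem eq_zero_of_cubic_singular {b : k} (hb : b ≠ 0) (hb' : 64 * b ≠ 1) {v : Fin 3 → k}
    (h : eval v (cubic b) = 0) (h0 : eval v (pderiv 0 (cubic b)) = 0)
    (h1 : eval v (pderiv 1 (cubic b)) = 0) (h2 : eval v (pderiv 2 (cubic b)) = 0) : v = 0 := by
  rw [eval_cubic] at h
  rw [eval_pderiv_zero_cubic] at h0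
  rw [eval_pderiv_one_cubic] at h1
  rw [eval_pderiv_two_cubic] at h2
  have hz : v 2 = 0 := by
    by_contra hz
    have hx : v 0 = -2 * v 1 := by
      have : v 2 * (2 * v 1 + v 0) = 0 := by linear_combination h1
      linear_combination (mul_eq_zero.1 this).resolve_left hz
    rw [hx] at h h0 h2
    have hy : v 1 * (4 * b * v 2 - v 1) = 0 := by linear_combination h2
    rcases mul_eq_zero.1 hy with hy | hy
    · rw [hy] at h0
      have : b * v 2 ^ 2 = 0 := by linear_combination -h0
      exact mul_ne_zero hb (pow_ne_zero _ hz) this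
    · have hy' : v 1 = 4 * b * v 2 := by linear_combination -hy
      rw [hy'] at h h0
      have hb2 : 64 * b - 1 ≠ 0 := sub_ne_zero.2 hb'
      -- The remaining equations force both 3 = 0 and 8 = 0, impossible because 9 - 8 = 1.
      have e1 : (3 : k) = 0 := by
        have : (3 : k) * (b * v 2 ^ 2 * (64 * b - 1)) = 0 := by linear_combination -h0
        exact (mul_eq_zero.1 this).resolve_right (mul_ne_zero (mul_ne_zero hb (pow_ne_zero _ hz)) hb2)
      have e2 : (8 : k) = 0 := by
        have : (8 : k) * (b ^ 2 * v 2 ^ 3 * (64 * b - 1)) = 0 := by linear_combination h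
        exact (mul_eq_zero.1 this).resolve_right
          (mul_ne_zero (mul_ne_zero (pow_ne_zero _ hb) (pow_ne_zero _ hz)) hb2)
      have : (1 : k) = 0 := by linear_combination 3 * e1 - e2
      exact one_ne_zero this
  rw [hz] at h h2
  have hx : v 0 = 0 := by
    have : v 0 ^ 3 = 0 := by linear_combination -h
    exact pow_eq_zero_iff (by norm_num) |>.1 this
  rw [hx] at h2
  have hy : v 1 = 0 := by
    have : v 1 ^ 2 = 0 := by linear_combination h2
    exact pow_eq_zero_iff (by norm_num) |>.1 this
  funext i
  fin_cases i <;> assumption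

theorem isSmoothCurve_cubic {b : k} (hb : b ≠ 0) (hb' : 64 * b ≠ 1) : IsSmoothCurve (cubic b) := by
  intro p hp
  refine ⟨hp, ?_⟩
  by_contra hcon
  push Not at hcon
  exact p.rep_nonzero (eq_zero_of_cubic_singular hb hb' hp (hcon 0) (hcon 1) (hcon 2))

section AlgClosed

variable [IsAlgClosed k]

variable (k) in
theorem exists_smooth_parameter : ∃ b : k, b ≠ 0 ∧ 64 * b ≠ 1 := by
  classical
  -- In characteristic two the inverse of 64 is 0 by convention, and the second exclusion is
  -- vacuous.
  obtain ⟨b, hb⟩ := Infinite.exists_notMem_finset ({0, (64 : k)⁻¹} : Finset k)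
  rw [Finset.mem_insert, Finset.mem_singleton, not_or] at hb
  exact ⟨b, hb.1, fun h => hb.2 (eq_inv_of_mul_eq_one_right h)⟩

/-- There are `3t` points of the smooth cubic `cubic b` that are not cut out by a curve of degree
`t`, although twice these points are cut out by a curve of degree `2t`. -/
theorem exists_points_cubic {b : k} (hb : b ≠ 0) (hb' : 64 * b ≠ 1) {t : ℕ} (ht : 5 < t) :
    ∃ X : Finset (Plane k), X.card = 3 * t ∧ (∀ p ∈ X, OnCurve (cubic b) p) ∧
      (∀ f ∈ van X, f.IsHomogeneous t → cubic b ∣ f) ∧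
      ∃ f ∈ tan (cubic b) X, f.IsHomogeneous (2 * t) ∧ ¬ cubic b ∣ f := by
  classical
  have hF := isHomogeneous_cubic b
  have hs := isSmoothCurve_cubic hb hb'
  have hp : Prime (cubic b) := (irreducible_of_smooth hF (cubic_ne_zero b) hs).prime
  -- In the group law with the flex O as origin, E has order two. X will consist of E, of P and Q
  -- collinear with O, and of t - 1 line sections, so that X sums to E and 2X to O.
  set F := cubic b with hFdef
  have hvO : (![0, 1, 0] : Fin 3 → k) ≠ 0 := fun h => by simpa using congrFun h 1
  have hvE : (![0, 0, 1] : Fin 3 → k) ≠ 0 := fun h => by simpa using congrFun h 2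
  set O : Plane k := Projectivization.mk k _ hvO with hO
  set E : Plane k := Projectivization.mk k _ hvE with hE
  obtain ⟨o, ho, hOr⟩ := exists_rep_mk_eq_smul _ hvO
  obtain ⟨ε, hε, hEr⟩ := exists_rep_mk_eq_smul _ hvE
  rw [← hO] at hOr
  rw [← hE] at hEr
  have hO0 : O.rep 0 = 0 := by rw [hOr]; simp
  have hO1 : O.rep 1 = o := by rw [hOr]; simp
  have hO2 : O.rep 2 = 0 := by rw [hOr]; simp
  have hE0 : E.rep 0 = 0 := by rw [hEr]; simp
  have hE1 : E.rep 1 = 0 := by rw [hEr]; simp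
  have hE2 : E.rep 2 = ε := by rw [hEr]; simp
  have hOF : OnCurve F O := by
    rw [OnCurve, hFdef, eval_cubic, hO0, hO2]; ring
  have hEF : OnCurve F E := by
    rw [OnCurve, hFdef, eval_cubic, hE0, hE1]; ring
  have hOE : O ≠ E := fun h => ho (by rw [← hO1, h, hE1])
  have hflex : ∀ p : Plane k, OnCurve F p → p.rep 2 = 0 → p = O := by
    intro p hpF hp2
    rw [OnCurve, hFdef, eval_cubic, hp2] at hpF
    have hp0 : p.rep 0 = 0 := by
      have : p.rep 0 ^ 3 = 0 := by linear_combination -hpF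
      exact pow_eq_zero_iff (by norm_num) |>.1 this
    refine eq_of_rep_eq_smul (c := p.rep 1 / o) (funext fun i => ?_)
    fin_cases i
    · simp [hp0, hO0]
    · simp [hO1, ho]
    · simp [hp2, hO2]
  obtain ⟨P, Q, hPF, hQF, hOP, hOQ, hPQ, hlP, hlB, -, -, -⟩ :=
    exists_transversal_line hF hp (hs O hOF)
      (polar_ne_zero hF hs O.rep_nonzero (Or.inl hOF)) {E} (by simpa using hOE)
  set n := crossProduct O.rep Q.rep with hn
  have hn0 : n ≠ 0 := crossProduct_rep_ne_zero hOQ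
  have hlQ : eval Q.rep (lin n) = 0 := eval_crossProduct_right _ _
  have hlE : eval E.rep (lin n) ≠ 0 := hlB E (by simp)
  have hn1 : n 1 = 0 := by
    rw [hn, cross_apply, hO0, hO2]
    simp
  have hlin : lin n = C (n 0) * X 0 + C (n 2) * X 2 := by
    rw [lin, Fin.sum_univ_three, hn1, C_0]
    ring
  obtain ⟨S, M, hScard, hSF, hSB, hM, hFM, hMS, hMB⟩ := exists_lines hF hp hs {O, E, P, Q} (t - 1)
  have hME : eval E.rep M ≠ 0 := hMB E (by simp)
  have hQS : Q ∉ S := fun h => hSB Q h (by simp)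
  have hPS : P ∉ insert Q S := by
    rw [Finset.mem_insert, not_or]
    exact ⟨hPQ, fun h => hSB P h (by simp)⟩
  set Y := insert P (insert Q S) with hY
  have hEY : E ∉ Y := by
    rw [hY, Finset.mem_insert, Finset.mem_insert, not_or, not_or]
    exact ⟨fun h => hlE (by rw [h, hlP]), fun h => hlE (by rw [h, hlQ]),
      fun h => hSB E h (by simp)⟩
  have hYcard : Y.card = 3 * t - 1 := by
    rw [hY, Finset.card_insert_of_notMem hPS, Finset.card_insert_of_notMem hQS, hScard]
    omega
  have hYF : ∀ p ∈ Y, OnCurve F p := by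
    simp only [hY, Finset.forall_mem_insert]
    exact ⟨hPF, hQF, hSF⟩
  have hYzero : ∀ p ∈ Y, eval p.rep (lin n * M) = 0 := by
    simp only [hY, Finset.forall_mem_insert, map_mul]
    exact ⟨by rw [hlP, zero_mul], by rw [hlQ, zero_mul], fun p hpS => by rw [hMS p hpS, mul_zero]⟩
  have hXF : ∀ p ∈ insert E Y, OnCurve F p := by
    simp only [Finset.forall_mem_insert]
    exact ⟨hEF, hYF⟩
  have hYO : ∀ p ∈ insert E Y, p ≠ O := by
    simp only [hY, Finset.forall_mem_insert]
    exact ⟨hOE.symm, hOP.symm, hOQ.symm, fun p hpS h => hSB p hpS (by simp [h])⟩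
  have hFn : ¬ F ∣ lin n := not_dvd_lin hF hn0
  refine ⟨insert E Y, ?_, hXF, fun f hfI hf => ?_, ?_⟩
  · rw [Finset.card_insert_of_notMem hEY, hYcard]
    omega
  -- Modulo F the only form of degree t through Y, up to scalars, is the line times M, and it does
  -- not vanish at E.
  · have hS := isCurveScheme_van hYF
    have hhilb : hilb (van Y) t + 1 = 3 * t := by
      rw [hS.hilb_of_gt hF hp (by omega) (by omega)]
      omega
    have hNM : (lin n * M).IsHomogeneous t := by
      have := (isHomogeneous_lin n).mul hM
      rwa [show 1 + (t - 1) = t by omega] at this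
    obtain ⟨c, hc⟩ := exists_dvd_sub_sum hF hp hS.mem (by omega) hhilb (fun _ => lin n * M)
      (fun _ => hNM) (fun _ => hYzero) (fun c hc i => by
        rw [Fin.sum_univ_one] at hc
        by_contra hne
        rw [Subsingleton.elim i 0] at hne
        refine hp.not_dvd_mul ?_ (hp.not_dvd_mul hFn hFM) hc
        exact not_dvd_of_lt hF (isHomogeneous_C _ _) (by norm_num) (C_ne_zero.2 hne)) hf
      (fun p hpY => hfI p (Finset.mem_insert_of_mem hpY))
    rw [Fin.sum_univ_one] at hc
    obtain ⟨h, hh⟩ := hc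
    have hfE : eval E.rep f = 0 := hfI E (Finset.mem_insert_self _ _)
    have hFE : eval E.rep F = 0 := hEF
    have h1 := congrArg (eval E.rep) hh
    rw [map_sub, map_mul, map_mul, map_mul, hfE, hFE, eval_C, zero_mul, zero_sub, neg_eq_zero,
      mul_eq_zero] at h1
    have h2 := h1.resolve_right (mul_ne_zero hlE hME)
    rw [h2, C_0, zero_mul, sub_zero] at hh
    exact ⟨h, hh⟩
  · obtain ⟨R, hRhom, hR⟩ := exists_residual_conic b (n 0) (n 2)
    rw [← hlin, ← hFdef] at hR
    -- Modulo F, the flex tangent times R M² is the square of the form through Y times the tangent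
    -- line at E, so it passes through the divisor 2X. The flex tangent meets the curve only at O,
    -- which is not in X, and may be cancelled by saturation.
    have hid : X 2 * (R * M ^ 2) = (lin n * M) ^ 2 * X 0 + F * (C (n 0 ^ 2) * M ^ 2) := by
      linear_combination M ^ 2 * hR
    have hS := isCurveScheme_tan hF fun p hpX => hs p (hXF p hpX)
    refine ⟨R * M ^ 2, hS.sat (X 2) (isHomogeneous_X k 2) (fun p hpX h => hYO p hpX
      (hflex p (hXF p hpX) (by simpa using h))) _ ?_, ?_, ?_⟩
    · rw [hid]
      refine Ideal.add_mem _ (fun p hpX => ?_) (Ideal.mul_mem_right _ _ hS.mem)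
      rw [Finset.mem_insert] at hpX
      rcases hpX with rfl | hpY
      · have hg0 : eval E.rep (pderiv 0 F) = -b * ε ^ 2 := by
          rw [hFdef, eval_pderiv_zero_cubic, hE0, hE1, hE2]; ring
        have hg1 : eval E.rep (pderiv 1 F) = 0 := by
          rw [hFdef, eval_pderiv_one_cubic, hE0, hE1]; ring
        have hg2 : eval E.rep (pderiv 2 F) = 0 := by
          rw [hFdef, eval_pderiv_two_cubic, hE0, hE1]; ring
        refine ⟨by rw [map_mul, eval_X, hE0, mul_zero],
          eval E.rep (lin n * M) ^ 2 / (-b * ε ^ 2), fun i => ?_⟩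
        have hne : -b * ε ^ 2 ≠ 0 := mul_ne_zero (neg_ne_zero.2 hb) (pow_ne_zero _ hε)
        rw [pderiv_mul, map_add, map_mul, map_mul, eval_X, hE0, mul_zero, zero_add, map_pow]
        fin_cases i
        · simp only [Fin.zero_eta, hg0, pderiv_X_self, map_one]
          field_simp
        · simp [hg1, pderiv_X]
        · simp [hg2, pderiv_X]
      · have h0 := hYzero p hpY
        generalize lin n * M = Z at h0
        refine ⟨by rw [map_mul, map_pow, h0]; ring, 0, fun i => ?_⟩
        simp only [pow_two, pderiv_mul, map_add, map_mul, h0]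
        ring
    · have := hRhom.mul (hM.pow 2)
      rwa [show 2 + (t - 1) * 2 = 2 * t by omega] at this
    · intro hdvd
      have h1 : F ∣ (lin n * M) ^ 2 * X 0 := by
        rw [← dvd_add_left (c := F * (C (n 0 ^ 2) * M ^ 2)) (Dvd.intro _ rfl), ← hid]
        exact hdvd.mul_left _
      rcases hp.dvd_or_dvd h1 with h2 | h2
      · exact hp.not_dvd_mul hFn hFM (hp.dvd_of_dvd_pow h2)
      · exact not_dvd_of_lt hF (isHomogeneous_X k 0) (by norm_num) (X_ne_zero 0) h2

end AlgClosed

/-! ### Open conditions and general points -/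

/-- A single nonvanishing minor bounds the Hilbert function from below. Only the inclusion of I in
the kernel of the functionals is needed. -/
theorem card_le_hilb {ι : Type*} [Fintype ι] [DecidableEq ι] {I : Ideal (MvPolynomial (Fin 3) k)}
    {d : ℕ} (r : ι → MvPolynomial (Fin 3) k →ₗ[k] k)
    (hI : ∀ f ∈ I, f.IsHomogeneous d → ∀ i, r i f = 0)
    (g : ι → MvPolynomial (Fin 3) k) (hg : ∀ i, (g i).IsHomogeneous d)
    (hdet : (Matrix.of fun i j => r i (g j)).det ≠ 0) : Fintype.card ι ≤ hilb I d := by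
  set φ : Hm k d →ₗ[k] (ι → k) := LinearMap.pi fun i => r i ∘ₗ (Hm k d).subtype with hφ
  have hker : gr I d ≤ LinearMap.ker φ := fun f hf => by
    rw [LinearMap.mem_ker]
    funext i
    exact hI f (by simpa using hf) f.2 i
  have hsurj : Function.Surjective ((gr I d).liftQ φ hker) := by
    intro y
    set A : Matrix ι ι k := Matrix.of fun i j => r i (g j) with hA
    set c := A⁻¹.mulVec y with hc
    refine ⟨(gr I d).mkQ (∑ j, c j • ⟨g j, hg j⟩), ?_⟩
    have hAc : A.mulVec c = y := by
      rw [hc, Matrix.mulVec_mulVec, Matrix.mul_nonsing_inv _ (isUnit_iff_ne_zero.2 hdet),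
        Matrix.one_mulVec]
    rw [Submodule.mkQ_apply, Submodule.liftQ_apply, ← hAc, map_sum]
    funext i
    rw [Finset.sum_apply]
    simp [hφ, hA, Matrix.mulVec, dotProduct, mul_comm]
  have h := LinearMap.finrank_le_finrank_of_surjective hsurj
  rwa [Module.finrank_fintype_fun_eq_card] at h

section Multihomogeneous

variable {n : ℕ}

theorem isMultihomogeneous_det {ι : Type*} [Fintype ι] [DecidableEq ι]
    (A : Matrix ι ι (MvPolynomial (Fin n × Fin 3) k)) (e : ι → Fin n → ℕ)
    (hA : ∀ a b i, (A a b).IsWeightedHomogeneous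
      (fun v : Fin n × Fin 3 => if v.1 = i then 1 else 0) (e a i)) :
    IsMultihomogeneous A.det := by
  refine ⟨fun i => ∑ a, e a i, fun i => ?_⟩
  -- Multidegrees are attached to rows, so the determinant is transposed to let each product run
  -- over the rows.
  rw [← Matrix.det_transpose, Matrix.det_apply]
  refine IsWeightedHomogeneous.sum _ _ _ fun σ _ => ?_
  have h : (∏ a, A.transpose (σ a) a).IsWeightedHomogeneous
      (fun v : Fin n × Fin 3 => if v.1 = i then 1 else 0) (∑ a, e a i) :=
    IsWeightedHomogeneous.prod _ _ _ fun a _ => hA a (σ a) i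
  rcases Int.units_eq_one_or (Equiv.Perm.sign σ) with hσ | hσ
  · rw [hσ, one_smul]; exact h
  · rw [hσ, Units.neg_smul, one_smul]; exact h.neg

theorem IsMultihomogeneous.mul {Φ Ψ : MvPolynomial (Fin n × Fin 3) k} (hΦ : IsMultihomogeneous Φ)
    (hΨ : IsMultihomogeneous Ψ) : IsMultihomogeneous (Φ * Ψ) := by
  obtain ⟨d, hd⟩ := hΦ
  obtain ⟨e, he⟩ := hΨ
  exact ⟨fun i => d i + e i, fun i => (hd i).mul (he i)⟩

theorem isWeightedHomogeneous_rename {f : MvPolynomial (Fin 3) k} {d : ℕ} (hf : f.IsHomogeneous d)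
    (a i : Fin n) : (rename (fun j => (a, j)) f).IsWeightedHomogeneous
      (fun v : Fin n × Fin 3 => if v.1 = i then 1 else 0) (if a = i then d else 0) := by
  classical
  rw [← f.support_sum_monomial_coeff, map_sum]
  refine IsWeightedHomogeneous.sum _ _ _ fun m hm => ?_
  rw [rename_monomial]
  refine isWeightedHomogeneous_monomial _ _ _ ?_
  rw [Finsupp.weight_apply, Finsupp.sum_mapDomain_index (by simp) fun v m₁ m₂ => by
    rw [smul_eq_mul, smul_eq_mul, smul_eq_mul, add_mul]]
  have := hf (mem_support_iff.1 hm)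
  rw [Finsupp.weight_apply] at this
  by_cases h : a = i
  · simpa [h] using this
  · simp [h]

/-- The functional `row v s j`, with `v` the generic point of the `a`-th factor. -/
def genericRow (s j : Fin 3) (a : Fin n) (f : MvPolynomial (Fin 3) k) :
    MvPolynomial (Fin n × Fin 3) k :=
  rename (fun l => (a, l)) (if j = s then f else pderiv j f)

theorem isWeightedHomogeneous_genericRow {f : MvPolynomial (Fin 3) k} {d : ℕ}
    (hf : f.IsHomogeneous d) (s j : Fin 3) (a i : Fin n) :
    (genericRow s j a f).IsWeightedHomogeneous
      (fun v : Fin n × Fin 3 => if v.1 = i then 1 else 0)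
      (if a = i then if j = s then d else d - 1 else 0) := by
  rw [genericRow]
  refine isWeightedHomogeneous_rename ?_ a i
  split_ifs
  · exact hf
  · exact hf.pderiv

theorem eval_genericRow (p : Fin n → Plane k) (s j : Fin 3) (a : Fin n)
    (f : MvPolynomial (Fin 3) k) :
    eval (fun v : Fin n × Fin 3 => (p v.1).rep v.2) (genericRow s j a f) =
      row (p a).rep s j f := by
  rw [genericRow, eval_rename]
  by_cases h : j = s
  · subst h; rw [if_pos rfl, row_self]; rfl
  · rw [if_neg h, row_of_ne _ h]; rfl

theorem isZariskiClosed_zeroLocus {Φ : MvPolynomial (Fin n × Fin 3) k}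
    (hΦ : IsMultihomogeneous Φ) : IsZariskiClosed
      {p : Fin n → Plane k | eval (fun v : Fin n × Fin 3 => (p v.1).rep v.2) Φ = 0} :=
  ⟨{Φ}, by simpa using hΦ, by simp⟩

end Multihomogeneous

section General

variable {F : MvPolynomial (Fin 3) k} {t : ℕ}

theorem hilb_van_of_forall_dvd (hF : F.IsHomogeneous 3) (hp : Prime F) (ht : 0 < t)
    {X : Finset (Plane k)} (hX : ∀ p ∈ X, OnCurve F p)
    (h : ∀ f ∈ van X, f.IsHomogeneous t → F ∣ f) : hilb (van X) t = 3 * t := by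
  have := (isCurveScheme_van hX).hilb_of_forall_dvd hF hp fun f hf hfI => h f hfI hf
  rwa [if_neg ht.ne'] at this

/-- The square of a form through X is singular along X, so it falls under the assumption in degree
2t; F is prime. -/
theorem dvd_of_mem_van {X : Finset (Plane k)} (hp : Prime F)
    (h : ∀ f ∈ tan F X, f.IsHomogeneous (2 * t) → F ∣ f) :
    ∀ f ∈ van X, f.IsHomogeneous t → F ∣ f := by
  intro f hfI hf
  refine hp.dvd_of_dvd_pow (n := 2) (h _ (fun p hpX => ?_) (by rw [mul_comm]; exact hf.pow 2))
  have h0 : eval p.rep f = 0 := hfI p hpX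
  exact ⟨by rw [map_pow, h0]; ring, 0, fun i => by
    simp only [pow_two, pderiv_mul, map_add, map_mul, h0]; ring⟩

theorem hilb_tan_of_forall_dvd (hF : F.IsHomogeneous 3) (hp : Prime F) (ht : 0 < t)
    {X : Finset (Plane k)} (hX : ∀ p ∈ X, IsSmoothPoint F p)
    (h : ∀ f ∈ tan F X, f.IsHomogeneous (2 * t) → F ∣ f) : hilb (tan F X) (2 * t) = 6 * t := by
  have := (isCurveScheme_tan hF hX).hilb_of_forall_dvd hF hp fun f hf hfI => h f hfI hf
  rw [if_neg (by omega)] at this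
  omega

variable [IsAlgClosed k]

theorem exists_points_endsThree (hF : F.IsHomogeneous 3) (hp : Prime F) (hs : IsSmoothCurve F)
    (ht : 5 < t) : ∃ X : Finset (Plane k), X.card = 3 * t ∧ (∀ p ∈ X, OnCurve F p) ∧
      IsReducedProfile t 0 (diffHilb 1 X) ∧ hilb (tan F X) (2 * t) = 6 * t := by
  obtain ⟨X, hcard, hX, h⟩ := exists_points_forall_dvd hF hp hs ht
  exact ⟨X, hcard, hX, isReducedProfile_zero hF hp ht hcard hX
    (hilb_van_of_forall_dvd hF hp (by omega) hX (dvd_of_mem_van hp h)).ge,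
    hilb_tan_of_forall_dvd hF hp (by omega) (fun p hpX => hs p (hX p hpX)) h⟩

theorem hilb_dbl_two_mul (hF : F.IsHomogeneous 3) (hp : Prime F) (ht : 5 < t)
    {X : Finset (Plane k)} (hcard : X.card = 3 * t) (hX : ∀ p ∈ X, IsSmoothPoint F p)
    (hprof : IsReducedProfile t 0 (diffHilb 1 X)) :
    hilb (dbl X) (2 * t) = 3 * t + hilb (tan F X) (2 * t) := by
  have h := (hilb_dbl_of_profile hF hp (by norm_num) (by omega) hcard hX hprof).2.2.2 (2 * t - 3)
  rwa [show 2 * t - 3 + 3 = 2 * t by omega, (isCurveScheme_van fun p hpX => (hX p hpX).1).hilb_of_gt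
    hF hp (by omega) (by omega), hcard] at h

/-- Semicontinuity from one example: two determinants that are nonzero at the example cut out the
open set, and on it both Hilbert functions attain their upper bounds. -/
theorem forGeneralPoints_endsThree (hF : F.IsHomogeneous 3) (hp : Prime F) (hs : IsSmoothCurve F)
    (ht : 5 < t) : ForGeneralPoints F (3 * t) (fun p =>
      Function.Injective p ∧ ∀ X : Finset (Plane k), (X : Set _) = Set.range p →
        IsReducedProfile t 0 (diffHilb 1 X) ∧ EndsThree t (diffHilb 2 X)) := by
  classical
  obtain ⟨X₀, hcard₀, hX₀, hprof₀, htan₀⟩ := exists_points_endsThree hF hp hs ht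
  set q : Fin (3 * t) → Plane k := fun i => (X₀.equivFinOfCardEq hcard₀).symm i with hq
  have hqX : ∀ i, q i ∈ X₀ := fun i => ((X₀.equivFinOfCardEq hcard₀).symm i).2
  have hXq : ∀ P : Plane k → Prop, (∀ p ∈ X₀, P p) ↔ ∀ i, P (q i) := fun P =>
    ⟨fun h i => h _ (hqX i), fun h p hpX => by
      simpa [hq] using h (X₀.equivFinOfCardEq hcard₀ ⟨p, hpX⟩)⟩
  have hvan₀ : hilb (van X₀) t = 3 * t := by
    have := ((isReducedProfile_iff (by omega)).1 hprof₀).2.1 t (by omega) le_rfl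
    exact this
  have hdbl₀ : hilb (dbl X₀) (2 * t) = 9 * t := by
    rw [hilb_dbl_two_mul hF hp ht hcard₀ (fun p hpX => hs p (hX₀ p hpX)) hprof₀, htan₀]
    ring
  -- The charts are those of the example and stay fixed. At another tuple such a coordinate may
  -- vanish, which is harmless since only a lower bound is drawn there.
  set s : Fin (3 * t) → Fin 3 := fun i => chart (q i) with hsdef
  -- The forms G and H are dual to the conditions at the example, so both matrices become the
  -- identity there.
  choose G hG hGrow using fun l : Fin (3 * t) =>
    surjective_of_hilb_eq_card (I := van X₀) (fun i : Fin (3 * t) => row (q i).rep 0 0)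
      (fun f _ => by simp only [row_self]; exact hXq fun p => eval p.rep f = 0)
      (by rw [hvan₀, Fintype.card_fin]) (Pi.single l 1)
  choose H hH hHrow using fun m : Fin (3 * t) × Fin 3 =>
    surjective_of_hilb_eq_card (I := dbl X₀)
      (fun a : Fin (3 * t) × Fin 3 => row (q a.1).rep (s a.1) a.2)
      (fun f hf => by
        rw [mem_dbl, hXq fun p => eval p.rep f = 0 ∧ ∀ i, eval p.rep (pderiv i f) = 0, Prod.forall]
        exact forall_congr' fun i => (rows_eq_zero_iff hf (rep_chart (q i))).symm)
      (by rw [hdbl₀, Fintype.card_prod, Fintype.card_fin, Fintype.card_fin]; ring) (Pi.single m 1)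
  set A : Matrix (Fin (3 * t)) (Fin (3 * t)) (MvPolynomial (Fin (3 * t) × Fin 3) k) :=
    Matrix.of fun i l => genericRow 0 0 i (G l) with hA
  set B : Matrix (Fin (3 * t) × Fin 3) (Fin (3 * t) × Fin 3)
      (MvPolynomial (Fin (3 * t) × Fin 3) k) :=
    Matrix.of fun a m => genericRow (s a.1) a.2 a.1 (H m) with hB
  have evalA : ∀ p : Fin (3 * t) → Plane k,
      eval (fun v : Fin (3 * t) × Fin 3 => (p v.1).rep v.2) A.det =
        (Matrix.of fun i l => row (p i).rep 0 0 (G l)).det := fun p => by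
    rw [RingHom.map_det]
    congr 1
    ext i l
    exact eval_genericRow p 0 0 i (G l)
  have evalB : ∀ p : Fin (3 * t) → Plane k,
      eval (fun v : Fin (3 * t) × Fin 3 => (p v.1).rep v.2) B.det =
        (Matrix.of fun (a m : Fin (3 * t) × Fin 3) => row (p a.1).rep (s a.1) a.2 (H m)).det :=
      fun p => by
    rw [RingHom.map_det]
    congr 1
    ext a m
    exact eval_genericRow p (s a.1) a.2 a.1 (H m)
  have hAhom : IsMultihomogeneous A.det :=
    isMultihomogeneous_det A _ fun a b i => isWeightedHomogeneous_genericRow (hG b) 0 0 a i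
  have hBhom : IsMultihomogeneous B.det :=
    isMultihomogeneous_det B _ fun a b i =>
      isWeightedHomogeneous_genericRow (hH b) (s a.1) a.2 a.1 i
  refine ⟨_, isZariskiClosed_zeroLocus (hAhom.mul hBhom), ⟨q, fun i => hX₀ _ (hqX i), ?_⟩, ?_⟩
  · have h1 : (Matrix.of fun i l => row (q i).rep 0 0 (G l)) = 1 := by
      ext i l
      rw [Matrix.of_apply, hGrow, Matrix.one_apply, Pi.single_apply]
    have h2 : (Matrix.of fun (a m : Fin (3 * t) × Fin 3) =>
        row (q a.1).rep (s a.1) a.2 (H m)) = 1 := by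
      ext a m
      rw [Matrix.of_apply, hHrow, Matrix.one_apply, Pi.single_apply]
    rw [Set.mem_ofPred_eq, map_mul, evalA, evalB, h1, h2, Matrix.det_one, Matrix.det_one, one_mul]
    exact one_ne_zero
  · intro p hpF hpS
    rw [Set.mem_ofPred_eq, map_mul, evalA, evalB, mul_eq_zero, not_or] at hpS
    obtain ⟨hdetA, hdetB⟩ := hpS
    -- Coinciding points would give equal rows in the first matrix.
    have hinj : Function.Injective p := by
      intro i j hij
      by_contra hne
      exact hdetA (Matrix.det_zero_of_row_eq hne (by ext l; simp only [Matrix.of_apply, hij]))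
    refine ⟨hinj, fun X hX => ?_⟩
    have hmem : ∀ i, p i ∈ X := fun i => by
      rw [← Finset.mem_coe, hX]; exact Set.mem_range_self i
    have hcard : X.card = 3 * t := by
      rw [← Set.ncard_coe_finset, hX, ← Set.image_univ, Set.ncard_image_of_injective _ hinj,
        Set.ncard_univ, Nat.card_fin]
    have hXF : ∀ x ∈ X, OnCurve F x := fun x hx => by
      rw [← Finset.mem_coe, hX] at hx
      obtain ⟨i, rfl⟩ := hx
      exact hpF i
    have hXs : ∀ x ∈ X, IsSmoothPoint F x := fun x hx => hs x (hXF x hx)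
    have hvan := card_le_hilb (I := van X) (fun i : Fin (3 * t) => row (p i).rep 0 0)
      (fun f hf _ i => by rw [row_self]; exact hf _ (hmem i)) G hG hdetA
    rw [Fintype.card_fin] at hvan
    have hdbl := card_le_hilb (I := dbl X)
      (fun a : Fin (3 * t) × Fin 3 => row (p a.1).rep (s a.1) a.2)
      (fun f hf _ a => row_eq_zero (hf _ (hmem a.1)).1 (hf _ (hmem a.1)).2 _ _) H hH hdetB
    rw [Fintype.card_prod, Fintype.card_fin, Fintype.card_fin] at hdbl
    have hprof := isReducedProfile_zero hF hp ht hcard hXF hvan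
    have h1 := hilb_dbl_two_mul hF hp ht hcard hXs hprof
    have h2 := (isCurveScheme_tan hF hXs).hilb_le (2 * t)
    -- From 9t ≤ h_{2X}(2t) = 3t + h_tan(2t) and h_tan(2t) ≤ 6t, equality follows.
    exact ⟨hprof, (double_profile hF hp (by norm_num) (by omega) hcard hXs hprof).2.2.1 rfl
      (by omega)⟩

end General

end FatPoints

end

theorem theorem3p3 (k : Type*) [Field k] [IsAlgClosed k] :
    -- `Δh` of the double points on points of an irreducible cubic, none of them singular on it
    (∀ F : MvPolynomial (Fin 3) k, FatPoints.IsIrreducibleCubic F →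
      ∀ t δ : ℕ, δ ≤ 2 → 5 < t + δ →
      ∀ X : Finset (FatPoints.Plane k), X.card = 3 * t + δ →
        (∀ p ∈ X, FatPoints.IsSmoothPoint F p) →
        FatPoints.IsReducedProfile t δ (FatPoints.diffHilb 1 X) →
          FatPoints.IsDoubleProfile t δ (FatPoints.diffHilb 2 X) ∧
          (δ = 1 ∨ δ = 2 → FatPoints.diffHilb 2 X (2 * t + δ) = 3 - δ ∧
            ∀ d, 2 * t + δ < d → FatPoints.diffHilb 2 X d = 0) ∧
          (δ = 0 → FatPoints.EndsThree t (FatPoints.diffHilb 2 X) ∨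
            FatPoints.EndsTwoOne t (FatPoints.diffHilb 2 X))) ∧
    -- for `δ = 0` the first ending occurs, on a smooth cubic
    (∀ t : ℕ, 5 < t → ∃ (F : MvPolynomial (Fin 3) k) (X : Finset (FatPoints.Plane k)),
      FatPoints.IsIrreducibleCubic F ∧ FatPoints.IsSmoothCurve F ∧ X.card = 3 * t ∧
      (∀ p ∈ X, FatPoints.OnCurve F p) ∧
      FatPoints.IsReducedProfile t 0 (FatPoints.diffHilb 1 X) ∧
      FatPoints.EndsThree t (FatPoints.diffHilb 2 X)) ∧
    -- for `δ = 0` the second ending occurs, on a smooth cubic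
    (∀ t : ℕ, 5 < t → ∃ (F : MvPolynomial (Fin 3) k) (X : Finset (FatPoints.Plane k)),
      FatPoints.IsIrreducibleCubic F ∧ FatPoints.IsSmoothCurve F ∧ X.card = 3 * t ∧
      (∀ p ∈ X, FatPoints.OnCurve F p) ∧
      FatPoints.IsReducedProfile t 0 (FatPoints.diffHilb 1 X) ∧
      FatPoints.EndsTwoOne t (FatPoints.diffHilb 2 X)) ∧
    -- for `δ = 0` and general points on any smooth cubic the first ending occurs
    (∀ F : MvPolynomial (Fin 3) k, FatPoints.IsIrreducibleCubic F → FatPoints.IsSmoothCurve F →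
      ∀ t : ℕ, 5 < t → FatPoints.ForGeneralPoints F (3 * t) (fun p =>
        Function.Injective p ∧ ∀ X : Finset (FatPoints.Plane k), (X : Set _) = Set.range p →
          FatPoints.IsReducedProfile t 0 (FatPoints.diffHilb 1 X) ∧
          FatPoints.EndsThree t (FatPoints.diffHilb 2 X))) := by
  refine ⟨fun F hF t δ hδ ht X hcard hX hprof => ?_, fun t ht => ?_, fun t ht => ?_,
    fun F hF hs t ht => FatPoints.forGeneralPoints_endsThree hF.1 hF.2.prime hs ht⟩
  · obtain ⟨h1, h2, h3, h4⟩ := FatPoints.double_profile hF.1 hF.2.prime hδ ht hcard hX hprof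
    refine ⟨h1, h2, fun h0 => ?_⟩
    subst h0
    exact (FatPoints.hilb_tan_dichotomy hF.1 hF.2.prime ht hcard hX).imp (h3 rfl) (h4 rfl)
  · obtain ⟨b, hb, hb'⟩ := FatPoints.exists_smooth_parameter k
    have hs := FatPoints.isSmoothCurve_cubic hb hb'
    have hF := FatPoints.isHomogeneous_cubic b
    have hirr := FatPoints.irreducible_of_smooth hF (FatPoints.cubic_ne_zero b) hs
    obtain ⟨X, hcard, hX, hprof, htan⟩ := FatPoints.exists_points_endsThree hF hirr.prime hs ht
    exact ⟨_, X, ⟨hF, hirr⟩, hs, hcard, hX, hprof,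
      (FatPoints.double_profile hF hirr.prime (by norm_num) ht hcard (fun p hp => hs p (hX p hp))
        hprof).2.2.1 rfl htan⟩
  · obtain ⟨b, hb, hb'⟩ := FatPoints.exists_smooth_parameter k
    have hs := FatPoints.isSmoothCurve_cubic hb hb'
    have hF := FatPoints.isHomogeneous_cubic b
    have hirr := FatPoints.irreducible_of_smooth hF (FatPoints.cubic_ne_zero b) hs
    obtain ⟨X, hcard, hX, hvan, f, hfI, hf, hFf⟩ := FatPoints.exists_points_cubic hb hb' ht
    have hXs := fun p hp => hs p (hX p hp)
    have hprof := FatPoints.isReducedProfile_zero hF hirr.prime ht hcard hX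
      (FatPoints.hilb_van_of_forall_dvd hF hirr.prime (by omega) hX hvan).ge
    have htan := (FatPoints.isCurveScheme_tan hF hXs).hilb_of_exists_not_dvd hF hirr.prime
      (by omega) (by omega) hf hfI hFf
    exact ⟨_, X, ⟨hF, hirr⟩, hs, hcard, hX, hprof,
      (FatPoints.double_profile hF hirr.prime (by norm_num) ht hcard hXs hprof).2.2.2 rfl
        (by omega)⟩
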